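/- Let $\mathbb K$ be an evenly graded commutative ring containing $\mathbb Q$ (all odd components vanish; for instance a commutative $\mathbb Q$-algebra in degree $0$), and let $V$ be a free graded $\mathbb K$-module with homogeneous basis $(v_i)_{i\in I}$. Put $W=\Sigma V^*=(\Sigma V)^*$, where $(\Sigma V)^n=V^{n+1}$; it is a profinite graded module with topological basis $t_i$ of degree $1-|v_i|$ dual to $\Sigma v_i$. Let $\widehat TW=\prod_{n\ge 0}W^{\hat\otimes n}$ be the completed tensor algebra (noncommutative power series in the $t_i$), $\widehat T_+W=\prod_{n\ge 1}W^{\hat\otimes n}$, and let $\widehat LW\subset\widehat TW$ be the completed free Lie algebra, the closed submodule generated by $W$ under the graded commutator. A $C_\infty$-structure on $V$ is a continuous derivation $m$ of $\widehat LW$ of degree $1$ with $m^2=0$; it extends uniquely to a continuous derivation $m$ of $\widehat TW$. *One-forms and complexes.* Below, $d$ has degree one in the differential envelopes and $|\omega|$ is the degree there. $DR^1_{\rm Ass}$ is the quotient of the module of one-forms $\widehat TW\hat\otimes(\widehat TW/\mathbb K)$, $x\otimes y=x\cdot dy$, with the bimodule structure given by the Leibniz rule, by the closed submodule generated by the graded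 commutators of functions and one-forms. $DR^1_{\rm Lie}$ is the quotient of $\Omega^1_{\rm Lie}\hat\otimes\widehat LW$ by the relations $\omega\otimes[y,z]=[\omega,y]\otimes z$, where $\Omega^1_{\rm Lie}$ is the left module over $\widehat{\mathcal U}(\widehat LW)=\widehat TW$ generated by the symbols $da$, $a\in\widehat LW$, subject to linearity, continuity and $d[a,b]=(-1)^{|a|}a\cdot db-(-1)^{(|a|+1)|b|}b\cdot da$, and where $[y,\omega]=y\cdot\omega$, $[\omega,y]=-(-1)^{|\omega||y|}y\cdot\omega$. The Lie derivative $L_m$, given by $L_m(x)=m(x)$, $L_m(dx)=-d(m(x))$ and the Leibniz rule, acts on both modules. The Harrison complex of $V$ with coefficients in $V^*$ is $C_{\rm Harr}(V,V^*)=(\Sigma DR^1_{\rm Lie},L_m)$ and the Hochschild complex is $C_{\rm Hoch}(V,V^*)=(\Sigma DR^1_{\rm Ass},L_m)$. Let $l:DR^1_{\rm Lie}\to DR^1_{\rm Ass}$ be the continuous linear map with $l\big((g_1\cdots g_k\cdot da)\otimes z\big)=[g_1,[g_2,\dots,[g_k,da]]]\cdot z$ for homogeneous $g_i,a\in\widehat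 LW$ and $z\in\widehat LW$. *Hodge decomposition.* Let $\Delta$ be the shuffle coproduct on $\widehat TW$ (the continuous algebra homomorphism for which the elements of $W$ are primitive), $\mu$ the multiplication, $s=\mu\Delta$, $s_n$ the restriction of $s$ to $W^{\hat\otimes n}$, and $\lambda_r=2^r$. Let $e_n(j)=\prod_{0\le r\le n,\ r\ne j}(\lambda_j-\lambda_r)^{-1}(s_n-\lambda_r)$ for $0\le j\le n$ and $e_n(j)=0$ for $j>n$. Let $e(j)$ be the operator on $\widehat TW$ with components $e_n(j)$, and let $\tilde e(j)=1\hat\otimes e(j)$ on $W\hat\otimes\widehat TW$. Let $\Theta:W\hat\otimes\widehat TW\to DR^1_{\rm Ass}$, $\Theta(x\otimes y)=dx\cdot y$, and let $C_{(1)}(V,V^*)\subset C_{\rm Hoch}(V,V^*)$ be the image under $\Theta$ of $\Sigma\big(\tilde e(1)[W\hat\otimes\widehat TW]\big)$. **Proposition.** Let $V$ be a $C_\infty$-algebra as above. 1. $e(1)[\widehat T_+W]=\widehat LW$. 2. The Harrison and the Hochschild complex are complexes (with differential of degree one), $\Theta$ is bijective, and $C_{(1)}(V,V^*)$ is a subcomplex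 of $C_{\rm Hoch}(V,V^*)$. 3. The map $l$ exists, is unique, preserves degrees and commutes with the differentials. It is an isomorphism of topological complexes from $C_{\rm Harr}(V,V^*)$ onto $C_{(1)}(V,V^*)$; equivalently, $\Theta^{-1}\circ l$ is an isomorphism of $C_{\rm Harr}(V,V^*)$ with $\big(\Sigma(\tilde e(1)[W\hat\otimes\widehat TW]),\Theta^{-1}L_m\Theta\big)$. 4. $l$ is split: there is a continuous degree-preserving linear map $r$ from the Hochschild complex to the Harrison complex that commutes with the differentials and satisfies $r\circ l=\mathrm{id}$. -/

import Mathlib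

namespace FormalGeom

/-! ## Signs and degrees -/

/-- The sign `(-1)^n` as an element of the ground ring. -/
def sgn (K : Type*) [CommRing K] (n : ℤ) : K := ((n.negOnePow : ℤˣ) : ℤ)

/-- An evenly graded ring: a graded ring whose odd components vanish. -/
class EvenlyGraded {K : Type*} [CommRing K] (𝒦 : ℤ → AddSubgroup K) : Prop where
  odd_eq_bot : ∀ n : ℤ, Odd n → 𝒦 n = ⊥

/-- The degree of the monomial `t_{i₁} ⋯ t_{iₙ}`, where `t_i` has degree `d i`. -/
def wdeg {I : Type*} (d : I → ℤ) (w : List I) : ℤ := (w.map d).sum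

/-- For a free graded module `V` with homogeneous basis `v_i` of degrees `vdeg i`, the degrees of
the topological basis `t_i` of `(Σ V)^*` dual to the basis `Σ v_i` of `Σ V`.  Since
`(Σ V)^n = V^(n+1)`, the vector `Σ v_i` has degree `vdeg i - 1`. -/
def suspDualDeg {I : Type*} (vdeg : I → ℤ) : I → ℤ := fun i => 1 - vdeg i

section Sgn
variable {K : Type*} [CommRing K]

lemma sgn_zero : sgn K 0 = 1 := by simp [sgn]

lemma sgn_add (a b : ℤ) : sgn K (a + b) = sgn K a * sgn K b := by
  simp [sgn, Int.negOnePow_add]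

lemma sgn_one : sgn K 1 = -1 := by simp [sgn]

lemma sgn_even {n : ℤ} (h : Even n) : sgn K n = 1 := by simp [sgn, Int.negOnePow_even n h]

lemma sgn_odd {n : ℤ} (h : Odd n) : sgn K n = -1 := by simp [sgn, Int.negOnePow_odd n h]

lemma sgn_sq (n : ℤ) : sgn K n * sgn K n = 1 := by
  rw [← sgn_add]; exact sgn_even ⟨n, rfl⟩

lemma wdeg_nil {I : Type*} (d : I → ℤ) : wdeg d [] = 0 := rfl

lemma wdeg_cons {I : Type*} (d : I → ℤ) (i : I) (w : List I) :
    wdeg d (i :: w) = d i + wdeg d w := by simp [wdeg]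

lemma wdeg_append {I : Type*} (d : I → ℤ) (u v : List I) :
    wdeg d (u ++ v) = wdeg d u + wdeg d v := by simp [wdeg]
end Sgn

/-! ## Formal modules

A profinite graded module with topological basis indexed by `X` is the module `X → K` of all
infinite linear combinations of basis elements.  It carries the inverse limit topology, which is
the product topology for the discrete topology of `K`.  If the basis element of index `x` has degree
`dX x` then a series is homogeneous of degree `n` when its coefficient at `x` lies in
`K^(n - dX x)`. The completed tensor product of `X → K` and `Y → K` is `X × Y → K`. -/

/-- The homogeneous elements of degree `n`. -/
def homog {K : Type*} [CommRing K] (𝒦 : ℤ → AddSubgroup K) {X : Type*} (dX : X → ℤ) (n : ℤ) :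
    AddSubgroup (X → K) where
  carrier := {f | ∀ x, f x ∈ 𝒦 (n - dX x)}
  add_mem' hf hg x := (𝒦 _).add_mem (hf x) (hg x)
  zero_mem' _ := (𝒦 _).zero_mem
  neg_mem' hf x := (𝒦 _).neg_mem (hf x)

/-- The elementary tensor `f ⊗ g`. -/
def tens {K X Y : Type*} [CommRing K] (f : X → K) (g : Y → K) : X × Y → K :=
  fun p => f p.1 * g p.2

/-- The submodule topologically generated by a set: all convergent infinite linear combinations. -/
def closedSpan {K X : Type*} [CommRing K] [TopologicalSpace K] [DiscreteTopology K]
    (S : Set (X → K)) : Submodule K (X → K) := (Submodule.span K S).topologicalClosure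

/-! ## The completed tensor algebra

For the module `W` with topological basis `t_i`, `i : I`, the completed tensor algebra of `W` is the
algebra `K⟨⟨t⟩⟩` of noncommutative formal power series: functions on words in the alphabet `I`. -/

/-- The sum of `F u v` over all ways to write the word `w` as a concatenation `u ++ v`. -/
def splitSum {I A : Type*} [AddCommMonoid A] (F : List I → List I → A) (w : List I) : A :=
  ∑ k ∈ Finset.range (w.length + 1), F (w.take k) (w.drop k)

/-- The multiplication `μ` of the completed tensor algebra, on the completed tensor square. -/
def mulMap {K I : Type*} [CommRing K] (F : List I × List I → K) : List I → K :=
  fun w => splitSum (fun u v => F (u, v)) w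

/-- The product of two noncommutative power series. -/
def cmul {K I : Type*} [CommRing K] (f g : List I → K) : List I → K := mulMap (tens f g)

/-- The power series `1`. -/
def one {K I : Type*} [CommRing K] : List I → K
  | [] => 1
  | _ :: _ => 0

/-- The element `∑ g_i t_i` of `W`, as a power series. -/
def orderOne {K I : Type*} [CommRing K] (g : I → K) : List I → K
  | [i] => g i
  | _ => 0

/-- The graded commutator `[f, g] = f g - (-1)^(|f||g|) g f`, extended to all series by
bilinearity and continuity. -/
def bracket {K I : Type*} [CommRing K] (d : I → ℤ) (f g : List I → K) : List I → K :=
  fun w => splitSum (fun u v => f u * g v - sgn K (wdeg d u * wdeg d v) * (g u * f v)) w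

/-- The parity automorphism: `f ↦ (-1)^|f| f` for homogeneous `f`. -/
def parityOp {K I : Type*} [CommRing K] (d : I → ℤ) (f : List I → K) : List I → K :=
  fun w => sgn K (wdeg d w) * f w

/-- The completed free Lie algebra: the smallest closed submodule of the completed tensor algebra
that contains `W` and is closed under the graded commutator. -/
def freeLie (K : Type*) {I : Type*} [CommRing K] [TopologicalSpace K] [DiscreteTopology K]
    (d : I → ℤ) : Submodule K (List I → K) :=
  sInf {N | (∀ g : I → K, orderOne g ∈ N) ∧ (∀ f ∈ N, ∀ g ∈ N, bracket d f g ∈ N) ∧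
    IsClosed (N : Set (List I → K))}

section FreeLie
variable {K I : Type*} [CommRing K] [TopologicalSpace K] [DiscreteTopology K] {d : I → ℤ}

lemma orderOne_mem_freeLie (g : I → K) : orderOne g ∈ freeLie K d :=
  Submodule.mem_sInf.2 fun _ hN => hN.1 g

lemma bracket_mem_freeLie {f g : List I → K} (hf : f ∈ freeLie K d) (hg : g ∈ freeLie K d) :
    bracket d f g ∈ freeLie K d :=
  Submodule.mem_sInf.2 fun N hN =>
    hN.2.1 f (Submodule.mem_sInf.1 hf N hN) g (Submodule.mem_sInf.1 hg N hN)

lemma isClosed_freeLie : IsClosed (freeLie K d : Set (List I → K)) := by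
  rw [freeLie, Submodule.coe_sInf]
  exact isClosed_biInter fun N hN => hN.2.2

lemma freeLie_le {N : Submodule K (List I → K)} (h1 : ∀ g : I → K, orderOne g ∈ N)
    (h2 : ∀ f ∈ N, ∀ g ∈ N, bracket d f g ∈ N) (h3 : IsClosed (N : Set (List I → K))) :
    freeLie K d ≤ N :=
  sInf_le ⟨h1, h2, h3⟩
end FreeLie

/-- A `C_∞`-structure on the free graded module with homogeneous basis of degrees `vdeg`: a
continuous derivation `m` of degree one of the completed free Lie algebra on `(Σ V)^*` with
`m² = 0`.  The derivation property reads `m [f, g] = [m f, g] + (-1)^|f| [f, m g]`. -/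
structure CInfinityStructure {K : Type*} [CommRing K] [TopologicalSpace K] [DiscreteTopology K]
    (𝒦 : ℤ → AddSubgroup K) {I : Type*} (vdeg : I → ℤ) where
  m : freeLie K (suspDualDeg vdeg) →L[K] freeLie K (suspDualDeg vdeg)
  derivation : ∀ f g : freeLie K (suspDualDeg vdeg),
    (m ⟨bracket (suspDualDeg vdeg) f g, bracket_mem_freeLie f.2 g.2⟩ : List I → K) =
      bracket (suspDualDeg vdeg) (m f) g +
        bracket (suspDualDeg vdeg) (parityOp (suspDualDeg vdeg) f) (m g)
  degree_one : ∀ (n : ℤ) (f : freeLie K (suspDualDeg vdeg)),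
    (f : List I → K) ∈ homog 𝒦 (wdeg (suspDualDeg vdeg)) n →
      (m f : List I → K) ∈ homog 𝒦 (wdeg (suspDualDeg vdeg)) (n + 1)
  sq_zero : ∀ f, m (m f) = 0

/-! ## Extension of a vector field to the completed tensor algebra -/

section SplitSum
variable {I A B : Type*} [AddCommMonoid A]

lemma splitSum_nil (F : List I → List I → A) : splitSum F [] = F [] [] := by simp [splitSum]

lemma splitSum_cons (F : List I → List I → A) (j : I) (w : List I) :
    splitSum F (j :: w) = F [] (j :: w) + splitSum (fun u v => F (j :: u) v) w := by
  unfold splitSum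
  rw [List.length_cons, Finset.sum_range_succ', add_comm]
  simp

lemma splitSum_add (F G : List I → List I → A) (w : List I) :
    splitSum (fun u v => F u v + G u v) w = splitSum F w + splitSum G w := by
  simp [splitSum, Finset.sum_add_distrib]

lemma splitSum_congr {F G : List I → List I → A} {w : List I}
    (h : ∀ u v, u ++ v = w → F u v = G u v) : splitSum F w = splitSum G w :=
  Finset.sum_congr rfl fun k _ => h _ _ (List.take_append_drop k w)

lemma map_splitSum [AddCommMonoid B] {Φ : Type*} [FunLike Φ A B] [AddMonoidHomClass Φ A B]
    (φ : Φ) (F : List I → List I → A) (w : List I) :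
    φ (splitSum F w) = splitSum (fun u v => φ (F u v)) w := by
  simp [splitSum, map_sum]

lemma splitSum_sub {A : Type*} [AddCommGroup A] (F G : List I → List I → A) (w : List I) :
    splitSum (fun u v => F u v - G u v) w = splitSum F w - splitSum G w := by
  simp [splitSum, Finset.sum_sub_distrib]

lemma mul_splitSum {R : Type*} [CommRing R] (c : R) (F : List I → List I → R) (w : List I) :
    c * splitSum F w = splitSum (fun u v => c * F u v) w := by
  simp [splitSum, Finset.mul_sum]

lemma splitSum_mul {R : Type*} [CommRing R] (c : R) (F : List I → List I → R) (w : List I) :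
    splitSum F w * c = splitSum (fun u v => F u v * c) w := by
  simp [splitSum, Finset.sum_mul]

lemma splitSum_assoc (G : List I → List I → List I → A) (w : List I) :
    splitSum (fun u v => splitSum (fun v₁ v₂ => G u v₁ v₂) v) w =
      splitSum (fun u v => splitSum (fun u₁ u₂ => G u₁ u₂ v) u) w := by
  induction w generalizing G with
  | nil => simp [splitSum_nil]
  | cons j w ih =>
    rw [splitSum_cons, splitSum_cons (fun v₁ v₂ => G [] v₁ v₂), ih (fun u => G (j :: u)),
      splitSum_cons, splitSum_nil]
    simp only [splitSum_cons, splitSum_add]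
    rw [add_assoc]

lemma splitSum_apply {X : Type*} (F : List I → List I → X → A) (w : List I) (x : X) :
    splitSum F w x = splitSum (fun u v => F u v x) w := by
  simp [splitSum]

lemma splitSum_zero (w : List I) : splitSum (fun _ _ : List I => (0 : A)) w = 0 := by
  simp [splitSum]

lemma splitSum_eq_self {F : List I → List I → A} (h : ∀ u j v, F u (j :: v) = 0) (w : List I) :
    splitSum F w = F w [] := by
  induction w generalizing F with
  | nil => simp [splitSum_nil]
  | cons j w ih => rw [splitSum_cons, h, zero_add, ih (F := fun u v => F (j :: u) v)]; simp [h]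

end SplitSum

section ExtDer
variable {K I : Type*} [CommRing K] [TopologicalSpace K] [DiscreteTopology K]

/-- The continuous derivation of the completed tensor algebra that extends the odd map `θ` from `W`,
`M (t_{i₁} ⋯ t_{iₙ}) = ∑ₖ (-1)^(|t_{i₁}| + ⋯ + |t_{iₖ₋₁}|) t_{i₁} ⋯ θ(t_{iₖ}) ⋯ t_{iₙ}`,
extended by continuity: the coefficient at `w` sums, over `w = a ++ c ++ b`, the coefficient at `c`
of `±θ (∑ᵢ f(a i b) t_i)`. -/
def extDer (d : I → ℤ) (θ : (I → K) →L[K] (List I → K)) : (List I → K) →L[K] (List I → K) where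
  toFun f w := splitSum (fun a r => splitSum (fun c b =>
    sgn K (wdeg d a) * θ (fun i => f (a ++ i :: b)) c) r) w
  map_add' f g := by
    funext w
    have h : ∀ a b c : List I, θ (fun i => (f + g) (a ++ i :: b)) c =
        θ (fun i => f (a ++ i :: b)) c + θ (fun i => g (a ++ i :: b)) c := fun a b c =>
      congrFun (map_add θ (fun i => f (a ++ i :: b)) fun i => g (a ++ i :: b)) c
    simp only [h]
    simp only [mul_add, splitSum_add, Pi.add_apply]
  map_smul' k f := by
    funext w
    have h : ∀ a b c : List I, θ (fun i => (k • f) (a ++ i :: b)) c =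
        k * θ (fun i => f (a ++ i :: b)) c := fun a b c =>
      congrFun (map_smul θ k fun i => f (a ++ i :: b)) c
    simp only [h]
    simp only [RingHom.id_apply, Pi.smul_apply, smul_eq_mul, mul_splitSum, mul_left_comm]
  cont := by
    refine continuous_pi fun w => ?_
    unfold splitSum
    fun_prop

lemma extDer_apply (d : I → ℤ) (θ : (I → K) →L[K] (List I → K)) (f : List I → K) (w : List I) :
    extDer d θ f w = splitSum (fun a r => splitSum (fun c b =>
      sgn K (wdeg d a) * θ (fun i => f (a ++ i :: b)) c) r) w := rfl

/-- The part of `extDer` in which the first letter is hit. -/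
def headSum (θ : (I → K) →L[K] (List I → K)) (f : List I → K) (w : List I) : K :=
  splitSum (fun c b => θ (fun i => f (i :: b)) c) w

lemma extDer_nil (d : I → ℤ) (θ : (I → K) →L[K] (List I → K)) (f : List I → K) :
    extDer d θ f [] = headSum θ f [] := by
  rw [extDer_apply]
  simp [headSum, splitSum_nil, sgn_zero, wdeg_nil]

lemma extDer_cons (d : I → ℤ) (θ : (I → K) →L[K] (List I → K)) (f : List I → K) (j : I)
    (w : List I) : extDer d θ f (j :: w) =
      headSum θ f (j :: w) + sgn K (d j) * extDer d θ (fun u => f (j :: u)) w := by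
  rw [extDer_apply, extDer_apply, splitSum_cons, mul_splitSum]
  simp [headSum, wdeg_nil, sgn_zero, wdeg_cons, sgn_add, mul_splitSum, mul_assoc]

lemma headSum_mulMap (θ : (I → K) →L[K] (List I → K)) (F : List I × List I → K) (w : List I) :
    headSum θ (mulMap F) w = headSum θ (fun v => F ([], v)) w +
      splitSum (fun u v => headSum θ (fun u' => F (u', v)) u) w := by
  unfold headSum
  rw [← splitSum_assoc (fun c b₁ b₂ => θ (fun i => F (i :: b₁, b₂)) c), ← splitSum_add]
  refine splitSum_congr fun c b _ => ?_
  have : (fun i => mulMap F (i :: b)) = (fun i => F ([], i :: b)) +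
      splitSum (fun b₁ b₂ => fun i => F (i :: b₁, b₂)) b := by
    funext i
    simp [mulMap, splitSum_cons, splitSum_apply]
  rw [this, map_add, map_splitSum, Pi.add_apply, splitSum_apply]

/-- The derivation property, for an arbitrary element `F` of the completed tensor square. -/
lemma extDer_mulMap (d : I → ℤ) (θ : (I → K) →L[K] (List I → K)) (F : List I × List I → K)
    (w : List I) : extDer d θ (mulMap F) w =
      splitSum (fun u v => extDer d θ (fun u' => F (u', v)) u) w +
      splitSum (fun u v => sgn K (wdeg d u) * extDer d θ (fun v' => F (u, v')) v) w := by
  induction w generalizing F with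
  | nil =>
    simp only [splitSum_nil, extDer_nil, headSum_mulMap, wdeg_nil, sgn_zero, one_mul]
    ring
  | cons j w ih =>
    have h : (fun u => mulMap F (j :: u)) = (fun v => F ([], v)) ∘ (List.cons j) +
        mulMap (fun p => F (j :: p.1, p.2)) := by
      funext u
      simp [mulMap, splitSum_cons]
    rw [extDer_cons, h, map_add, Pi.add_apply, ih, headSum_mulMap]
    simp only [splitSum_cons, extDer_cons, extDer_nil, splitSum_add, wdeg_nil, sgn_zero, one_mul,
      wdeg_cons, sgn_add, mul_assoc, ← mul_splitSum, Function.comp_def]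
    ring

lemma extDer_cmul (d : I → ℤ) (θ : (I → K) →L[K] (List I → K)) (f g : List I → K) :
    extDer d θ (cmul f g) = cmul (extDer d θ f) g + cmul (parityOp d f) (extDer d θ g) := by
  funext w
  rw [cmul, extDer_mulMap]
  have h1 : ∀ u v, extDer d θ (fun u' => tens f g (u', v)) u = extDer d θ f u * g v :=
    fun u v => by
      have h : (fun u' => tens f g (u', v)) = g v • f := by
        funext u; simp [tens, mul_comm]
      rw [h, map_smul, Pi.smul_apply, smul_eq_mul, mul_comm]
  have h2 : ∀ u v, extDer d θ (fun v' => tens f g (u, v')) v = f u * extDer d θ g v :=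
    fun u v => by
      have h : (fun v' => tens f g (u, v')) = f u • g := by
        funext u; simp [tens]
      rw [h, map_smul, Pi.smul_apply, smul_eq_mul]
  simp only [h1, h2]
  simp only [Pi.add_apply, cmul, mulMap, tens, parityOp, mul_assoc]

lemma extDer_one (d : I → ℤ) (θ : (I → K) →L[K] (List I → K)) : extDer d θ one = 0 := by
  funext w
  rw [extDer_apply]
  have h : ∀ a b : List I, (fun i => (one (a ++ i :: b) : K)) = 0 := fun a b => by
    funext i; cases a <;> rfl
  simp [h, splitSum_zero]

lemma extDer_orderOne (d : I → ℤ) (θ : (I → K) →L[K] (List I → K)) (g : I → K) :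
    extDer d θ (orderOne g) = θ g := by
  have hh : ∀ w, headSum θ (orderOne g) w = θ g w := fun w => by
    rw [headSum, splitSum_eq_self]
    · rfl
    · intro u j v
      have : (fun i => orderOne g (i :: j :: v)) = 0 := by funext i; rfl
      rw [this, map_zero]; rfl
  funext w
  cases w with
  | nil => rw [extDer_nil, hh]
  | cons j w =>
    have : (fun u => orderOne g (j :: u)) = g j • (one : List I → K) := by
      funext u; cases u <;> simp [orderOne, one]
    rw [extDer_cons, hh, this, map_smul, extDer_one]
    simp

lemma extDer_homog (d : I → ℤ) (θ : (I → K) →L[K] (List I → K)) (𝒦 : ℤ → AddSubgroup K)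
    (hθ : ∀ n g, g ∈ homog 𝒦 d n → θ g ∈ homog 𝒦 (wdeg d) (n + 1)) {n : ℤ} {f : List I → K}
    (hf : f ∈ homog 𝒦 (wdeg d) n) : extDer d θ f ∈ homog 𝒦 (wdeg d) (n + 1) := by
  intro w
  rw [extDer_apply]
  refine AddSubgroup.sum_mem _ fun k _ => AddSubgroup.sum_mem _ fun l _ => ?_
  set a := w.take k
  set c := (w.drop k).take l
  set b := (w.drop k).drop l
  have hw : wdeg d w = wdeg d a + (wdeg d c + wdeg d b) := by
    rw [← wdeg_append, ← wdeg_append, List.take_append_drop, List.take_append_drop]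
  have h1 : (fun i => f (a ++ i :: b)) ∈ homog 𝒦 d (n - wdeg d a - wdeg d b) := fun i => by
    have := hf (a ++ i :: b)
    rw [wdeg_append, wdeg_cons] at this
    convert this using 2; ring
  have h2 := hθ _ _ h1 c
  have h3 : n - wdeg d a - wdeg d b + 1 - wdeg d c = n + 1 - wdeg d w := by rw [hw]; ring
  rw [h3] at h2
  rcases Int.even_or_odd (wdeg d a) with h | h
  · rw [sgn_even h]; simpa using h2
  · rw [sgn_odd h]; simpa using h2

end ExtDer

section Parity
variable {K I : Type*} [CommRing K]

lemma coeff_even {𝒦 : ℤ → AddSubgroup K} [EvenlyGraded 𝒦] {X : Type*} {dX : X → ℤ} {n : ℤ}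
    {f : X → K} (hf : f ∈ homog 𝒦 dX n) (x : X) : sgn K (dX x) * f x = sgn K n * f x := by
  rcases Int.even_or_odd (n - dX x) with h | h
  · have : sgn K n = sgn K (n - dX x) * sgn K (dX x) := by rw [← sgn_add]; congr 1; ring
    rw [this, sgn_even h, one_mul]
  · have := hf x
    rw [EvenlyGraded.odd_eq_bot (𝒦 := 𝒦) _ h, AddSubgroup.mem_bot] at this
    rw [this, mul_zero, mul_zero]

lemma parityOp_homog {𝒦 : ℤ → AddSubgroup K} [EvenlyGraded 𝒦] {d : I → ℤ} {n : ℤ}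
    {f : List I → K} (hf : f ∈ homog 𝒦 (wdeg d) n) : parityOp d f = sgn K n • f := by
  funext w
  exact coeff_even hf w

lemma sgn_mul_eq_pow (a b : ℤ) (h : Even b) : sgn K (a * b) = 1 := sgn_even (h.mul_left a)

lemma sgn_mul_odd (a b : ℤ) (h : Odd b) : sgn K (a * b) = sgn K a := by
  rcases Int.even_or_odd a with ha | ha
  · rw [sgn_even ha, sgn_even (ha.mul_right b)]
  · rw [sgn_odd ha, sgn_odd (ha.mul h)]

lemma smul_sgn_mem {M : Type*} [AddCommGroup M] [Module K M] (A : AddSubgroup M) (n : ℤ) {x : M}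
    (hx : x ∈ A) : sgn K n • x ∈ A := by
  rcases Int.even_or_odd n with h | h
  · rwa [sgn_even h, one_smul]
  · rw [sgn_odd h, neg_one_smul]; exact A.neg_mem hx

lemma parityOp_parityOp (d : I → ℤ) (f : List I → K) : parityOp d (parityOp d f) = f := by
  funext w
  simp only [parityOp, ← mul_assoc, sgn_sq, one_mul]

lemma parityOp_add (d : I → ℤ) (f g : List I → K) :
    parityOp d (f + g) = parityOp d f + parityOp d g := by
  funext w; simp [parityOp, mul_add]

lemma parityOp_smul (d : I → ℤ) (k : K) (f : List I → K) :
    parityOp d (k • f) = k • parityOp d f := by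
  funext w; simp [parityOp, mul_left_comm]

lemma bracket_parityOp (d : I → ℤ) (f g : List I → K) :
    bracket d (parityOp d f) (parityOp d g) = parityOp d (bracket d f g) := by
  funext w
  simp only [bracket, parityOp, mul_splitSum]
  refine splitSum_congr fun u v h => ?_
  rw [← h, wdeg_append, sgn_add]
  ring

lemma parityOp_orderOne (d : I → ℤ) (g : I → K) :
    parityOp d (orderOne g) = orderOne fun i => sgn K (d i) * g i := by
  funext w
  match w with
  | [] => simp [parityOp, orderOne]
  | [i] => simp [parityOp, orderOne, wdeg]
  | _ :: _ :: _ => simp [parityOp, orderOne]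

lemma bracket_add_left (d : I → ℤ) (f f' g : List I → K) :
    bracket d (f + f') g = bracket d f g + bracket d f' g := by
  funext w
  simp only [bracket, Pi.add_apply, ← splitSum_add]
  exact splitSum_congr fun u v _ => by ring

lemma bracket_add_right (d : I → ℤ) (f g g' : List I → K) :
    bracket d f (g + g') = bracket d f g + bracket d f g' := by
  funext w
  simp only [bracket, Pi.add_apply, ← splitSum_add]
  exact splitSum_congr fun u v _ => by ring

lemma bracket_smul_left (d : I → ℤ) (k : K) (f g : List I → K) :
    bracket d (k • f) g = k • bracket d f g := by
  funext w
  simp only [bracket, Pi.smul_apply, smul_eq_mul, mul_splitSum]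
  exact splitSum_congr fun u v _ => by ring

lemma cmul_add_left (f f' g : List I → K) : cmul (f + f') g = cmul f g + cmul f' g := by
  funext w
  simp only [cmul, mulMap, tens, Pi.add_apply, ← splitSum_add, add_mul]

lemma cmul_smul_left (k : K) (f g : List I → K) : cmul (k • f) g = k • cmul f g := by
  funext w
  simp only [cmul, mulMap, tens, Pi.smul_apply, smul_eq_mul, mul_splitSum, mul_assoc]

end Parity

/-- The properties of an odd vector field on the completed tensor algebra that extends a vector
field on the completed free Lie algebra. -/
structure IsOddField {K I : Type*} [CommRing K] [TopologicalSpace K] [DiscreteTopology K]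
    (𝒦 : ℤ → AddSubgroup K) (d : I → ℤ) (M : (List I → K) →L[K] (List I → K)) : Prop where
  mul : ∀ (F : List I × List I → K) (w : List I), M (mulMap F) w =
      splitSum (fun u v => M (fun u' => F (u', v)) u) w +
      splitSum (fun u v => sgn K (wdeg d u) * M (fun v' => F (u, v')) v) w
  map_one : M one = 0
  parity : ∀ f, M (parityOp d f) = -parityOp d (M f)
  homog : ∀ (n : ℤ) (f : List I → K), f ∈ homog 𝒦 (wdeg d) n → M f ∈ homog 𝒦 (wdeg d) (n + 1)
  lie : ∀ f ∈ freeLie K d, M f ∈ freeLie K d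

section Ext
variable {K I : Type*} [CommRing K] [TopologicalSpace K] [DiscreteTopology K]

lemma parityOp_mem_freeLie {d : I → ℤ} {f : List I → K} (hf : f ∈ freeLie K d) :
    parityOp d f ∈ freeLie K d := by
  let P : (List I → K) →ₗ[K] (List I → K) :=
    { toFun := parityOp d, map_add' := parityOp_add d, map_smul' := parityOp_smul d }
  have hP : Continuous P := by
    change Continuous fun f : List I → K => fun w => sgn K (wdeg d w) * f w
    fun_prop
  have : freeLie K d ≤ (freeLie K d).comap P := by
    refine freeLie_le (fun g => ?_) (fun f hf g hg => ?_) (isClosed_freeLie.preimage hP)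
    · change parityOp d (orderOne g) ∈ freeLie K d
      rw [parityOp_orderOne]; exact orderOne_mem_freeLie _
    · change parityOp d (bracket d f g) ∈ freeLie K d
      rw [← bracket_parityOp]; exact bracket_mem_freeLie hf hg
  exact this hf

/-- A continuous functional that vanishes on the topological basis vanishes. -/
lemma functional_eq_zero {X : Type*} [DecidableEq X] (φ : (X → K) →L[K] K)
    (h : ∀ x, φ (Pi.single x 1) = 0) : φ = 0 := by
  ext f
  have hlim : Filter.Tendsto (fun s : Finset X => ∑ x ∈ s, f x • (Pi.single x 1 : X → K))
      Filter.atTop (nhds f) := by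
    rw [tendsto_pi_nhds]
    intro y
    refine tendsto_const_nhds.congr' ?_
    filter_upwards [Filter.eventually_ge_atTop ({y} : Finset X)] with s hs
    have hy : y ∈ s := hs (Finset.mem_singleton_self y)
    simp [Finset.sum_apply, Pi.single_apply, hy]
  have h1 := (φ.continuous.tendsto f).comp hlim
  have h2 : (φ ∘ fun s : Finset X => ∑ x ∈ s, f x • (Pi.single x 1 : X → K)) = fun _ => 0 := by
    funext s; simp [h]
  rw [h2] at h1
  exact tendsto_nhds_unique h1 tendsto_const_nhds

/-- The inclusion of `W` into the completed free Lie algebra. -/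
def lieGen (d : I → ℤ) : (I → K) →L[K] freeLie K d where
  toFun g := ⟨orderOne g, orderOne_mem_freeLie g⟩
  map_add' f g := by
    ext w
    match w with
    | [] => simp [orderOne]
    | [i] => simp [orderOne]
    | _ :: _ :: _ => simp [orderOne]
  map_smul' k g := by
    ext w
    match w with
    | [] => simp [orderOne]
    | [i] => simp [orderOne]
    | _ :: _ :: _ => simp [orderOne]
  cont := by
    refine Continuous.subtype_mk (continuous_pi fun w => ?_) _
    match w with
    | [] => exact continuous_const
    | [i] => exact continuous_apply i
    | _ :: _ :: _ => exact continuous_const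

variable {𝒦 : ℤ → AddSubgroup K} {vdeg : I → ℤ}

/-- The extension of a `C_∞`-structure to a vector field on the completed tensor algebra, that is
the associated `A_∞`-structure. -/
def CInfinityStructure.ext (m : CInfinityStructure 𝒦 vdeg) : (List I → K) →L[K] (List I → K) :=
  extDer (suspDualDeg vdeg) ((freeLie K (suspDualDeg vdeg)).subtypeL.comp
    (m.m.comp (lieGen (suspDualDeg vdeg))))

lemma orderOne_homog {d : I → ℤ} {n : ℤ} {g : I → K} (hg : g ∈ homog 𝒦 d n) :
    orderOne g ∈ homog 𝒦 (wdeg d) n := by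
  intro w
  match w with
  | [] => exact AddSubgroup.zero_mem _
  | [i] => simpa [orderOne, wdeg] using hg i
  | _ :: _ :: _ => exact AddSubgroup.zero_mem _

lemma extDer_parity [GradedRing 𝒦] [EvenlyGraded 𝒦] (d : I → ℤ)
    (θ : (I → K) →L[K] (List I → K))
    (hθ : ∀ n g, g ∈ homog 𝒦 d n → θ g ∈ homog 𝒦 (wdeg d) (n + 1)) (f : List I → K) :
    extDer d θ (parityOp d f) = -parityOp d (extDer d θ f) := by
  classical
  have key : ∀ (c : List I) (g : I → K),
      θ (fun i => sgn K (d i) * g i) c = -(sgn K (wdeg d c) * θ g c) := by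
    intro c g
    let T : (I → K) →L[K] (I → K) :=
      { toFun := fun g i => sgn K (d i) * g i
        map_add' := fun f g => by funext i; simp [mul_add]
        map_smul' := fun k f => by funext i; simp [mul_left_comm]
        cont := by fun_prop }
    let φ : (I → K) →L[K] K :=
      (ContinuousLinearMap.proj c).comp (θ.comp T) +
        sgn K (wdeg d c) • (ContinuousLinearMap.proj c).comp θ
    have hφ : φ = 0 := by
      refine functional_eq_zero φ fun i => ?_
      have hT : T (Pi.single i 1) = sgn K (d i) • Pi.single i 1 := by
        funext j
        by_cases hj : j = i
        · subst hj; simp [T]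
        · simp [T, hj]
      have hi : (Pi.single i 1 : I → K) ∈ homog 𝒦 d (d i) := by
        intro j
        by_cases hj : j = i
        · subst hj
          simpa using SetLike.GradedOne.one_mem (A := 𝒦)
        · simp [hj]
      have h2 := coeff_even (hθ _ _ hi) c
      simp only [φ, add_apply, ContinuousLinearMap.comp_apply, hT, map_smul,
        smul_apply, ContinuousLinearMap.proj_apply, smul_eq_mul, h2, sgn_add,
        sgn_one]
      ring
    have := congrArg (fun ψ => ψ g) hφ
    exact eq_neg_of_add_eq_zero_left this
  funext w
  simp only [Pi.neg_apply, parityOp, extDer_apply, mul_splitSum]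
  rw [← neg_one_mul, mul_splitSum]
  refine splitSum_congr fun a r hr => ?_
  rw [mul_splitSum]
  refine splitSum_congr fun c b hb => ?_
  have h1 : (fun i => sgn K (wdeg d (a ++ i :: b)) * f (a ++ i :: b)) =
      (sgn K (wdeg d a) * sgn K (wdeg d b)) • fun i => sgn K (d i) * f (a ++ i :: b) := by
    funext i
    simp only [wdeg_append, wdeg_cons, sgn_add, Pi.smul_apply, smul_eq_mul]
    ring
  rw [h1, map_smul, Pi.smul_apply, key, ← hr, ← hb]
  simp only [wdeg_append, sgn_add, smul_eq_mul]
  ring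

/-- An odd derivation for the product is one for the graded commutator. -/
lemma bracket_of_mul {d : I → ℤ} {M : (List I → K) →L[K] (List I → K)}
    (hmul : ∀ (F : List I × List I → K) (w : List I), M (mulMap F) w =
      splitSum (fun u v => M (fun u' => F (u', v)) u) w +
      splitSum (fun u v => sgn K (wdeg d u) * M (fun v' => F (u, v')) v) w)
    (hpar : ∀ f, M (parityOp d f) = -parityOp d (M f)) (f g : List I → K) :
    M (bracket d f g) = bracket d (M f) g + bracket d (parityOp d f) (M g) := by
  have tw : ∀ (n : ℤ) (h : List I → K) (u : List I),
      M (fun u => sgn K (wdeg d u * n) * h u) u = sgn K ((wdeg d u + 1) * n) * M h u := by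
    intro n h u
    rcases Int.even_or_odd n with hn | hn
    · simp only [sgn_mul_eq_pow _ _ hn, one_mul]
    · simp only [sgn_mul_odd _ _ hn]
      have := congrFun (hpar h) u
      simp only [parityOp, Pi.neg_apply] at this
      rw [sgn_add, sgn_one]
      change M (fun u => sgn K (wdeg d u) * h u) u = _ at this
      rw [this]; ring
  have hb : bracket d f g = mulMap (fun p => f p.1 * g p.2 -
      sgn K (wdeg d p.1 * wdeg d p.2) * (g p.1 * f p.2)) := rfl
  have h1 : ∀ u v, M (fun u' => f u' * g v - sgn K (wdeg d u' * wdeg d v) * (g u' * f v)) u =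
      M f u * g v - sgn K ((wdeg d u + 1) * wdeg d v) * (M g u * f v) := by
    intro u v
    have : (fun u' => f u' * g v - sgn K (wdeg d u' * wdeg d v) * (g u' * f v)) =
        g v • f - f v • fun u' => sgn K (wdeg d u' * wdeg d v) * g u' := by
      funext u'; simp only [Pi.sub_apply, Pi.smul_apply, smul_eq_mul]; ring
    rw [this, map_sub, map_smul, map_smul, Pi.sub_apply, Pi.smul_apply, Pi.smul_apply, tw]
    simp only [smul_eq_mul]; ring
  have h2 : ∀ u v, M (fun v' => f u * g v' - sgn K (wdeg d u * wdeg d v') * (g u * f v')) v =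
      f u * M g v - sgn K ((wdeg d v + 1) * wdeg d u) * (g u * M f v) := by
    intro u v
    have : (fun v' => f u * g v' - sgn K (wdeg d u * wdeg d v') * (g u * f v')) =
        f u • g - g u • fun v' => sgn K (wdeg d v' * wdeg d u) * f v' := by
      funext u'; simp only [Pi.sub_apply, Pi.smul_apply, smul_eq_mul, mul_comm (wdeg d u)]; ring
    rw [this, map_sub, map_smul, map_smul, Pi.sub_apply, Pi.smul_apply, Pi.smul_apply, tw]
    simp only [smul_eq_mul]; ring
  funext w
  rw [hb, hmul]
  simp only [h1, h2, Pi.add_apply, bracket, ← splitSum_add, parityOp]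
  refine splitSum_congr fun u v _ => ?_
  simp only [add_mul, one_mul, sgn_add, mul_comm (wdeg d v) (wdeg d u)]
  linear_combination (- sgn K (wdeg d u * wdeg d v) * (g u * M f v)) * sgn_sq (K := K) (wdeg d u)

lemma CInfinityStructure.gen_homog (m : CInfinityStructure 𝒦 vdeg) (n : ℤ) (g : I → K)
    (hg : g ∈ FormalGeom.homog 𝒦 (suspDualDeg vdeg) n) :
    ((freeLie K (suspDualDeg vdeg)).subtypeL.comp
      (m.m.comp (lieGen (suspDualDeg vdeg)))) g ∈
        FormalGeom.homog 𝒦 (wdeg (suspDualDeg vdeg)) (n + 1) :=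
  m.degree_one n _ (orderOne_homog hg)

variable [GradedRing 𝒦] [EvenlyGraded 𝒦] (m : CInfinityStructure 𝒦 vdeg)

lemma CInfinityStructure.ext_bracket (f g : List I → K) :
    m.ext (bracket (suspDualDeg vdeg) f g) = bracket (suspDualDeg vdeg) (m.ext f) g +
      bracket (suspDualDeg vdeg) (parityOp (suspDualDeg vdeg) f) (m.ext g) :=
  bracket_of_mul (extDer_mulMap _ _) (extDer_parity (𝒦 := 𝒦) _ _ m.gen_homog) f g

/-- The extension restricts to the given `C_∞`-structure on the free Lie algebra. -/
lemma CInfinityStructure.ext_eq (φ : freeLie K (suspDualDeg vdeg)) :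
    m.ext φ = m.m φ := by
  let N : Submodule K (List I → K) :=
    (LinearMap.ker ((m.ext.comp (freeLie K (suspDualDeg vdeg)).subtypeL - (freeLie K (suspDualDeg vdeg)).subtypeL.comp m.m :
      freeLie K (suspDualDeg vdeg) →L[K] (List I → K)) : freeLie K (suspDualDeg vdeg) →ₗ[K] (List I → K))).map
        (freeLie K (suspDualDeg vdeg)).subtype
  have hN : ∀ x, x ∈ N ↔ ∃ h : x ∈ freeLie K (suspDualDeg vdeg), m.ext x = m.m ⟨x, h⟩ := by
    intro x
    simp only [N, Submodule.mem_map, LinearMap.mem_ker]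
    constructor
    · rintro ⟨y, hy, rfl⟩
      exact ⟨y.2, sub_eq_zero.1 hy⟩
    · rintro ⟨h, hx⟩
      exact ⟨⟨x, h⟩, sub_eq_zero.2 hx, rfl⟩
  have hle : freeLie K (suspDualDeg vdeg) ≤ N := by
    refine freeLie_le (fun g => ?_) (fun f hf g hg => ?_) ?_
    · exact (hN _).2 ⟨orderOne_mem_freeLie g, extDer_orderOne _ _ g⟩
    · obtain ⟨hf, hf'⟩ := (hN f).1 hf
      obtain ⟨hg, hg'⟩ := (hN g).1 hg
      refine (hN _).2 ⟨bracket_mem_freeLie hf hg, ?_⟩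
      rw [m.ext_bracket, m.derivation ⟨f, hf⟩ ⟨g, hg⟩, hf', hg']
    · have hc := ContinuousLinearMap.isClosed_ker
        (m.ext.comp (freeLie K (suspDualDeg vdeg)).subtypeL - (freeLie K (suspDualDeg vdeg)).subtypeL.comp m.m)
      exact (isClosed_freeLie.isClosedEmbedding_subtypeVal).isClosedMap _ hc
  obtain ⟨_, h⟩ := (hN _).1 (hle φ.2)
  exact h

lemma CInfinityStructure.isOddField : IsOddField 𝒦 (suspDualDeg vdeg) m.ext where
  mul := extDer_mulMap _ _
  map_one := extDer_one _ _
  parity := extDer_parity (𝒦 := 𝒦) _ _ m.gen_homog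
  homog _ _ hf := extDer_homog _ _ 𝒦 m.gen_homog hf
  lie f hf := by
    rw [m.ext_eq ⟨f, hf⟩]
    exact (m.m ⟨f, hf⟩).2

end Ext

/-! ## Noncommutative one-forms

Forms live in the differential envelope, where `d` has degree one.  The basis element `(p, q)` of
`List I × List I → K` stands for the one-form `t_p · d(t_q)`, of degree `|t_p| + |t_q| + 1`. -/

section AssForms
variable {K I : Type*} [CommRing K]

/-- The degree of `t_p · d(t_q)` in the differential envelope. -/
def formDeg (d : I → ℤ) (p : List I × List I) : ℤ := wdeg d p.1 + wdeg d p.2 + 1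

/-- The left action `a · (x · dy) = (a x) · dy`. -/
def formLeft (a : List I → K) (ω : List I × List I → K) : List I × List I → K :=
  fun p => cmul a (fun u => ω (u, p.2)) p.1

/-- The right action `(x · dy) · a = x · d(y a) - (-1)^|y| (x y) · da`. -/
def formRight (d : I → ℤ) (ω : List I × List I → K) (a : List I → K) : List I × List I → K :=
  fun p => cmul (fun v => ω (p.1, v)) a p.2 -
    splitSum (fun u v => sgn K (wdeg d v) * ω (u, v)) p.1 * a p.2

/-- The graded commutator `[a, ω] = a ω - (-1)^(k n) ω a` of a function `a` of degree `k` and a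
one-form `ω` of degree `n`. -/
def formComm (d : I → ℤ) (k n : ℤ) (a : List I → K) (ω : List I × List I → K) :
    List I × List I → K :=
  formLeft a ω - sgn K (k * n) • formRight d ω a

variable [TopologicalSpace K] [DiscreteTopology K]

/-- The relations that cut the associative one-forms out of `T̂W ⊗ T̂W`: first `x · d1 = 0`, which
replaces the second factor by `T̂W / K`, and then the vanishing of the graded commutators
`[a, ω]` of functions and one-forms. -/
def assRel (𝒦 : ℤ → AddSubgroup K) (d : I → ℤ) : Submodule K (List I × List I → K) :=
  closedSpan ({F | ∃ x : List I → K, F = tens x one} ∪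
    {F | ∃ (k n : ℤ) (a : List I → K) (ω : List I × List I → K),
      a ∈ homog 𝒦 (wdeg d) k ∧ ω ∈ homog 𝒦 (formDeg d) n ∧ F = formComm d k n a ω})

/-- The module `DR¹_Ass(T̂W)` of associative one-forms. -/
abbrev DR1Ass (𝒦 : ℤ → AddSubgroup K) (d : I → ℤ) : Type _ :=
  (List I × List I → K) ⧸ assRel 𝒦 d

/-- The Lie derivative `L(x · dy) = M x · dy - (-1)^|x| x · d(M y)` of an odd vector field. -/
def assLieDer (d : I → ℤ) (M : (List I → K) →L[K] (List I → K)) :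
    (List I × List I → K) →L[K] (List I × List I → K) where
  toFun F p := M (fun u => F (u, p.2)) p.1 - sgn K (wdeg d p.1) * M (fun v => F (p.1, v)) p.2
  map_add' F G := by
    funext p
    have h1 : (fun u => (F + G) (u, p.2)) = (fun u => F (u, p.2)) + fun u => G (u, p.2) := rfl
    have h2 : (fun v => (F + G) (p.1, v)) = (fun v => F (p.1, v)) + fun v => G (p.1, v) := rfl
    rw [h1, h2, map_add, map_add]
    simp only [Pi.add_apply]
    ring
  map_smul' k F := by
    funext p
    have h1 : (fun u => (k • F) (u, p.2)) = k • fun u => F (u, p.2) := rfl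
    have h2 : (fun v => (k • F) (p.1, v)) = k • fun v => F (p.1, v) := rfl
    rw [h1, h2, map_smul, map_smul]
    simp only [Pi.smul_apply, smul_eq_mul, RingHom.id_apply]
    ring
  cont := by
    refine continuous_pi fun p => ?_
    fun_prop

lemma assLieDer_apply (d : I → ℤ) (M : (List I → K) →L[K] (List I → K))
    (F : List I × List I → K) (p : List I × List I) : assLieDer d M F p =
      M (fun u => F (u, p.2)) p.1 - sgn K (wdeg d p.1) * M (fun v => F (p.1, v)) p.2 := rfl

lemma tens_mem_closedSpan {X : Type*} {S : Set (X → K)} {F : X → K} (h : F ∈ S) :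
    F ∈ closedSpan S :=
  Submodule.le_topologicalClosure _ (Submodule.subset_span h)

/-- A continuous linear map that sends generators into a closed submodule does so on their
closed span. -/
lemma map_closedSpan {X Y : Type*} {S : Set (X → K)} {N : Submodule K (Y → K)}
    (hN : IsClosed (N : Set (Y → K))) (D : (X → K) →L[K] (Y → K)) (h : ∀ F ∈ S, D F ∈ N) {F : X → K}
    (hF : F ∈ closedSpan S) : D F ∈ N := by
  have : closedSpan S ≤ N.comap (D : (X → K) →ₗ[K] (Y → K)) :=
    Submodule.topologicalClosure_minimal _ (Submodule.span_le.2 h) (hN.preimage D.continuous)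
  exact this hF

lemma isClosed_closedSpan {X : Type*} (S : Set (X → K)) :
    IsClosed (closedSpan S : Set (X → K)) := Submodule.isClosed_topologicalClosure _

variable {𝒦 : ℤ → AddSubgroup K} {d : I → ℤ} {M : (List I → K) →L[K] (List I → K)}

lemma IsOddField.cmul_eq (hM : IsOddField 𝒦 d M) (f g : List I → K) :
    M (cmul f g) = cmul (M f) g + cmul (parityOp d f) (M g) := by
  funext w
  rw [cmul, hM.mul]
  have h1 : ∀ u v, M (fun u' => tens f g (u', v)) u = M f u * g v := fun u v => by
    have h : (fun u' => tens f g (u', v)) = g v • f := by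
      funext u; simp [tens, mul_comm]
    rw [h, map_smul, Pi.smul_apply, smul_eq_mul, mul_comm]
  have h2 : ∀ u v, M (fun v' => tens f g (u, v')) v = f u * M g v := fun u v => by
    have h : (fun v' => tens f g (u, v')) = f u • g := by
      funext u; simp [tens]
    rw [h, map_smul, Pi.smul_apply, smul_eq_mul]
  simp only [h1, h2]
  simp only [Pi.add_apply, cmul, mulMap, tens, parityOp, mul_assoc]

lemma IsOddField.bracket_eq (hM : IsOddField 𝒦 d M) (f g : List I → K) :
    M (bracket d f g) = bracket d (M f) g + bracket d (parityOp d f) (M g) :=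
  bracket_of_mul hM.mul hM.parity f g

lemma assLieDer_homog (hM : IsOddField 𝒦 d M) {n : ℤ} {F : List I × List I → K}
    (hF : F ∈ homog 𝒦 (formDeg d) n) : assLieDer d M F ∈ homog 𝒦 (formDeg d) (n + 1) := by
  intro p
  rw [assLieDer_apply]
  refine AddSubgroup.sub_mem _ ?_ (smul_sgn_mem (K := K) _ _ (x := M (fun v => F (p.1, v)) p.2) ?_)
  · have h : (fun u => F (u, p.2)) ∈ homog 𝒦 (wdeg d) (n - wdeg d p.2 - 1) := fun u => by
      have := hF (u, p.2)
      convert this using 2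
      simp only [formDeg]; ring
    have := hM.homog _ _ h p.1
    convert this using 2
    simp only [formDeg]; ring
  · have h : (fun v => F (p.1, v)) ∈ homog 𝒦 (wdeg d) (n - wdeg d p.1 - 1) := fun v => by
      have := hF (p.1, v)
      convert this using 2
      simp only [formDeg]; ring
    have := hM.homog _ _ h p.2
    convert this using 2
    simp only [formDeg]; ring

lemma assLieDer_formLeft (hM : IsOddField 𝒦 d M) (a : List I → K) (ω : List I × List I → K) :
    assLieDer d M (formLeft a ω) =
      formLeft (M a) ω + formLeft (parityOp d a) (assLieDer d M ω) := by
  funext ⟨p, q⟩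
  rw [assLieDer_apply]
  have h1 : (fun u => formLeft a ω (u, q)) = cmul a fun u => ω (u, q) := rfl
  have h2 : (fun v => formLeft a ω (p, v)) =
      splitSum (fun u v => a u • fun q => ω (v, q)) p := by
    funext v
    simp [formLeft, cmul, mulMap, tens, splitSum_apply]
  simp only [h1, h2, hM.cmul_eq, map_splitSum, map_smul, splitSum_apply]
  simp only [Pi.add_apply, formLeft, cmul, mulMap, tens, assLieDer_apply, mul_splitSum,
    Pi.smul_apply, smul_eq_mul]
  rw [add_sub_assoc, ← splitSum_sub]
  congr 1
  refine splitSum_congr fun u v h => ?_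
  rw [← h, wdeg_append, sgn_add]
  simp only [parityOp]
  ring

lemma assLieDer_formRight (hM : IsOddField 𝒦 d M) (a : List I → K) (ω : List I × List I → K) :
    assLieDer d M (formRight d ω a) = formRight d (assLieDer d M ω) a +
      formRight d (fun p => sgn K (formDeg d p) * ω p) (M a) := by
  funext ⟨p, q⟩
  have h1 : (fun u => formRight d ω a (u, q)) =
      splitSum (fun v₁ v₂ => a v₂ • fun u => ω (u, v₁)) q -
        a q • mulMap (fun r => sgn K (wdeg d r.2) * ω r) := by
    funext u
    simp only [formRight, cmul, mulMap, tens, Pi.sub_apply, splitSum_apply, Pi.smul_apply,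
      smul_eq_mul, mul_comm (a _)]
  have h2 : (fun v => formRight d ω a (p, v)) =
      cmul (fun v => ω (p, v)) a -
        splitSum (fun u v => sgn K (wdeg d v) * ω (u, v)) p • a := by
    funext v
    simp only [formRight, Pi.sub_apply, Pi.smul_apply, smul_eq_mul]
  have h3 : ∀ v, M (fun u' => sgn K (wdeg d v) * ω (u', v)) =
      sgn K (wdeg d v) • M fun u' => ω (u', v) := fun v => by
    rw [← map_smul]; rfl
  have h4 : ∀ u, M (fun v' => sgn K (wdeg d v') * ω (u, v')) =
      -parityOp d (M fun v' => ω (u, v')) := fun u => hM.parity fun v' => ω (u, v')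
  rw [assLieDer_apply]
  dsimp only
  rw [h1, h2, map_sub, map_sub, map_smul, map_smul, map_splitSum, hM.cmul_eq]
  simp only [Pi.sub_apply, Pi.add_apply, Pi.smul_apply, smul_eq_mul, splitSum_apply, map_smul]
  rw [hM.mul]
  dsimp only
  simp only [h3, h4, Pi.smul_apply, smul_eq_mul, Pi.neg_apply, parityOp]
  simp only [formRight, cmul, mulMap, tens, assLieDer_apply, Pi.add_apply, formDeg, mul_sub,
    sub_mul, splitSum_sub, sgn_add, sgn_one]
  have e1 : splitSum (fun u v => sgn K (wdeg d u) * -(sgn K (wdeg d v) * M (fun v' => ω (u, v')) v))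
      p = -splitSum (fun u v => sgn K (wdeg d v) *
        (sgn K (wdeg d u) * M (fun v' => ω (u, v')) v)) p := by
    rw [← neg_one_mul, mul_splitSum]
    exact splitSum_congr fun u v _ => by ring
  have e2 : splitSum (fun u v => sgn K (wdeg d v) *
      (sgn K (wdeg d u) * sgn K (wdeg d v) * -1 * ω (u, v))) p =
      -(sgn K (wdeg d p) * splitSum (fun u v => sgn K (wdeg d v) * ω (u, v)) p) := by
    rw [← neg_mul, mul_splitSum]
    refine splitSum_congr fun u v h => ?_
    rw [← h, wdeg_append, sgn_add]
    ring
  have e3 : splitSum (fun u v => sgn K (wdeg d p) * sgn K (wdeg d u) * -1 * ω (p, u) * M a v) q =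
      -(sgn K (wdeg d p) * splitSum (fun u v => sgn K (wdeg d u) * ω (p, u) * M a v) q) := by
    rw [← neg_mul, mul_splitSum]
    exact splitSum_congr fun u v _ => by ring
  have e4 : splitSum (fun u v => a v * M (fun u' => ω (u', u)) p) q =
      splitSum (fun u v => M (fun u' => ω (u', u)) p * a v) q :=
    splitSum_congr fun u v _ => mul_comm _ _
  rw [e1, e2, e3, e4]
  have e5 : splitSum (fun u v => sgn K (wdeg d p) * M (fun v => ω (p, v)) u * a v) q =
      sgn K (wdeg d p) * splitSum (fun u v => M (fun v => ω (p, v)) u * a v) q := by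
    rw [mul_splitSum]
    exact splitSum_congr fun u v _ => by ring
  rw [e5]
  simp only [parityOp]
  ring

lemma formLeft_smul (k : K) (a : List I → K) (ω : List I × List I → K) :
    formLeft (k • a) ω = k • formLeft a ω := by
  funext p
  simp only [formLeft, cmul_smul_left, Pi.smul_apply]

lemma formRight_smul (k : K) (a : List I → K) (ω : List I × List I → K) :
    formRight d (k • ω) a = k • formRight d ω a := by
  funext p
  simp only [formRight, cmul, mulMap, tens, Pi.smul_apply, smul_eq_mul, mul_sub, mul_splitSum,
    splitSum_mul]
  congr 1 <;> exact splitSum_congr fun u v _ => by ring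

lemma assLieDer_formComm [EvenlyGraded 𝒦] (hM : IsOddField 𝒦 d M) {k n : ℤ} {a : List I → K}
    {ω : List I × List I → K} (ha : a ∈ homog 𝒦 (wdeg d) k) (hω : ω ∈ homog 𝒦 (formDeg d) n) :
    assLieDer d M (formComm d k n a ω) =
      formComm d (k + 1) n (M a) ω + sgn K k • formComm d k (n + 1) a (assLieDer d M ω) := by
  have h1 : (fun p => sgn K (formDeg d p) * ω p) = sgn K n • ω := funext fun p => coeff_even hω p
  rw [formComm, map_sub, map_smul, assLieDer_formLeft hM, assLieDer_formRight hM,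
    parityOp_homog ha, h1, formLeft_smul, formRight_smul, formComm, formComm]
  have h2 : sgn K ((k + 1) * n) = sgn K (k * n) * sgn K n := by rw [← sgn_add]; congr 1; ring
  have h3 : sgn K (k * (n + 1)) = sgn K (k * n) * sgn K k := by rw [← sgn_add]; congr 1; ring
  rw [h2, h3]
  funext p
  simp only [Pi.add_apply, Pi.sub_apply, Pi.smul_apply, smul_eq_mul]
  linear_combination (sgn K (k * n) * formRight d (assLieDer d M ω) a p) * sgn_sq (K := K) k

lemma assLieDer_assRel [EvenlyGraded 𝒦] (hM : IsOddField 𝒦 d M) :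
    assRel 𝒦 d ≤ (assRel 𝒦 d).comap (assLieDer d M : _ →ₗ[K] (List I × List I → K)) := by
  intro F hF
  refine map_closedSpan (isClosed_closedSpan _) (assLieDer d M) ?_ hF
  rintro _ (⟨x, rfl⟩ | ⟨k, n, a, ω, ha, hω, rfl⟩)
  · refine tens_mem_closedSpan (Or.inl ⟨M x, ?_⟩)
    funext ⟨p, q⟩
    have h1 : (fun u => tens x (one : List I → K) (u, q)) = (one q : K) • x := by
      funext u; simp [tens, mul_comm]
    have h2 : (fun v : List I => tens x (one : List I → K) (p, v)) = x p • (one : List I → K) := by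
      funext v; simp [tens]
    rw [assLieDer_apply]
    dsimp only
    rw [h1, h2, map_smul, map_smul, hM.map_one]
    simp [tens, mul_comm]
  · rw [assLieDer_formComm hM ha hω]
    exact Submodule.add_mem _
      (tens_mem_closedSpan (Or.inr ⟨_, _, _, _, hM.homog _ _ ha, hω, rfl⟩))
      (Submodule.smul_mem _ _
        (tens_mem_closedSpan (Or.inr ⟨_, _, _, _, ha, assLieDer_homog hM hω, rfl⟩)))

end AssForms

section AssComplex
variable {K I : Type*} [CommRing K] [TopologicalSpace K] [DiscreteTopology K]
  {𝒦 : ℤ → AddSubgroup K} [GradedRing 𝒦] [EvenlyGraded 𝒦] {vdeg : I → ℤ}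

/-- The differential of the Hochschild complex of a `C_∞`-structure: the Lie derivative along `m`
on associative one-forms. -/
def assDiff (m : CInfinityStructure 𝒦 vdeg) :
    DR1Ass 𝒦 (suspDualDeg vdeg) →L[K] DR1Ass 𝒦 (suspDualDeg vdeg) :=
  Submodule.liftQL _ ((Submodule.mkQL _).comp (assLieDer (suspDualDeg vdeg) m.ext)) fun _ hF =>
    (Submodule.Quotient.mk_eq_zero _).2 (assLieDer_assRel m.isOddField hF)

end AssComplex

section LieForms
variable {K I : Type*} [CommRing K] [TopologicalSpace K] [DiscreteTopology K]

/-- The completed tensor product of the universal enveloping algebra of the free Lie algebra `L̂W`,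
which is `T̂W`, with two copies of `L̂W`. The element `x ⊗ a ⊗ z` stands for `(x · da) ⊗ z`. -/
def lieTens (K : Type*) {I : Type*} [CommRing K] [TopologicalSpace K] [DiscreteTopology K]
    (d : I → ℤ) : Submodule K (List I × List I × List I → K) :=
  closedSpan {F | ∃ x, ∃ a ∈ freeLie K d, ∃ z ∈ freeLie K d, F = tens x (tens a z)}

/-- The Leibniz relation `(x · d[a, b]) ⊗ z - (-1)^|a| (x a · db) ⊗ z
+ (-1)^((|a| + 1)|b|) (x b · da) ⊗ z`, with `|a| = ka` and `|b| = kb`. -/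
def leibnizRel (d : I → ℤ) (ka kb : ℤ) (x a b z : List I → K) :
    List I × List I × List I → K :=
  tens x (tens (bracket d a b) z) - sgn K ka • tens (cmul x a) (tens b z) +
    sgn K ((ka + 1) * kb) • tens (cmul x b) (tens a z)

/-- The relation `ω ⊗ [y, z] - [ω, y] ⊗ z = ω ⊗ [y, z] + (-1)^(|ω||y|) (y ω) ⊗ z`, for the form
`ω = x · da` of degree `|x| + |a| + 1`, with `|x| = kx`, `|a| = ka` and `|y| = ky`. -/
def invarRel (d : I → ℤ) (kx ka ky : ℤ) (x a y z : List I → K) :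
    List I × List I × List I → K :=
  tens x (tens a (bracket d y z)) + sgn K ((kx + ka + 1) * ky) • tens (cmul y x) (tens a z)

/-- The relations that cut the Lie one-forms out of `T̂W ⊗ L̂W ⊗ L̂W`. -/
def lieRel (𝒦 : ℤ → AddSubgroup K) (d : I → ℤ) : Submodule K (List I × List I × List I → K) :=
  closedSpan
    ({F | ∃ (ka kb : ℤ) (x a b z : List I → K), a ∈ freeLie K d ∧ b ∈ freeLie K d ∧
        z ∈ freeLie K d ∧ a ∈ homog 𝒦 (wdeg d) ka ∧ b ∈ homog 𝒦 (wdeg d) kb ∧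
        F = leibnizRel d ka kb x a b z} ∪
      {F | ∃ (kx ka ky : ℤ) (x a y z : List I → K), a ∈ freeLie K d ∧ y ∈ freeLie K d ∧
        z ∈ freeLie K d ∧ x ∈ homog 𝒦 (wdeg d) kx ∧ a ∈ homog 𝒦 (wdeg d) ka ∧
        y ∈ homog 𝒦 (wdeg d) ky ∧ F = invarRel d kx ka ky x a y z})

/-- The module `DR¹_Lie(L̂W)` of Lie one-forms.  It is the part of degree one in forms of the
quotient of `Ω ⊗ Ω`, where `Ω = L̂W ⊕ Ω¹ ⊕ ⋯` is the Lie differential envelope, by the relations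
`u ⊗ v = (-1)^(|u||v|) v ⊗ u` and `u ⊗ [v, w] = [u, v] ⊗ w`.  The first relation identifies the
summand `L̂W ⊗ Ω¹` with `Ω¹ ⊗ L̂W`, and the second one then takes the form `invarRel`, whichever of
`u`, `v`, `w` is the one-form. -/
abbrev DR1Lie (𝒦 : ℤ → AddSubgroup K) (d : I → ℤ) : Type _ :=
  lieTens K d ⧸ (lieRel 𝒦 d).comap (lieTens K d).subtype

/-- The Lie derivative of an odd vector field,
`L((x · da) ⊗ z) = (M x · da) ⊗ z - (-1)^|x| (x · d(M a)) ⊗ z - (-1)^(|x| + |a|) (x · da) ⊗ M z`. -/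
def lieLieDer (d : I → ℤ) (M : (List I → K) →L[K] (List I → K)) :
    (List I × List I × List I → K) →L[K] (List I × List I × List I → K) where
  toFun F p := M (fun u => F (u, p.2.1, p.2.2)) p.1 -
    sgn K (wdeg d p.1) * M (fun v => F (p.1, v, p.2.2)) p.2.1 -
    sgn K (wdeg d p.1 + wdeg d p.2.1) * M (fun w => F (p.1, p.2.1, w)) p.2.2
  map_add' F G := by
    funext p
    have h1 : (fun u => (F + G) (u, p.2.1, p.2.2)) =
      (fun u => F (u, p.2.1, p.2.2)) + fun u => G (u, p.2.1, p.2.2) := rfl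
    have h2 : (fun v => (F + G) (p.1, v, p.2.2)) =
      (fun v => F (p.1, v, p.2.2)) + fun v => G (p.1, v, p.2.2) := rfl
    have h3 : (fun v => (F + G) (p.1, p.2.1, v)) =
      (fun v => F (p.1, p.2.1, v)) + fun v => G (p.1, p.2.1, v) := rfl
    rw [h1, h2, h3, map_add, map_add, map_add]
    simp only [Pi.add_apply]
    ring
  map_smul' k F := by
    funext p
    have h1 : (fun u => (k • F) (u, p.2.1, p.2.2)) = k • fun u => F (u, p.2.1, p.2.2) := rfl
    have h2 : (fun v => (k • F) (p.1, v, p.2.2)) = k • fun v => F (p.1, v, p.2.2) := rfl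
    have h3 : (fun v => (k • F) (p.1, p.2.1, v)) = k • fun v => F (p.1, p.2.1, v) := rfl
    rw [h1, h2, h3, map_smul, map_smul, map_smul]
    simp only [Pi.smul_apply, smul_eq_mul, RingHom.id_apply]
    ring
  cont := by
    refine continuous_pi fun p => ?_
    fun_prop

lemma lieLieDer_tens (d : I → ℤ) (M : (List I → K) →L[K] (List I → K)) (x a z : List I → K) :
    lieLieDer d M (tens x (tens a z)) = tens (M x) (tens a z) -
      tens (parityOp d x) (tens (M a) z) - tens (parityOp d x) (tens (parityOp d a) (M z)) := by
  funext ⟨p, q, r⟩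
  have h1 : (fun u => tens x (tens a z) (u, q, r)) = (a q * z r) • x := by
    funext u; simp only [tens, Pi.smul_apply, smul_eq_mul]; ring
  have h2 : (fun v => tens x (tens a z) (p, v, r)) = (x p * z r) • a := by
    funext u; simp only [tens, Pi.smul_apply, smul_eq_mul]; ring
  have h3 : (fun v => tens x (tens a z) (p, q, v)) = (x p * a q) • z := by
    funext u; simp only [tens, Pi.smul_apply, smul_eq_mul]; ring
  change M (fun u => tens x (tens a z) (u, q, r)) p -
    sgn K (wdeg d p) * M (fun v => tens x (tens a z) (p, v, r)) q -
    sgn K (wdeg d p + wdeg d q) * M (fun w => tens x (tens a z) (p, q, w)) r = _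
  rw [h1, h2, h3, map_smul, map_smul, map_smul, sgn_add]
  simp only [tens, parityOp, Pi.smul_apply, Pi.sub_apply, smul_eq_mul]
  ring

variable {𝒦 : ℤ → AddSubgroup K} {d : I → ℤ} {M : (List I → K) →L[K] (List I → K)}

lemma lieLieDer_lieTens (hM : IsOddField 𝒦 d M) {F : List I × List I × List I → K}
    (hF : F ∈ lieTens K d) : lieLieDer d M F ∈ lieTens K d := by
  refine map_closedSpan (isClosed_closedSpan _) (lieLieDer d M) ?_ hF
  rintro _ ⟨x, a, ha, z, hz, rfl⟩
  rw [lieLieDer_tens]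
  exact Submodule.sub_mem _ (Submodule.sub_mem _
    (tens_mem_closedSpan ⟨_, _, ha, _, hz, rfl⟩)
    (tens_mem_closedSpan ⟨_, _, hM.lie _ ha, _, hz, rfl⟩))
    (tens_mem_closedSpan ⟨_, _, parityOp_mem_freeLie ha, _, hM.lie _ hz, rfl⟩)

lemma parityOp_cmul (d : I → ℤ) (f g : List I → K) :
    parityOp d (cmul f g) = cmul (parityOp d f) (parityOp d g) := by
  funext w
  simp only [parityOp, cmul, mulMap, tens, mul_splitSum]
  refine splitSum_congr fun u v h => ?_
  rw [← h, wdeg_append, sgn_add]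
  ring

lemma cmul_smul_right (k : K) (f g : List I → K) : cmul f (k • g) = k • cmul f g := by
  funext w
  simp only [cmul, mulMap, tens, Pi.smul_apply, smul_eq_mul, mul_splitSum, mul_left_comm]

lemma bracket_smul_right (d : I → ℤ) (k : K) (f g : List I → K) :
    bracket d f (k • g) = k • bracket d f g := by
  funext w
  simp only [bracket, Pi.smul_apply, smul_eq_mul, mul_splitSum]
  exact splitSum_congr fun u v _ => by ring

lemma lieLieDer_leibnizRel [EvenlyGraded 𝒦] (hM : IsOddField 𝒦 d M) {ka kb : ℤ}
    {x a b z : List I → K} (ha : a ∈ homog 𝒦 (wdeg d) ka) (hb : b ∈ homog 𝒦 (wdeg d) kb) :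
    lieLieDer d M (leibnizRel d ka kb x a b z) = leibnizRel d ka kb (M x) a b z -
      leibnizRel d (ka + 1) kb (parityOp d x) (M a) b z -
      sgn K ka • leibnizRel d ka (kb + 1) (parityOp d x) a (M b) z -
      (sgn K ka * sgn K kb) • leibnizRel d ka kb (parityOp d x) a b (M z) := by
  have e1 : sgn K ((ka + 1 + 1) * kb) = sgn K ((ka + 1) * kb) * sgn K kb := by
    rw [← sgn_add]; congr 1; ring
  have e2 : sgn K ((ka + 1) * (kb + 1)) = -(sgn K ((ka + 1) * kb) * sgn K ka) := by
    rw [← sgn_add, ← mul_neg_one, ← sgn_one, ← sgn_add]; congr 1; ring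
  simp only [leibnizRel, map_add, map_sub, map_smul, lieLieDer_tens, hM.bracket_eq, hM.cmul_eq,
    ← bracket_parityOp, parityOp_cmul, parityOp_homog ha, parityOp_homog hb, bracket_smul_left,
    bracket_smul_right, cmul_smul_right, e1, e2, sgn_add ka 1, sgn_one]
  funext ⟨p, q, r⟩
  simp only [tens, Pi.add_apply, Pi.sub_apply, Pi.smul_apply, smul_eq_mul]
  have h := sgn_sq (K := K) ka
  have h' := sgn_sq (K := K) kb
  ring_nf
  grind

lemma lieLieDer_invarRel [EvenlyGraded 𝒦] (hM : IsOddField 𝒦 d M) {kx ka ky : ℤ}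
    {x a y z : List I → K} (hx : x ∈ homog 𝒦 (wdeg d) kx) (ha : a ∈ homog 𝒦 (wdeg d) ka)
    (hy : y ∈ homog 𝒦 (wdeg d) ky) :
    lieLieDer d M (invarRel d kx ka ky x a y z) = invarRel d (kx + 1) ka ky (M x) a y z -
      sgn K kx • invarRel d kx (ka + 1) ky x (M a) y z -
      (sgn K kx * sgn K ka) • invarRel d kx ka (ky + 1) x a (M y) z -
      (sgn K kx * sgn K ka * sgn K ky) • invarRel d kx ka ky x a y (M z) := by
  have e1 : sgn K ((kx + 1 + ka + 1) * ky) = sgn K ((kx + ka + 1) * ky) * sgn K ky := by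
    rw [← sgn_add]; congr 1; ring
  have e2 : sgn K ((kx + (ka + 1) + 1) * ky) = sgn K ((kx + ka + 1) * ky) * sgn K ky := by
    rw [← sgn_add]; congr 1; ring
  have e3 : sgn K ((kx + ka + 1) * (ky + 1)) =
      -(sgn K ((kx + ka + 1) * ky) * sgn K kx * sgn K ka) := by
    rw [← sgn_add, ← sgn_add, ← mul_neg_one, ← sgn_one, ← sgn_add]; congr 1; ring
  simp only [invarRel, map_add, map_sub, map_smul, lieLieDer_tens, hM.bracket_eq, hM.cmul_eq,
    parityOp_cmul, parityOp_homog hx, parityOp_homog ha, parityOp_homog hy, bracket_smul_left,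
    bracket_smul_right, cmul_smul_left, cmul_smul_right, e1, e2, e3]
  funext ⟨p, q, r⟩
  simp only [tens, Pi.add_apply, Pi.sub_apply, Pi.smul_apply, smul_eq_mul]
  have h := sgn_sq (K := K) kx
  have h' := sgn_sq (K := K) ka
  have h'' := sgn_sq (K := K) ky
  ring_nf
  grind

lemma lieLieDer_lieRel [EvenlyGraded 𝒦] (hM : IsOddField 𝒦 d M)
    {F : List I × List I × List I → K} (hF : F ∈ lieRel 𝒦 d) : lieLieDer d M F ∈ lieRel 𝒦 d := by
  refine map_closedSpan (isClosed_closedSpan _) (lieLieDer d M) ?_ hF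
  have A : ∀ {ka kb : ℤ} {x a b z : List I → K}, a ∈ freeLie K d → b ∈ freeLie K d →
      z ∈ freeLie K d → a ∈ homog 𝒦 (wdeg d) ka → b ∈ homog 𝒦 (wdeg d) kb →
      leibnizRel d ka kb x a b z ∈ lieRel 𝒦 d := fun ha hb hz ha' hb' =>
    tens_mem_closedSpan (Or.inl ⟨_, _, _, _, _, _, ha, hb, hz, ha', hb', rfl⟩)
  have B : ∀ {kx ka ky : ℤ} {x a y z : List I → K}, a ∈ freeLie K d → y ∈ freeLie K d →
      z ∈ freeLie K d → x ∈ homog 𝒦 (wdeg d) kx → a ∈ homog 𝒦 (wdeg d) ka →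
      y ∈ homog 𝒦 (wdeg d) ky → invarRel d kx ka ky x a y z ∈ lieRel 𝒦 d :=
    fun ha hy hz hx' ha' hy' =>
      tens_mem_closedSpan (Or.inr ⟨_, _, _, _, _, _, _, ha, hy, hz, hx', ha', hy', rfl⟩)
  rintro _ (⟨ka, kb, x, a, b, z, ha, hb, hz, ha', hb', rfl⟩ |
    ⟨kx, ka, ky, x, a, y, z, ha, hy, hz, hx', ha', hy', rfl⟩)
  · rw [lieLieDer_leibnizRel hM ha' hb']
    exact Submodule.sub_mem _ (Submodule.sub_mem _ (Submodule.sub_mem _ (A ha hb hz ha' hb')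
      (A (hM.lie _ ha) hb hz (hM.homog _ _ ha') hb'))
      (Submodule.smul_mem _ _ (A ha (hM.lie _ hb) hz ha' (hM.homog _ _ hb'))))
      (Submodule.smul_mem _ _ (A ha hb (hM.lie _ hz) ha' hb'))
  · rw [lieLieDer_invarRel hM hx' ha' hy']
    exact Submodule.sub_mem _ (Submodule.sub_mem _ (Submodule.sub_mem _
      (B ha hy hz (hM.homog _ _ hx') ha' hy')
      (Submodule.smul_mem _ _ (B (hM.lie _ ha) hy hz hx' (hM.homog _ _ ha') hy')))
      (Submodule.smul_mem _ _ (B ha (hM.lie _ hy) hz hx' ha' (hM.homog _ _ hy'))))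
      (Submodule.smul_mem _ _ (B ha hy (hM.lie _ hz) hx' ha' hy'))

end LieForms

section LieComplex
variable {K I : Type*} [CommRing K] [TopologicalSpace K] [DiscreteTopology K]
  {𝒦 : ℤ → AddSubgroup K} [GradedRing 𝒦] [EvenlyGraded 𝒦] {vdeg : I → ℤ}

/-- The Lie derivative along `m`, on `T̂W ⊗ L̂W ⊗ L̂W`. -/
def lieTensDer (m : CInfinityStructure 𝒦 vdeg) :
    lieTens K (suspDualDeg vdeg) →L[K] lieTens K (suspDualDeg vdeg) :=
  ((lieLieDer (suspDualDeg vdeg) m.ext).comp (lieTens K (suspDualDeg vdeg)).subtypeL).codRestrict _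
    fun F => lieLieDer_lieTens m.isOddField F.2

/-- The differential of the Harrison complex of a `C_∞`-structure: the Lie derivative along `m` on
Lie one-forms. -/
def lieDiff (m : CInfinityStructure 𝒦 vdeg) :
    DR1Lie 𝒦 (suspDualDeg vdeg) →L[K] DR1Lie 𝒦 (suspDualDeg vdeg) :=
  Submodule.liftQL _ ((Submodule.mkQL _).comp (lieTensDer m)) fun _ hF =>
    (Submodule.Quotient.mk_eq_zero _).2 (lieLieDer_lieRel m.isOddField hF)

end LieComplex

/-! ## The modified shuffle operator and its spectral projections -/

section Shuffle
variable {K I : Type*} [CommRing K]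

/-- The shuffle coproduct: the continuous algebra homomorphism `Δ : T̂W → T̂W ⊗ T̂W` for which the
`t_i` are primitive.  Since `Δ(t_i x) = (t_i ⊗ 1 + 1 ⊗ t_i) Δ(x)`, where
`(1 ⊗ t_i) (y ⊗ z) = (-1)^(|t_i||y|) y ⊗ t_i z`, the coefficient of `Δ f` at `t_u ⊗ t_v` is computed
by splitting off the first letter of the words in `f`. -/
def shufCoprod (d : I → ℤ) (f : List I → K) : List I → List I → K
  | [], v => f v
  | i :: u, [] => f (i :: u)
  | i :: u, j :: v => shufCoprod d (fun w => f (i :: w)) u (j :: v) +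
      sgn K (d j * wdeg d (i :: u)) * shufCoprod d (fun w => f (j :: w)) (i :: u) v
  termination_by u v => u.length + v.length

lemma shufCoprod_add (d : I → ℤ) (f g : List I → K) (u v : List I) :
    shufCoprod d (fun w => f w + g w) u v = shufCoprod d f u v + shufCoprod d g u v := by
  match u, v with
  | [], v => simp [shufCoprod]
  | i :: u, [] => simp [shufCoprod]
  | i :: u, j :: v =>
    rw [shufCoprod, shufCoprod_add, shufCoprod_add, shufCoprod, shufCoprod]
    ring
  termination_by u.length + v.length

lemma shufCoprod_smul (d : I → ℤ) (k : K) (f : List I → K) (u v : List I) :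
    shufCoprod d (fun w => k * f w) u v = k * shufCoprod d f u v := by
  match u, v with
  | [], v => simp [shufCoprod]
  | i :: u, [] => simp [shufCoprod]
  | i :: u, j :: v =>
    rw [shufCoprod, shufCoprod_smul, shufCoprod_smul, shufCoprod]
    ring
  termination_by u.length + v.length

/-- The modified shuffle operator `s = μ Δ`. -/
def shuffleOp (K : Type*) {I : Type*} [CommRing K] (d : I → ℤ) : Module.End K (List I → K) where
  toFun f := mulMap fun p => shufCoprod d f p.1 p.2
  map_add' f g := by
    funext w
    simp only [mulMap, Pi.add_apply, ← splitSum_add]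
    exact splitSum_congr fun u v _ => shufCoprod_add d f g u v
  map_smul' k f := by
    funext w
    simp only [mulMap, Pi.smul_apply, smul_eq_mul, mul_splitSum, RingHom.id_apply]
    exact splitSum_congr fun u v _ => shufCoprod_smul d k f u v

variable [Algebra ℚ K]

/-- The polynomial `e_n(j) = ∏ (s - λ_r) / (λ_j - λ_r)`, over `0 ≤ r ≤ n` with `r ≠ j`, in the
operator `s`, where `λ_r = 2^r`; it is zero for `j > n`.  It will be used on series that are
homogeneous of order `n` (linear combinations of words of length `n`). -/
noncomputable def hodgePoly (K : Type*) {I : Type*} [CommRing K] [Algebra ℚ K] (d : I → ℤ)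
    (n j : ℕ) : Module.End K (List I → K) :=
  if j ≤ n then
    Polynomial.aeval (shuffleOp K d)
      (Lagrange.basis (Finset.range (n + 1)) (fun r => (2 : ℚ) ^ r) j)
  else 0

/-- The operator `e(j)` on the completed tensor algebra, with components `e_n(j)`.  Since `s`
preserves the order, the part of order `n` of `e(j) f` consists of the coefficients of `e_n(j) f` at
the words of length `n`. -/
noncomputable def hodgeProj (K : Type*) {I : Type*} [CommRing K] [Algebra ℚ K] (d : I → ℤ)
    (j : ℕ) : Module.End K (List I → K) where
  toFun f w := hodgePoly K d w.length j f w
  map_add' f g := by funext w; rw [map_add]; rfl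
  map_smul' k f := by funext w; rw [map_smul]; rfl

/-- The operator `ẽ(j) = 1 ⊗ e(j)` on `W ⊗ T̂W`. -/
noncomputable def hodgeProjTilde (K : Type*) {I : Type*} [CommRing K] [Algebra ℚ K] (d : I → ℤ)
    (j : ℕ) : Module.End K (I × List I → K) where
  toFun F p := hodgeProj K d j (fun w => F (p.1, w)) p.2
  map_add' F G := by
    funext p
    exact congrFun (map_add (hodgeProj K d j) (fun w => F (p.1, w)) fun w => G (p.1, w)) p.2
  map_smul' k F := by
    funext p
    exact congrFun (map_smul (hodgeProj K d j) k fun w => F (p.1, w)) p.2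

end Shuffle

/-! ## The Harrison and Hochschild complexes -/

section Complexes
variable {K I : Type*} [CommRing K]

/-- The one-form `dx · y = d(x y) - (-1)^|x| x · dy`, for an element `F = x ⊗ y` of `W ⊗ T̂W`. -/
def thetaForm (d : I → ℤ) : (I × List I → K) →ₗ[K] (List I × List I → K) where
  toFun F
    | ([], i :: w) => F (i, w)
    | ([i], w) => -(sgn K (d i) * F (i, w))
    | _ => 0
  map_add' F G := by
    funext p
    match p with
    | ([], []) => simp
    | ([], i :: w) => simp
    | ([i], w) => simp [mul_add, add_comm]
    | (_ :: _ :: _, w) => simp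
  map_smul' k F := by
    funext p
    match p with
    | ([], []) => simp
    | ([], i :: w) => simp
    | ([i], w) => simp [mul_left_comm]
    | (_ :: _ :: _, w) => simp

variable [TopologicalSpace K] [DiscreteTopology K]

/-- The map `Θ : W ⊗ T̂W → DR¹_Ass(T̂W)`, `Θ(x ⊗ y) = dx · y`. -/
def theta (𝒦 : ℤ → AddSubgroup K) (d : I → ℤ) : (I × List I → K) →ₗ[K] DR1Ass 𝒦 d :=
  (assRel 𝒦 d).mkQ ∘ₗ thetaForm d

/-- The summand of index `j` of the Hodge decomposition of the Hochschild complex, the image of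
`ẽ(j)` under the identification `Θ` of `W ⊗ T̂W` with `DR¹_Ass(T̂W)`. -/
noncomputable def hodgeSummand [Algebra ℚ K] (𝒦 : ℤ → AddSubgroup K) (d : I → ℤ) (j : ℕ) :
    Submodule K (DR1Ass 𝒦 d) :=
  (LinearMap.range (hodgeProjTilde K d j)).map (theta 𝒦 d)

/-- The cochains of degree `n` of the Hochschild complex `Σ DR¹_Ass(T̂W)`.  In `DR¹` the form
`x · dy` has degree `|x| + |y|`, one less than in the differential envelope, and in `Σ DR¹` it has
degree `|x| + |y| - 1`. -/
def hochCochains (𝒦 : ℤ → AddSubgroup K) (d : I → ℤ) (n : ℤ) : AddSubgroup (DR1Ass 𝒦 d) :=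
  (homog 𝒦 (formDeg d) (n + 2)).map (assRel 𝒦 d).mkQ.toAddMonoidHom

/-- The cochains of degree `n` of the Harrison complex `Σ DR¹_Lie(L̂W)`, in which the form
`(x · da) ⊗ z` has degree `|x| + |a| + |z| - 1`. -/
def harrCochains (𝒦 : ℤ → AddSubgroup K) (d : I → ℤ) (n : ℤ) : AddSubgroup (DR1Lie 𝒦 d) :=
  ((homog 𝒦 (fun p => wdeg d p.1 + wdeg d p.2.1 + wdeg d p.2.2) (n + 1)).comap
    (lieTens K d).subtype.toAddMonoidHom).map
      ((lieRel 𝒦 d).comap (lieTens K d).subtype).mkQ.toAddMonoidHom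

/-- `D` is a differential of degree one for the given cochains. -/
def IsDifferential {M : Type*} [TopologicalSpace M] [AddCommGroup M] [Module K M]
    (C : ℤ → AddSubgroup M) (D : M →L[K] M) : Prop :=
  (∀ x, D (D x) = 0) ∧ ∀ n, ∀ x ∈ C n, D x ∈ C (n + 1)

/-- The iterated graded commutator `[g₁, [g₂, ⋯ [g_k, ω]]]` together with its degree, where `ω` is a
one-form of degree `n` and the list consists of the pairs `(|g_i|, g_i)`. -/
def iterComm (d : I → ℤ) (gs : List (ℤ × (List I → K))) (n : ℤ) (ω : List I × List I → K) :
    ℤ × (List I × List I → K) :=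
  gs.foldr (fun g p => (g.1 + p.1, formComm d g.1 p.1 g.2 p.2)) (n, ω)

/-- The product `g₁ g₂ ⋯ g_k`. -/
def listProd (gs : List (ℤ × (List I → K))) : List I → K :=
  gs.foldr (fun g x => cmul g.2 x) one

/-- `l : DR¹_Lie(L̂W) → DR¹_Ass(T̂W)` is the map `l (ω ⊗ z) = l' (ω) z`, where `l'` is the extension
of the inclusion `L̂W → T̂W` to a map of differential graded Lie algebras of forms, so that
`l' (g₁ ⋯ g_k · da) = [g₁, [g₂, ⋯ [g_k, da]]]` for `g_i`, `a` in `L̂W`. -/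
def IsLieToAss (𝒦 : ℤ → AddSubgroup K) (d : I → ℤ) (l : DR1Lie 𝒦 d →L[K] DR1Ass 𝒦 d) : Prop :=
  ∀ (gs : List (ℤ × (List I → K))) (k : ℤ) (a z : List I → K),
    (∀ g ∈ gs, g.2 ∈ freeLie K d ∧ g.2 ∈ homog 𝒦 (wdeg d) g.1) →
    a ∈ freeLie K d → a ∈ homog 𝒦 (wdeg d) k → z ∈ freeLie K d →
    ∀ F : lieTens K d, (F : List I × List I × List I → K) = tens (listProd gs) (tens a z) →
      l (Submodule.Quotient.mk F) =
        Submodule.Quotient.mk (formRight d (iterComm d gs (k + 1) (tens one a)).2 z)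

end Complexes

end FormalGeom

open FormalGeom

/-!
Write `H = W ⊗ T̂W`, and let `e = e(1)`.  All three modules of one-forms are compared inside `H`.

*Associative forms.*  Modulo graded commutators every one-form can be rotated into a combination
of forms `dt_i · t_w`, namely `t_x · d(t_a) = ± d(t_a) · t_x` and
`d(t_i t_a) · t_z = dt_i · (t_a t_z) ± d(t_a) · (t_z t_i)`.  The resulting map `formCyc` from forms
to `H` kills the relations and is inverse to `Θ` (`formCyc_formComm`, `formCyc_thetaForm`,
`sub_thetaForm_formCyc_mem`).  Its restriction to the forms `da · z` is `cyc`.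

*Lie forms.*  The map `l`, followed by `Θ⁻¹`, is `lam`: moving the left factor of `(x · da) ⊗ z`
into `z` by the invariance relation, it is determined by `lam (1 ⊗ a ⊗ z) = cyc (a ⊗ z)`.  It kills
the relations (`lam_eq_zero`), agrees with iterated commutators (`lam_listProd`), and takes values
in the submodule `W ⊗ L̂W` of `H` (`lam_mem_headLie`), because
`cyc ([a, b] ⊗ z) = cyc (a ⊗ [b, z]) - (±) cyc (b ⊗ [a, z])`.  The same relations show that every
Lie form is equivalent to a combination of the `dt_i ⊗ z` (`sub_emb_lam_mem`), so `lam` identifies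
`DR¹_Lie` with `W ⊗ L̂W`, with inverse `emb`.

*The Hodge projection.*  The elements of `L̂W` are primitive, so `s = 2` and hence `e = 1` on them
(`shuffleOp_lie`, `hodgeProj_one_lie`).  On products of `k` Lie elements `s` is `2^k` up to products
of fewer Lie elements (`LieProd.shuffleOp_sub_mem`); therefore the factors `s - 2^r`, `2 ≤ r ≤ n`,
of `e_n(1)` bring a word of length `n` down to `K + L̂W`, and the factor `s - 1` removes `K`
(`hodgeProj_one_mem`).  Thus `e` projects `T̂W` onto `L̂W` and `ẽ(1)` projects `H` onto `W ⊗ L̂W`,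
which makes `l` an isomorphism onto the Hodge summand, split by `emb ∘ ẽ(1) ∘ Θ⁻¹`.

*The differentials.*  Derivations of `T̂W` that preserve `L̂W` commute with `Δ` and `μ`, hence with
`s` and `e` (`IsLieDer.shuffleOp_comm`, `hodgeProj_one_comm`).  For the inner derivations `[a, ·]`
this gives `ẽ(1) (cyc (a ⊗ z)) = cyc (a ⊗ e z)` for `a ∈ L̂W`, and together with the case of `m` it
shows that `ẽ(1)` commutes with the Lie derivative on `H` (`hodgeProjTilde_one_headDer`).  That
`lam` does so as well need only be checked on the forms `dt_i ⊗ z` (`lam_lieLieDer`).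

All operations are continuous, so that identities are verified on basis elements; the predicate
`IsCL` and the lemmas `IsCL.mem`, `IsCL.eq` serve this purpose.  Since `K` is evenly graded, the
signs depend only on parities of words (`HasPar`).
-/

namespace FormalGeom
set_option linter.unusedSectionVars false

/-! ### Continuous linear maps between formal modules -/

section Formal
variable {K X Y Z : Type*} [CommRing K]

open Classical in
/-- The topological basis element of index `x`. -/
noncomputable def bas (x : X) : X → K := fun y => if y = x then 1 else 0

open Classical in
lemma bas_apply (x y : X) : (bas x y : K) = if y = x then 1 else 0 := rfl

lemma bas_self (x : X) : (bas x x : K) = 1 := if_pos rfl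

lemma bas_ne {x y : X} (h : y ≠ x) : (bas x y : K) = 0 := if_neg h

lemma eq_of_bas_ne_zero {x y : X} (h : (bas x y : K) ≠ 0) : y = x := by
  by_contra h'
  exact h (bas_ne h')

lemma bas_prod (x : X) (y : Y) : (bas (x, y) : X × Y → K) = tens (bas x) (bas y) := by
  classical
  funext ⟨u, v⟩
  simp only [tens, bas_apply, Prod.mk.injEq]
  split_ifs <;> simp_all

lemma tens_bas (x : X) (y : Y) : tens (bas x) (bas y) = (bas (x, y) : X × Y → K) :=
  (bas_prod x y).symm

lemma bas_cons {I : Type*} (i : I) (u w : List I) : (bas (i :: u) (i :: w) : K) = bas u w := by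
  classical
  simp [bas_apply]

variable [TopologicalSpace K] [DiscreteTopology K]

lemma hasSum_bas (F : X → K) : HasSum (fun x => F x • (bas x : X → K)) F := by
  rw [Pi.hasSum]
  intro y
  convert hasSum_single (f := fun x => (F x • (bas x : X → K)) y) y ?_ using 1
  · simp [bas_self]
  · intro x hx
    simp [bas_ne hx.symm]

/-- Continuous linearity, as a property of a function.  As a predicate on functions it can be
proved by `fun_prop` for maps that are given by formulas. -/
@[fun_prop]
def IsCL (K : Type*) [CommRing K] {E F : Type*} [AddCommGroup E] [Module K E] [TopologicalSpace E]
    [AddCommGroup F] [Module K F] [TopologicalSpace F] (A : E → F) : Prop :=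
  ∃ L : E →L[K] F, ∀ f, A f = L f

section Module
variable {E F G : Type*} [AddCommGroup E] [Module K E] [TopologicalSpace E]
  [AddCommGroup F] [Module K F] [TopologicalSpace F] [AddCommGroup G] [Module K G]
  [TopologicalSpace G]

lemma IsCL.clm (L : E →L[K] F) : IsCL K (L : E → F) := ⟨L, fun _ => rfl⟩

@[fun_prop]
lemma IsCL.id : IsCL K (fun f : E => f) := ⟨ContinuousLinearMap.id K _, fun _ => rfl⟩

@[fun_prop]
lemma IsCL.comp {B : F → G} {A : E → F} (hB : IsCL K B) (hA : IsCL K A) :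
    IsCL K (fun f => B (A f)) := by
  obtain ⟨L, hL⟩ := hA
  obtain ⟨M, hM⟩ := hB
  exact ⟨M.comp L, fun f => by simp [hL, hM]⟩

@[fun_prop]
lemma IsCL.clm_comp (L : F →L[K] G) {A : E → F} (hA : IsCL K A) :
    IsCL K (fun f => L (A f)) := (IsCL.clm L).comp hA

/-- A map given by a formula that is linear and continuous. -/
lemma IsCL.mk' {A : E → F} (h1 : ∀ f g, A (f + g) = A f + A g)
    (h2 : ∀ (k : K) f, A (k • f) = k • A f) (h3 : Continuous A) : IsCL K A :=
  ⟨⟨⟨⟨A, h1⟩, h2⟩, h3⟩, fun _ => rfl⟩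

lemma IsCL.map_add {A : E → F} (hA : IsCL K A) (f g : E) : A (f + g) = A f + A g := by
  obtain ⟨L, hL⟩ := hA
  simp only [hL, _root_.map_add]

lemma IsCL.map_sub {A : E → F} (hA : IsCL K A) (f g : E) : A (f - g) = A f - A g := by
  obtain ⟨L, hL⟩ := hA
  simp only [hL, _root_.map_sub]

lemma IsCL.map_smul {A : E → F} (hA : IsCL K A) (k : K) (f : E) : A (k • f) = k • A f := by
  obtain ⟨L, hL⟩ := hA
  simp only [hL, _root_.map_smul]

variable [IsTopologicalAddGroup F]

@[fun_prop]
lemma IsCL.add {A B : E → F} (hA : IsCL K A) (hB : IsCL K B) :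
    IsCL K (fun f => A f + B f) := by
  obtain ⟨L, hL⟩ := hA
  obtain ⟨M, hM⟩ := hB
  exact ⟨L + M, fun f => by simp [hL, hM]⟩

@[fun_prop]
lemma IsCL.sub {A B : E → F} (hA : IsCL K A) (hB : IsCL K B) :
    IsCL K (fun f => A f - B f) := by
  obtain ⟨L, hL⟩ := hA
  obtain ⟨M, hM⟩ := hB
  exact ⟨L - M, fun f => by simp [hL, hM]⟩

@[fun_prop]
lemma IsCL.neg {A : E → F} (hA : IsCL K A) : IsCL K (fun f => -A f) := by
  obtain ⟨L, hL⟩ := hA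
  exact ⟨-L, fun f => by simp [hL]⟩

@[fun_prop]
lemma IsCL.smul [ContinuousConstSMul K F] (k : K) {A : E → F} (hA : IsCL K A) :
    IsCL K (fun f => k • A f) := by
  obtain ⟨L, hL⟩ := hA
  exact ⟨k • L, fun f => by simp [hL]⟩

end Module

/-- A continuous linear map sends `F` into a closed submodule as soon as it does so with the basis
elements in the support of `F`. -/
lemma IsCL.mem {A : (X → K) → (Y → K)} (hA : IsCL K A) {N : Submodule K (Y → K)}
    (hN : IsClosed (N : Set (Y → K))) {F : X → K} (h : ∀ x, F x ≠ 0 → A (bas x) ∈ N) :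
    A F ∈ N := by
  obtain ⟨L, hL⟩ := hA
  rw [hL]
  have hs := (hasSum_bas F).mapL L
  refine hN.mem_of_tendsto hs (Filter.Eventually.of_forall fun s => ?_)
  refine N.sum_mem fun x _ => ?_
  rw [_root_.map_smul]
  by_cases hx : F x = 0
  · rw [hx, zero_smul]; exact N.zero_mem
  · rw [← hL]; exact N.smul_mem _ (h x hx)

lemma isClosed_bot' : IsClosed ((⊥ : Submodule K (Y → K)) : Set (Y → K)) := by
  rw [Submodule.bot_coe]; exact isClosed_singleton

/-- Two continuous linear maps agree on `F` as soon as they agree on the basis elements in the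
support of `F`. -/
lemma IsCL.eq {A B : (X → K) → (Y → K)} (hA : IsCL K A) (hB : IsCL K B) {F : X → K}
    (h : ∀ x, F x ≠ 0 → A (bas x) = B (bas x)) : A F = B F := by
  have := (hA.sub hB).mem isClosed_bot' (F := F) fun x hx => by
    rw [h x hx, sub_self]; exact Submodule.zero_mem _
  exact sub_eq_zero.1 this

lemma IsCL.eq_zero {A : (X → K) → (Y → K)} (hA : IsCL K A) {F : X → K}
    (h : ∀ x, F x ≠ 0 → A (bas x) = 0) : A F = 0 :=
  (Submodule.mem_bot K).1 (hA.mem isClosed_bot' fun x hx => (Submodule.mem_bot K).2 (h x hx))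

lemma IsCL.preimage {A : (X → K) → (Y → K)} (hA : IsCL K A) {N : Submodule K (Y → K)}
    (hN : IsClosed (N : Set (Y → K))) {S : Set (X → K)} (h : ∀ f ∈ S, A f ∈ N) {F : X → K}
    (hF : F ∈ closedSpan S) : A F ∈ N := by
  obtain ⟨L, hL⟩ := hA
  rw [hL]
  exact map_closedSpan hN L (fun f hf => hL f ▸ h f hf) hF

lemma IsCL.eqOn {A B : (X → K) → (Y → K)} (hA : IsCL K A) (hB : IsCL K B) {S : Set (X → K)}
    (h : ∀ f ∈ S, A f = B f) {F : X → K} (hF : F ∈ closedSpan S) : A F = B F := by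
  have := (hA.sub hB).preimage isClosed_bot' (S := S) (fun f hf => by
    rw [h f hf, sub_self]; exact Submodule.zero_mem _) hF
  exact sub_eq_zero.1 this

/-- The continuous linear map with prescribed values on a topological basis, for a family of values
in which every coordinate occurs finitely often. -/
noncomputable def ofBasis (Φ : X → Y → K) (h : ∀ y, {x | Φ x y ≠ 0}.Finite) :
    (X → K) →L[K] (Y → K) where
  toFun F y := ∑ x ∈ (h y).toFinset, F x * Φ x y
  map_add' F G := by funext y; simp [add_mul, Finset.sum_add_distrib]
  map_smul' k F := by funext y; simp [Finset.mul_sum, mul_assoc]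
  cont := by
    refine continuous_pi fun y => ?_
    fun_prop

lemma ofBasis_apply (Φ : X → Y → K) (h : ∀ y, {x | Φ x y ≠ 0}.Finite) (F : X → K) (y : Y) :
    ofBasis Φ h F y = ∑ x ∈ (h y).toFinset, F x * Φ x y := rfl

@[simp]
lemma ofBasis_bas (Φ : X → Y → K) (h : ∀ y, {x | Φ x y ≠ 0}.Finite) (x : X) :
    ofBasis Φ h (bas x) = Φ x := by
  funext y
  rw [ofBasis_apply, Finset.sum_eq_single x]
  · rw [bas_self, one_mul]
  · intro b _ hb
    rw [bas_ne hb, zero_mul]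
  · intro hx
    rw [Set.Finite.mem_toFinset, Set.mem_ofPred_eq, not_not] at hx
    rw [hx, mul_zero]

lemma ofBasis_homog {𝒦 : ℤ → AddSubgroup K} [GradedRing 𝒦] {dX : X → ℤ} {dY : Y → ℤ}
    (Φ : X → Y → K) (h : ∀ y, {x | Φ x y ≠ 0}.Finite) (hΦ : ∀ x, Φ x ∈ homog 𝒦 dY (dX x))
    {n : ℤ} {F : X → K} (hF : F ∈ homog 𝒦 dX n) : ofBasis Φ h F ∈ homog 𝒦 dY n := by
  intro y
  rw [ofBasis_apply]
  refine AddSubgroup.sum_mem _ fun x _ => ?_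
  have := SetLike.GradedMul.mul_mem (hF x) (hΦ x y)
  convert this using 2
  ring

end Formal

/-! ### The bilinear operations -/

section Ops
variable {K I X Y Z : Type*} [CommRing K]

/-- The product of `f` with the sign `(-1)^(n |w|)` at each word `w`. -/
def tw (d : I → ℤ) (n : ℤ) (f : List I → K) : List I → K := fun w => sgn K (n * wdeg d w) * f w

variable [TopologicalSpace K] [DiscreteTopology K]

@[fun_prop]
lemma isCL_tens_right (f : X → K) {A : (Z → K) → (Y → K)} (hA : IsCL K A) :
    IsCL K (fun g => tens f (A g)) := by
  refine IsCL.comp (B := fun g => tens f g) (IsCL.mk' (fun g h => ?_) (fun k g => ?_) ?_) hA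
  · funext p; simp [tens, mul_add]
  · funext p; simp [tens, mul_left_comm]
  · unfold tens; fun_prop

@[fun_prop]
lemma isCL_tens_left (f : X → K) {A : (Z → K) → (Y → K)} (hA : IsCL K A) :
    IsCL K (fun g => tens (A g) f) := by
  refine IsCL.comp (B := fun g => tens g f) (IsCL.mk' (fun g h => ?_) (fun k g => ?_) ?_) hA
  · funext p; simp [tens, add_mul]
  · funext p; simp [tens, mul_assoc]
  · unfold tens; fun_prop

@[fun_prop]
lemma isCL_mulMap {A : (Z → K) → (List I × List I → K)} (hA : IsCL K A) :
    IsCL K (fun g => mulMap (A g)) := by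
  refine IsCL.comp (B := fun g : List I × List I → K => mulMap g)
    (IsCL.mk' (fun g h => ?_) (fun k g => ?_) ?_) hA
  · funext p; simp [mulMap, splitSum_add]
  · funext p; simp [mulMap, mul_splitSum]
  · unfold mulMap splitSum; fun_prop

@[fun_prop]
lemma isCL_cmul_right (f : List I → K) {A : (Z → K) → (List I → K)} (hA : IsCL K A) :
    IsCL K (fun g => cmul f (A g)) := by
  unfold cmul; fun_prop

@[fun_prop]
lemma isCL_cmul_left (f : List I → K) {A : (Z → K) → (List I → K)} (hA : IsCL K A) :
    IsCL K (fun g => cmul (A g) f) := by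
  unfold cmul; fun_prop

@[fun_prop]
lemma isCL_tw (d : I → ℤ) (n : ℤ) {A : (Z → K) → (List I → K)} (hA : IsCL K A) :
    IsCL K (fun g => tw d n (A g)) := by
  refine IsCL.comp (B := fun g : List I → K => tw d n g)
    (IsCL.mk' (fun g h => ?_) (fun k g => ?_) ?_) hA
  · funext p; simp [tw, mul_add]
  · funext p; simp [tw, mul_left_comm]
  · unfold tw; fun_prop

@[fun_prop]
lemma isCL_bracket_right (d : I → ℤ) (f : List I → K) {A : (Z → K) → (List I → K)} (hA : IsCL K A) :
    IsCL K (fun g => bracket d f (A g)) := by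
  refine IsCL.comp (B := fun g => bracket d f g)
    (IsCL.mk' (bracket_add_right d f) (fun k => bracket_smul_right d k f) ?_) hA
  unfold bracket splitSum; fun_prop

@[fun_prop]
lemma isCL_bracket_left (d : I → ℤ) (f : List I → K) {A : (Z → K) → (List I → K)} (hA : IsCL K A) :
    IsCL K (fun g => bracket d (A g) f) := by
  refine IsCL.comp (B := fun g => bracket d g f)
    (IsCL.mk' (fun g h => bracket_add_left d g h f) (fun k g => bracket_smul_left d k g f) ?_) hA
  unfold bracket splitSum; fun_prop

@[fun_prop]
lemma isCL_formLeft_left (ω : List I × List I → K) {A : (Z → K) → (List I → K)} (hA : IsCL K A) :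
    IsCL K (fun g => formLeft (A g) ω) := by
  refine IsCL.comp (B := fun g => formLeft g ω)
    (IsCL.mk' (fun g h => ?_) (fun k g => formLeft_smul k g ω) ?_) hA
  · funext p; simp [formLeft, cmul_add_left]
  · unfold formLeft cmul mulMap splitSum tens; fun_prop

@[fun_prop]
lemma isCL_formLeft_right (a : List I → K) {A : (Z → K) → (List I × List I → K)} (hA : IsCL K A) :
    IsCL K (fun g => formLeft a (A g)) := by
  refine IsCL.comp (B := fun g => formLeft a g)
    (IsCL.mk' (fun g h => ?_) (fun k g => ?_) ?_) hA
  · funext p; simp [formLeft, cmul, mulMap, tens, mul_add, splitSum_add]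
  · funext p; simp [formLeft, cmul, mulMap, tens, mul_left_comm, mul_splitSum]
  · unfold formLeft cmul mulMap splitSum tens; fun_prop

@[fun_prop]
lemma isCL_formRight_left (d : I → ℤ) (a : List I → K) {A : (Z → K) → (List I × List I → K)}
    (hA : IsCL K A) : IsCL K (fun g => formRight d (A g) a) := by
  refine IsCL.comp (B := fun g => formRight d g a)
    (IsCL.mk' (fun g h => ?_) (fun k g => formRight_smul k a g) ?_) hA
  · funext p
    simp only [formRight, cmul, mulMap, tens, Pi.add_apply, mul_add, add_mul, splitSum_add]
    ring
  · unfold formRight cmul mulMap splitSum tens; fun_prop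

@[fun_prop]
lemma isCL_formRight_right (d : I → ℤ) (ω : List I × List I → K) {A : (Z → K) → (List I → K)}
    (hA : IsCL K A) : IsCL K (fun g => formRight d ω (A g)) := by
  refine IsCL.comp (B := fun g => formRight d ω g)
    (IsCL.mk' (fun g h => ?_) (fun k g => ?_) ?_) hA
  · funext p
    simp only [formRight, cmul, mulMap, tens, Pi.add_apply, mul_add, splitSum_add]
    ring
  · funext p
    simp only [formRight, cmul, mulMap, tens, Pi.smul_apply, smul_eq_mul, mul_sub, mul_splitSum]
    congr 1
    · exact splitSum_congr fun u v _ => by ring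
    · ring
  · unfold formRight cmul mulMap splitSum tens; fun_prop

end Ops

/-! ### The graded algebra of noncommutative power series -/

section Algebra
variable {K I X Y : Type*} [CommRing K] [TopologicalSpace K] [DiscreteTopology K]

lemma sgn_congr {a b : ℤ} (h : Even (a - b)) : sgn K a = sgn K b := by
  have : a = (a - b) + b := by ring
  rw [this, sgn_add, sgn_even h, one_mul]

/-- All degrees that occur in `f` have the parity of `n`.  Over an evenly graded ring this holds for
the homogeneous elements of degree `n`, and it is all that the signs depend on. -/
def HasPar (dX : X → ℤ) (n : ℤ) (f : X → K) : Prop := ∀ x, f x ≠ 0 → Even (n - dX x)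

lemma HasPar.of_homog {𝒦 : ℤ → AddSubgroup K} [EvenlyGraded 𝒦] {dX : X → ℤ} {n : ℤ} {f : X → K}
    (hf : f ∈ homog 𝒦 dX n) : HasPar dX n f := by
  intro x hx
  by_contra h
  have := hf x
  rw [EvenlyGraded.odd_eq_bot (𝒦 := 𝒦) _ (Int.not_even_iff_odd.1 h), AddSubgroup.mem_bot] at this
  exact hx this

lemma hasPar_bas (dX : X → ℤ) (x : X) : HasPar dX (dX x) (bas x : X → K) := by
  intro y hy
  rw [eq_of_bas_ne_zero hy, sub_self]
  exact Even.zero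

lemma HasPar.sgn_mul {dX : X → ℤ} {n : ℤ} {f : X → K} (hf : HasPar dX n f) (k : ℤ) (x : X) :
    sgn K (k * dX x) * f x = sgn K (k * n) * f x := by
  by_cases hx : f x = 0
  · rw [hx, mul_zero, mul_zero]
  · rw [sgn_congr (a := k * n)]
    rw [← mul_sub]
    exact (hf x hx).mul_left k

lemma HasPar.add {dX : X → ℤ} {n : ℤ} {f g : X → K} (hf : HasPar dX n f) (hg : HasPar dX n g) :
    HasPar dX n (f + g) := by
  intro x hx
  by_cases h : f x = 0
  · exact hg x fun h' => hx (by simp [h, h'])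
  · exact hf x h

lemma HasPar.smul {dX : X → ℤ} {n : ℤ} {f : X → K} (hf : HasPar dX n f) (k : K) :
    HasPar dX n (k • f) := fun x hx => hf x fun h => hx (by simp [h])

lemma HasPar.sub {dX : X → ℤ} {n : ℤ} {f g : X → K} (hf : HasPar dX n f) (hg : HasPar dX n g) :
    HasPar dX n (f - g) := by
  have : f - g = f + (-1 : K) • g := by simp [sub_eq_add_neg]
  rw [this]
  exact hf.add (hg.smul _)

lemma hasPar_zero (dX : X → ℤ) (n : ℤ) : HasPar dX n (0 : X → K) := fun _ h => absurd rfl h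

lemma HasPar.tens {dX : X → ℤ} {dY : Y → ℤ} {m n : ℤ} {f : X → K} {g : Y → K}
    (hf : HasPar dX m f) (hg : HasPar dY n g) :
    HasPar (fun p : X × Y => dX p.1 + dY p.2) (m + n) (tens f g) := by
  intro p hp
  rw [show m + n - (dX p.1 + dY p.2) = (m - dX p.1) + (n - dY p.2) by ring]
  exact (hf _ (left_ne_zero_of_mul hp)).add (hg _ (right_ne_zero_of_mul hp))

lemma exists_ne_zero_of_splitSum {F : List I → List I → K} {w : List I} (h : splitSum F w ≠ 0) :
    ∃ u v, u ++ v = w ∧ F u v ≠ 0 := by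
  obtain ⟨k, -, hk⟩ := Finset.exists_ne_zero_of_sum_ne_zero h
  exact ⟨_, _, List.take_append_drop k w, hk⟩

lemma exists_ne_zero_of_cmul {f g : List I → K} {w : List I} (h : cmul f g w ≠ 0) :
    ∃ u v, u ++ v = w ∧ f u ≠ 0 ∧ g v ≠ 0 := by
  obtain ⟨u, v, huv, h⟩ := exists_ne_zero_of_splitSum (F := fun u v => tens f g (u, v)) h
  exact ⟨u, v, huv, left_ne_zero_of_mul h, right_ne_zero_of_mul h⟩

lemma HasPar.cmul {d : I → ℤ} {m n : ℤ} {f g : List I → K} (hf : HasPar (wdeg d) m f)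
    (hg : HasPar (wdeg d) n g) : HasPar (wdeg d) (m + n) (cmul f g) := by
  intro w hw
  obtain ⟨u, v, rfl, hu, hv⟩ := exists_ne_zero_of_cmul hw
  rw [wdeg_append, show m + n - (wdeg d u + wdeg d v) = (m - wdeg d u) + (n - wdeg d v) by ring]
  exact (hf _ hu).add (hg _ hv)

lemma cmul_homog {𝒦 : ℤ → AddSubgroup K} [GradedRing 𝒦] {d : I → ℤ} {m n : ℤ} {f g : List I → K}
    (hf : f ∈ homog 𝒦 (wdeg d) m) (hg : g ∈ homog 𝒦 (wdeg d) n) :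
    cmul f g ∈ homog 𝒦 (wdeg d) (m + n) := by
  intro w
  rw [cmul, mulMap, splitSum]
  refine AddSubgroup.sum_mem (𝒦 _) fun k _ => ?_
  have := SetLike.GradedMul.mul_mem (hf (w.take k)) (hg (w.drop k))
  have h : wdeg d w = wdeg d (w.take k) + wdeg d (w.drop k) := by
    rw [← wdeg_append, List.take_append_drop]
  convert this using 2
  · rw [h]; ring
  · rfl

/-! #### Products -/

lemma cmul_nil (f g : List I → K) : cmul f g [] = f [] * g [] := by
  simp [cmul, mulMap, splitSum_nil, tens]

lemma cmul_cons (f g : List I → K) (i : I) (w : List I) :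
    cmul f g (i :: w) = f [] * g (i :: w) + cmul (fun u => f (i :: u)) g w := by
  simp [cmul, mulMap, splitSum_cons, tens]

lemma cmul_zero_left (g : List I → K) : cmul 0 g = 0 := by
  funext w
  simp [cmul, mulMap, tens, splitSum_zero]

lemma cmul_add_right (f g g' : List I → K) : cmul f (g + g') = cmul f g + cmul f g' := by
  funext w
  simp only [cmul, mulMap, tens, Pi.add_apply, ← splitSum_add, mul_add]

lemma cmul_neg_left (f g : List I → K) : cmul (-f) g = -cmul f g := by
  rw [← neg_one_smul K f, cmul_smul_left, neg_one_smul]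

lemma cmul_neg_right (f g : List I → K) : cmul f (-g) = -cmul f g := by
  rw [← neg_one_smul K g, cmul_smul_right, neg_one_smul]

lemma cmul_sub_left (f f' g : List I → K) : cmul (f - f') g = cmul f g - cmul f' g := by
  rw [sub_eq_add_neg, cmul_add_left, cmul_neg_left, ← sub_eq_add_neg]

lemma cmul_sub_right (f g g' : List I → K) : cmul f (g - g') = cmul f g - cmul f g' := by
  rw [sub_eq_add_neg, cmul_add_right, cmul_neg_right, ← sub_eq_add_neg]

lemma one_eq_bas : (one : List I → K) = bas [] := by
  classical
  funext w
  cases w <;> simp [one, bas_apply]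

lemma orderOne_bas (i : I) : orderOne (bas i) = (bas [i] : List I → K) := by
  classical
  funext w
  match w with
  | [] => simp [orderOne, bas_apply]
  | [j] => simp [orderOne, bas_apply]
  | _ :: _ :: _ => simp [orderOne, bas_apply]

lemma one_cmul (f : List I → K) : cmul one f = f := by
  funext w
  cases w with
  | nil => simp [cmul_nil, one]
  | cons i w =>
    have : (fun u => (one (i :: u) : K)) = 0 := rfl
    rw [cmul_cons, this, cmul_zero_left]
    simp [one]

lemma cmul_one (f : List I → K) : cmul f one = f := by
  funext w
  induction w generalizing f with
  | nil => simp [cmul_nil, one]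
  | cons i w ih => rw [cmul_cons, ih]; simp [one]

lemma cmul_assoc (f g h : List I → K) : cmul (cmul f g) h = cmul f (cmul g h) := by
  funext w
  simp only [cmul, mulMap, tens, mul_splitSum, splitSum_mul]
  rw [splitSum_assoc (fun u v₁ v₂ => f u * (g v₁ * h v₂))]
  simp only [mul_assoc]

lemma letter_cmul_nil (i : I) (f : List I → K) : cmul (bas [i]) f [] = 0 := by
  rw [cmul_nil, bas_ne (by simp), zero_mul]

open Classical in
lemma letter_cmul_cons (i : I) (f : List I → K) (j : I) (w : List I) :
    cmul (bas [i]) f (j :: w) = if j = i then f w else 0 := by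
  rw [cmul_cons, bas_ne (by simp), zero_mul, zero_add]
  split_ifs with h
  · subst h
    have : (fun u => (bas [j] (j :: u) : K)) = one := by
      rw [one_eq_bas]; funext u; exact bas_cons j [] u
    rw [this, one_cmul]
  · have : (fun u => (bas [i] (j :: u) : K)) = 0 := by
      funext u; exact bas_ne (by simp [h])
    rw [this, cmul_zero_left]; rfl

lemma cmul_bas (u v : List I) : cmul (bas u) (bas v) = (bas (u ++ v) : List I → K) := by
  classical
  induction u with
  | nil => rw [← one_eq_bas, one_cmul]; rfl
  | cons i u ih =>
    have h : ∀ w : List I, (bas (i :: w) : List I → K) = cmul (bas [i]) (bas w) := by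
      intro w
      funext x
      cases x with
      | nil => rw [letter_cmul_nil, bas_ne (by simp)]
      | cons j x =>
        rw [letter_cmul_cons]
        split_ifs with hj
        · rw [hj, bas_cons]
        · exact bas_ne (by simp [hj])
    rw [h, cmul_assoc, ih, ← h]; rfl

/-! #### Signs -/

lemma tw_add (d : I → ℤ) (n : ℤ) (f g : List I → K) : tw d n (f + g) = tw d n f + tw d n g := by
  funext w; simp [tw, mul_add]

lemma tw_sub (d : I → ℤ) (n : ℤ) (f g : List I → K) : tw d n (f - g) = tw d n f - tw d n g := by
  funext w; simp [tw, mul_sub]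

lemma tw_smul (d : I → ℤ) (n : ℤ) (k : K) (f : List I → K) : tw d n (k • f) = k • tw d n f := by
  funext w; simp [tw, mul_left_comm]

lemma tw_cmul (d : I → ℤ) (n : ℤ) (f g : List I → K) :
    tw d n (cmul f g) = cmul (tw d n f) (tw d n g) := by
  funext w
  simp only [tw, cmul, mulMap, tens, mul_splitSum]
  refine splitSum_congr fun u v h => ?_
  rw [← h, wdeg_append, mul_add, sgn_add]
  ring

lemma tw_tw (d : I → ℤ) (m n : ℤ) (f : List I → K) : tw d m (tw d n f) = tw d (m + n) f := by
  funext w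
  simp only [tw, add_mul, sgn_add]
  ring

lemma HasPar.tw_eq {d : I → ℤ} {n : ℤ} {f : List I → K} (hf : HasPar (wdeg d) n f) (k : ℤ) :
    tw d k f = sgn K (k * n) • f := by
  funext w
  exact hf.sgn_mul k w

lemma tw_bas (d : I → ℤ) (n : ℤ) (w : List I) :
    tw d n (bas w) = sgn K (n * wdeg d w) • (bas w : List I → K) := (hasPar_bas _ w).tw_eq n

lemma HasPar.tw {d : I → ℤ} {n : ℤ} {f : List I → K} (hf : HasPar (wdeg d) n f) (k : ℤ) :
    HasPar (wdeg d) n (tw d k f) := by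
  rw [hf.tw_eq]; exact hf.smul _

/-! #### Elementary tensors -/

lemma tens_smul_left {X Y : Type*} (k : K) (f : X → K) (g : Y → K) :
    tens (k • f) g = k • tens f g := by
  funext p; simp [tens, mul_assoc]

lemma tens_smul_right {X Y : Type*} (k : K) (f : X → K) (g : Y → K) :
    tens f (k • g) = k • tens f g := by
  funext p; simp [tens, mul_left_comm]

lemma tens_sub_left {X Y : Type*} (f f' : X → K) (g : Y → K) :
    tens (f - f') g = tens f g - tens f' g := by
  funext p; simp [tens, sub_mul]

lemma tens_sub_right {X Y : Type*} (f : X → K) (g g' : Y → K) :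
    tens f (g - g') = tens f g - tens f g' := by
  funext p; simp [tens, mul_sub]

lemma tens_add_left {X Y : Type*} (f f' : X → K) (g : Y → K) :
    tens (f + f') g = tens f g + tens f' g := by
  funext p; simp [tens, add_mul]

lemma tens_add_right {X Y : Type*} (f : X → K) (g g' : Y → K) :
    tens f (g + g') = tens f g + tens f g' := by
  funext p; simp [tens, mul_add]

lemma formLeft_tens (a x y : List I → K) : formLeft a (tens x y) = tens (cmul a x) y := by
  funext p
  simp only [formLeft, cmul, mulMap, tens, splitSum_mul, mul_assoc]

lemma bas_cons_eq (i : I) (x : List I) :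
    (bas (i :: x) : List I → K) = cmul (bas [i]) (bas x) := by rw [cmul_bas]; rfl

lemma hasPar_one (d : I → ℤ) : HasPar (wdeg d) 0 (one : List I → K) := by
  rw [one_eq_bas]; exact hasPar_bas (wdeg d) []

/-! #### The graded commutator -/

lemma HasPar.bracket_eq {d : I → ℤ} {m : ℤ} {f : List I → K} (hf : HasPar (wdeg d) m f)
    (g : List I → K) : bracket d f g =
      FormalGeom.cmul f g - FormalGeom.cmul (FormalGeom.tw d m g) f := by
  funext w
  simp only [bracket, Pi.sub_apply, FormalGeom.cmul, mulMap, FormalGeom.tens, FormalGeom.tw,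
    splitSum_sub]
  congr 1
  refine splitSum_congr fun u v h => ?_
  rw [mul_left_comm, hf.sgn_mul, mul_comm m]
  ring

lemma HasPar.bracket_eq' {d : I → ℤ} {m n : ℤ} {f g : List I → K} (hf : HasPar (wdeg d) m f)
    (hg : HasPar (wdeg d) n g) :
    bracket d f g = FormalGeom.cmul f g - sgn K (m * n) • FormalGeom.cmul g f := by
  rw [hf.bracket_eq, hg.tw_eq, cmul_smul_left]

lemma HasPar.bracket {d : I → ℤ} {m n : ℤ} {f g : List I → K} (hf : HasPar (wdeg d) m f)
    (hg : HasPar (wdeg d) n g) : HasPar (wdeg d) (m + n) (bracket d f g) := by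
  rw [hf.bracket_eq]
  refine (hf.cmul hg).sub ?_
  rw [add_comm]
  exact (hg.tw m).cmul hf

lemma bracket_homog {𝒦 : ℤ → AddSubgroup K} [GradedRing 𝒦] [EvenlyGraded 𝒦] {d : I → ℤ} {m n : ℤ}
    {f g : List I → K} (hf : f ∈ homog 𝒦 (wdeg d) m) (hg : g ∈ homog 𝒦 (wdeg d) n) :
    bracket d f g ∈ homog 𝒦 (wdeg d) (m + n) := by
  rw [(HasPar.of_homog hf).bracket_eq' (HasPar.of_homog hg)]
  refine AddSubgroup.sub_mem _ (cmul_homog hf hg) (smul_sgn_mem _ _ ?_)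
  rw [add_comm]
  exact cmul_homog hg hf

lemma bas_homog (𝒦 : ℤ → AddSubgroup K) [GradedRing 𝒦] (dX : X → ℤ) (x : X) :
    (bas x : X → K) ∈ homog 𝒦 dX (dX x) := by
  classical
  intro y
  rw [bas_apply]
  split_ifs with h
  · rw [h, sub_self]; exact SetLike.GradedOne.one_mem
  · exact AddSubgroup.zero_mem _

/-- The graded Jacobi identity. -/
lemma HasPar.jacobi {d : I → ℤ} {m n : ℤ} {a b : List I → K} (ha : HasPar (wdeg d) m a)
    (hb : HasPar (wdeg d) n b) (z : List I → K) :
    FormalGeom.bracket d (FormalGeom.bracket d a b) z =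
      FormalGeom.bracket d a (FormalGeom.bracket d b z) -
        sgn K (m * n) • FormalGeom.bracket d b (FormalGeom.bracket d a z) := by
  rw [(ha.bracket hb).bracket_eq, ha.bracket_eq' hb, ha.bracket_eq, hb.bracket_eq, hb.bracket_eq,
    ha.bracket_eq]
  simp only [tw_sub, tw_cmul, tw_tw, ha.tw_eq, hb.tw_eq, cmul_sub_left, cmul_sub_right,
    cmul_smul_left, cmul_smul_right, cmul_assoc, smul_sub, smul_smul, mul_comm n m, sgn_sq,
    one_smul, add_comm n m]
  abel

/-- The graded commutator with `y` is a graded derivation. -/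
lemma HasPar.bracket_cmul {d : I → ℤ} {m : ℤ} {y : List I → K} (hy : HasPar (wdeg d) m y)
    (f g : List I → K) : FormalGeom.bracket d y (FormalGeom.cmul f g) =
      FormalGeom.cmul (FormalGeom.bracket d y f) g +
        FormalGeom.cmul (FormalGeom.tw d m f) (FormalGeom.bracket d y g) := by
  simp only [hy.bracket_eq, tw_cmul, cmul_sub_left, cmul_sub_right, cmul_assoc]
  abel

end Algebra

/-! ### Lie monomials -/

section LieMon
variable {K I : Type*} [CommRing K] [TopologicalSpace K] [DiscreteTopology K]

/-- The iterated graded commutators of the letters, with their degrees. -/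
inductive LieMon (d : I → ℤ) : ℤ → (List I → K) → Prop
  | letter (i : I) : LieMon d (d i) (bas [i])
  | bracket {m n : ℤ} {f g : List I → K} : LieMon d m f → LieMon d n g →
      LieMon d (m + n) (bracket d f g)

lemma wdeg_letter (d : I → ℤ) (i : I) : wdeg d [i] = d i := by simp [wdeg]

lemma LieMon.hasPar {d : I → ℤ} {n : ℤ} {f : List I → K} (h : LieMon d n f) :
    HasPar (wdeg d) n f := by
  induction h with
  | letter i => simpa [wdeg_letter] using hasPar_bas (K := K) (wdeg d) [i]
  | bracket _ _ ihf ihg => exact ihf.bracket ihg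

lemma LieMon.homog {𝒦 : ℤ → AddSubgroup K} [GradedRing 𝒦] [EvenlyGraded 𝒦] {d : I → ℤ} {n : ℤ}
    {f : List I → K} (h : LieMon d n f) : f ∈ homog 𝒦 (wdeg d) n := by
  induction h with
  | letter i => simpa [wdeg_letter] using bas_homog 𝒦 (wdeg d) [i]
  | bracket _ _ ihf ihg => exact bracket_homog ihf ihg

lemma LieMon.mem_freeLie {d : I → ℤ} {n : ℤ} {f : List I → K} (h : LieMon d n f) :
    f ∈ freeLie K d := by
  induction h with
  | letter i => rw [← orderOne_bas]; exact orderOne_mem_freeLie _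
  | bracket _ _ ihf ihg => exact bracket_mem_freeLie ihf ihg

@[fun_prop]
lemma isCL_orderOne : IsCL K (orderOne : (I → K) → (List I → K)) := by
  refine IsCL.mk' (fun f g => ?_) (fun k f => ?_) (continuous_pi fun w => ?_)
  · exact congrArg Subtype.val (map_add (lieGen fun _ => 0) f g)
  · exact congrArg Subtype.val (map_smul (lieGen fun _ => 0) k f)
  · match w with
    | [] => exact continuous_const
    | [i] => exact continuous_apply i
    | _ :: _ :: _ => exact continuous_const

/-- The completed free Lie algebra consists of the convergent combinations of Lie monomials. -/
lemma freeLie_eq_closedSpan (d : I → ℤ) :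
    freeLie K d = closedSpan {f | ∃ n, LieMon d n f} := by
  apply le_antisymm
  · refine freeLie_le (fun g => ?_) (fun f hf g hg => ?_) (isClosed_closedSpan _)
    · refine isCL_orderOne.mem (isClosed_closedSpan _) fun i _ => ?_
      rw [orderOne_bas]
      exact tens_mem_closedSpan ⟨_, .letter i⟩
    · refine IsCL.preimage (A := fun f => bracket d f g) (by fun_prop) (isClosed_closedSpan _) ?_ hf
      rintro f ⟨m, hf⟩
      refine IsCL.preimage (A := fun g => bracket d f g) (by fun_prop) (isClosed_closedSpan _) ?_ hg
      rintro g ⟨n, hg⟩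
      exact tens_mem_closedSpan ⟨_, hf.bracket hg⟩
  · refine Submodule.topologicalClosure_minimal _ (Submodule.span_le.2 ?_) isClosed_freeLie
    rintro f ⟨n, hf⟩
    exact hf.mem_freeLie

/-- Continuous linear maps that send the Lie monomials into a closed submodule send all of the free
Lie algebra there. -/
lemma IsCL.mem_of_lieMon {Y : Type*} {d : I → ℤ} {A : (List I → K) → (Y → K)} (hA : IsCL K A)
    {N : Submodule K (Y → K)} (hN : IsClosed (N : Set (Y → K)))
    (h : ∀ n f, LieMon d n f → A f ∈ N) {f : List I → K} (hf : f ∈ freeLie K d) : A f ∈ N := by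
  rw [freeLie_eq_closedSpan] at hf
  exact hA.preimage hN (fun f hf => h _ f hf.choose_spec) hf

lemma IsCL.eq_of_lieMon {Y : Type*} {d : I → ℤ} {A B : (List I → K) → (Y → K)} (hA : IsCL K A)
    (hB : IsCL K B) (h : ∀ n f, LieMon d n f → A f = B f) {f : List I → K}
    (hf : f ∈ freeLie K d) : A f = B f := by
  rw [freeLie_eq_closedSpan] at hf
  exact hA.eqOn hB (fun f hf => h _ f hf.choose_spec) hf

end LieMon

/-! ### Cyclic derivatives -/

section Finite
variable {I : Type*}

lemma finite_perm (u : List I) : {w : List I | w.Perm u}.Finite := by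
  refine (List.finite_toSet u.permutations).subset fun w hw => ?_
  exact List.mem_permutations.2 hw

lemma finite_perm_pair (u : List I) : {p : List I × List I | (p.1 ++ p.2).Perm u}.Finite := by
  refine (((finite_perm u).prod (Set.finite_Iic u.length)).image
    fun q : List I × ℕ => (q.1.take q.2, q.1.drop q.2)).subset ?_
  rintro ⟨a, b⟩ h
  refine ⟨(a ++ b, a.length), ⟨h, ?_⟩, by simp⟩
  have := List.Perm.length_eq h
  simp only [List.length_append] at this
  simp only [Set.mem_Iic]; omega

lemma finite_perm_triple (u : List I) :
    {p : List I × List I × List I | (p.1 ++ (p.2.1 ++ p.2.2)).Perm u}.Finite := by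
  refine ((finite_perm_pair u).prod (Set.finite_Iic u.length)).image
    (fun q : (List I × List I) × ℕ => (q.1.1, q.1.2.take q.2, q.1.2.drop q.2)) |>.subset ?_
  rintro ⟨x, a, b⟩ h
  refine ⟨((x, a ++ b), a.length), ⟨h, ?_⟩, by simp⟩
  have := List.Perm.length_eq h
  simp only [List.length_append] at this
  simp only [Set.mem_Iic]; omega

end Finite

section Cyclic
variable {K I : Type*} [CommRing K] [TopologicalSpace K] [DiscreteTopology K]

/-- The form `d(t_a) · t_z`, rewritten modulo graded commutators as a sum of terms `dt_i · t_w`,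
which are identified with `t_i ⊗ t_w`. -/
noncomputable def cycWord (K : Type*) {I : Type*} [CommRing K] (d : I → ℤ) :
    List I → List I → (I × List I → K)
  | [], _ => 0
  | i :: a, z => bas (i, a ++ z) + sgn K (d i * (wdeg d a + wdeg d z)) • cycWord K d a (z ++ [i])

/-- The degree of `t_i ⊗ t_w`. -/
def headDeg (d : I → ℤ) (p : I × List I) : ℤ := d p.1 + wdeg d p.2

/-- Only cyclic permutations of the letters occur, so that `cycWord` extends to infinite
combinations of words. -/
lemma cycWord_perm (d : I → ℤ) (a z : List I) {p : I × List I} (h : cycWord K d a z p ≠ 0) :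
    (a ++ z).Perm (p.1 :: p.2) := by
  induction a generalizing z with
  | nil => exact absurd rfl h
  | cons i a ih =>
    by_cases h1 : (bas (i, a ++ z) p : K) = 0
    · have h2 : cycWord K d a (z ++ [i]) p ≠ 0 := fun h' => h (by simp [cycWord, h1, h'])
      refine .trans ?_ (ih _ h2)
      rw [← List.append_assoc]
      exact (List.perm_append_singleton i (a ++ z)).symm
    · rw [eq_of_bas_ne_zero h1]; rfl

lemma cycWord_homog (𝒦 : ℤ → AddSubgroup K) [GradedRing 𝒦] (d : I → ℤ) (a z : List I) :
    cycWord K d a z ∈ homog 𝒦 (headDeg d) (wdeg d a + wdeg d z) := by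
  induction a generalizing z with
  | nil => exact AddSubgroup.zero_mem _
  | cons i a ih =>
    refine AddSubgroup.add_mem _ ?_ (smul_sgn_mem _ _ ?_)
    · have := bas_homog 𝒦 (headDeg d) (i, a ++ z)
      simpa [headDeg, wdeg_append, wdeg_cons, add_assoc] using this
    · have := ih (z ++ [i])
      convert this using 1
      simp only [wdeg_append, wdeg_cons, wdeg_nil]
      congr 1
      ring

/-- The Leibniz rule `d(t_a t_b) · t_z = d(t_a) · t_b t_z ± d(t_b) · t_z t_a`. -/
lemma cycWord_append (d : I → ℤ) (a b z : List I) :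
    cycWord K d (a ++ b) z = cycWord K d a (b ++ z) +
      sgn K (wdeg d a * (wdeg d b + wdeg d z)) • cycWord K d b (z ++ a) := by
  induction a generalizing z with
  | nil => simp [cycWord, wdeg_nil, sgn_zero]
  | cons i a ih =>
    rw [List.cons_append, cycWord, ih, cycWord]
    simp only [List.append_assoc, wdeg_append, wdeg_cons, List.cons_append,
      List.nil_append, smul_add, smul_smul, ← sgn_add, wdeg_nil]
    rw [← add_assoc (wdeg d a) (wdeg d b), sgn_congr (a := d i * (wdeg d a + wdeg d b + wdeg d z) +
      wdeg d a * (wdeg d b + (wdeg d z + (d i + 0)))) (b := (d i + wdeg d a) *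
      (wdeg d b + wdeg d z)) ⟨d i * wdeg d a, by ring⟩]
    abel

/-- The continuous bilinear map that sends `a ⊗ z` to the form `da · z`, where `dt_i · z` is
identified with `t_i ⊗ z`. -/
noncomputable def cyc (K : Type*) {I : Type*} [CommRing K] [TopologicalSpace K]
    [DiscreteTopology K] (d : I → ℤ) : (List I × List I → K) →L[K] (I × List I → K) :=
  ofBasis (fun p => cycWord K d p.1 p.2) fun _ =>
    (finite_perm_pair _).subset fun _ h => cycWord_perm d _ _ h

lemma cyc_bas (d : I → ℤ) (a z : List I) :
    cyc K d (tens (bas a) (bas z)) = cycWord K d a z := by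
  rw [tens_bas, cyc, ofBasis_bas]

lemma cyc_letter (d : I → ℤ) (i : I) (z : List I → K) :
    cyc K d (tens (bas [i]) z) = tens (bas i) z := by
  refine IsCL.eq (A := fun z => cyc K d (tens (bas [i]) z)) (B := fun z => tens (bas i) z)
    (by fun_prop) (by fun_prop) fun w _ => ?_
  simp only [cyc_bas, cycWord, smul_zero, add_zero, List.nil_append, bas_prod]

/-- `d(a b) · z = da · (b z) + (-1)^(|a|(|b| + |z|)) db · (z a)`. -/
lemma cyc_cmul {d : I → ℤ} {m : ℤ} {a : List I → K} (ha : HasPar (wdeg d) m a)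
    (b z : List I → K) : cyc K d (tens (cmul a b) z) = cyc K d (tens a (cmul b z)) +
      cyc K d (tens (tw d m b) (cmul (tw d m z) a)) := by
  refine IsCL.eq (A := fun a => cyc K d (tens (cmul a b) z)) (B := fun a =>
    cyc K d (tens a (cmul b z)) + cyc K d (tens (tw d m b) (cmul (tw d m z) a)))
    (by fun_prop) (by fun_prop) fun u hu => ?_
  refine IsCL.eq (A := fun b => cyc K d (tens (cmul (bas u) b) z)) (B := fun b =>
    cyc K d (tens (bas u) (cmul b z)) + cyc K d (tens (tw d m b) (cmul (tw d m z) (bas u))))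
    (by fun_prop) (by fun_prop) fun v _ => ?_
  refine IsCL.eq (A := fun z => cyc K d (tens (cmul (bas u) (bas v)) z)) (B := fun z =>
    cyc K d (tens (bas u) (cmul (bas v) z)) +
      cyc K d (tens (tw d m (bas v)) (cmul (tw d m z) (bas u))))
    (by fun_prop) (by fun_prop) fun w _ => ?_
  simp only [tw_bas, cmul_smul_left, tens_smul_left, tens_smul_right, map_smul, cmul_bas, cyc_bas,
    cycWord_append, smul_smul, ← sgn_add]
  congr 2
  refine sgn_congr ?_
  rw [show wdeg d u * (wdeg d v + wdeg d w) - (m * wdeg d w + m * wdeg d v) =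
    -((m - wdeg d u) * (wdeg d v + wdeg d w)) by ring]
  exact ((ha u hu).mul_right _).neg

/-- `d[a, b] · z = da · [b, z] - (-1)^(|a||b|) db · [a, z]`. -/
lemma cyc_bracket {d : I → ℤ} {m n : ℤ} {a b : List I → K} (ha : HasPar (wdeg d) m a)
    (hb : HasPar (wdeg d) n b) (z : List I → K) :
    cyc K d (tens (bracket d a b) z) = cyc K d (tens a (bracket d b z)) -
      sgn K (m * n) • cyc K d (tens b (bracket d a z)) := by
  rw [ha.bracket_eq' hb, ha.bracket_eq, hb.bracket_eq]
  simp only [tens_sub_left, tens_sub_right, tens_smul_left, map_sub, map_smul, cyc_cmul ha,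
    cyc_cmul hb, ha.tw_eq, hb.tw_eq, smul_sub, smul_add, smul_smul, mul_comm n m, sgn_sq, one_smul]
  abel

/-- The identification of associative one-forms modulo graded commutators with `W ⊗ T̂W`:
`x · da = (-1)^(|x|(|a| + 1)) da · x`. -/
noncomputable def formCyc (K : Type*) {I : Type*} [CommRing K] [TopologicalSpace K]
    [DiscreteTopology K] (d : I → ℤ) : (List I × List I → K) →L[K] (I × List I → K) :=
  ofBasis (fun p => sgn K (wdeg d p.1 * (wdeg d p.2 + 1)) • cycWord K d p.2 p.1) fun _ =>
    (finite_perm_pair _).subset fun _ h => List.perm_append_comm.trans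
      (cycWord_perm (K := K) d _ _ (right_ne_zero_of_mul h))

lemma formCyc_bas (d : I → ℤ) (x a : List I) : formCyc K d (tens (bas x) (bas a)) =
    sgn K (wdeg d x * (wdeg d a + 1)) • cycWord K d a x := by
  rw [tens_bas, formCyc, ofBasis_bas]

lemma formCyc_homog {𝒦 : ℤ → AddSubgroup K} [GradedRing 𝒦] {d : I → ℤ} {n : ℤ}
    {ω : List I × List I → K} (hω : ω ∈ homog 𝒦 (formDeg d) (n + 1)) :
    formCyc K d ω ∈ homog 𝒦 (headDeg d) n := by
  refine ofBasis_homog (dX := fun p : List I × List I => wdeg d p.1 + wdeg d p.2) _ _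
    (fun p => ?_) fun p => ?_
  · refine smul_sgn_mem _ _ ?_
    rw [add_comm]
    exact cycWord_homog 𝒦 d _ _
  · have := hω p
    convert this using 2
    simp only [formDeg]; ring

lemma formRight_tens (d : I → ℤ) (x y a : List I → K) :
    formRight d (tens x y) a = tens x (cmul y a) - tens (cmul x (tw d 1 y)) a := by
  funext p
  simp only [formRight, cmul, mulMap, tens, tw, Pi.sub_apply, splitSum_mul, mul_splitSum, one_mul,
    mul_assoc, mul_left_comm]

lemma formCyc_one (d : I → ℤ) (x : List I → K) : formCyc K d (tens x one) = 0 := by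
  refine IsCL.eq_zero (A := fun x => formCyc K d (tens x one)) (by fun_prop) fun w _ => ?_
  simp only [one_eq_bas, formCyc_bas, cycWord, smul_zero]

lemma formCyc_formRight_bas (d : I → ℤ) (x y z : List I) :
    formCyc K d (formRight d (tens (bas x) (bas y)) (bas z)) =
      sgn K (wdeg d x * (wdeg d y + wdeg d z + 1)) • cycWord K d y (z ++ x) := by
  simp only [formRight_tens, tw_bas, cmul_smul_right, tens_smul_left, cmul_bas, map_sub, map_smul,
    formCyc_bas, cycWord_append, smul_add, smul_smul, ← sgn_add, wdeg_append]
  rw [add_sub_assoc, add_eq_left, sub_eq_zero]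
  congr 1
  exact sgn_congr ⟨wdeg d x * wdeg d y - wdeg d y, by ring⟩

/-- `formCyc (da · z) = cyc (da · z)`. -/
lemma formCyc_formRight_one (d : I → ℤ) (a z : List I → K) :
    formCyc K d (formRight d (tens one a) z) = cyc K d (tens a z) := by
  refine IsCL.eq (A := fun a => formCyc K d (formRight d (tens one a) z)) (B := fun a =>
    cyc K d (tens a z)) (by fun_prop) (by fun_prop) fun u _ => ?_
  refine IsCL.eq (A := fun z => formCyc K d (formRight d (tens one (bas u)) z)) (B := fun z =>
    cyc K d (tens (bas u) z)) (by fun_prop) (by fun_prop) fun v _ => ?_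
  simp only [one_eq_bas, formCyc_formRight_bas, cyc_bas, wdeg_nil, zero_mul, sgn_zero, one_smul,
    List.append_nil]

/-- Graded commutators of functions and forms vanish. -/
lemma formCyc_formComm {d : I → ℤ} {k n : ℤ} {a : List I → K} {ω : List I × List I → K}
    (ha : HasPar (wdeg d) k a) (hω : HasPar (formDeg d) n ω) :
    formCyc K d (formComm d k n a ω) = 0 := by
  rw [formComm, map_sub, map_smul, sub_eq_zero]
  refine IsCL.eq (A := fun a => formCyc K d (formLeft a ω)) (B := fun a => sgn K (k * n) •
    formCyc K d (formRight d ω a)) (by fun_prop) (by fun_prop) fun u hu => ?_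
  refine IsCL.eq (A := fun ω => formCyc K d (formLeft (bas u) ω)) (B := fun ω => sgn K (k * n) •
    formCyc K d (formRight d ω (bas u))) (by fun_prop) (by fun_prop) fun p hp => ?_
  obtain ⟨x, y⟩ := p
  have e1 : sgn K (k * n) = sgn K (wdeg d u * formDeg d (x, y)) := sgn_congr (by
    rw [show k * n - wdeg d u * formDeg d (x, y) =
      (k - wdeg d u) * n + wdeg d u * (n - formDeg d (x, y)) by ring]
    exact ((ha u hu).mul_right _).add ((hω _ hp).mul_left _))
  rw [e1, bas_prod, formCyc_formRight_bas, formLeft_tens, cmul_bas, formCyc_bas, smul_smul,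
    ← sgn_add]
  congr 1
  simp only [wdeg_append, formDeg]
  exact sgn_congr ⟨-(wdeg d u * wdeg d x), by ring⟩

/-- `[g, ω] · z = - (-1)^(|g||ω|) ω · [g, z]` modulo graded commutators. -/
lemma formCyc_formRight_formComm {d : I → ℤ} {k n : ℤ} {g : List I → K} {ω : List I × List I → K}
    (hg : HasPar (wdeg d) k g) (hω : HasPar (formDeg d) n ω) (z : List I → K) :
    formCyc K d (formRight d (formComm d k n g ω) z) =
      -(sgn K (k * n) • formCyc K d (formRight d ω (bracket d g z))) := by
  rw [hg.bracket_eq]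
  refine IsCL.eq (A := fun g => formCyc K d (formRight d (formLeft g ω - sgn K (k * n) •
    formRight d ω g) z)) (B := fun g => -(sgn K (k * n) • formCyc K d (formRight d ω
    (cmul g z - cmul (tw d k z) g)))) (by fun_prop) (by fun_prop) fun u hu => ?_
  refine IsCL.eq (A := fun ω => formCyc K d (formRight d (formLeft (bas u) ω - sgn K (k * n) •
    formRight d ω (bas u)) z)) (B := fun ω => -(sgn K (k * n) • formCyc K d (formRight d ω
    (cmul (bas u) z - cmul (tw d k z) (bas u))))) (by fun_prop) (by fun_prop) fun p hp => ?_
  obtain ⟨x, y⟩ := p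
  have e1 : sgn K (k * n) = sgn K (wdeg d u * formDeg d (x, y)) := sgn_congr (by
    rw [show k * n - wdeg d u * formDeg d (x, y) =
      (k - wdeg d u) * n + wdeg d u * (n - formDeg d (x, y)) by ring]
    exact ((hg u hu).mul_right _).add ((hω _ hp).mul_left _))
  refine IsCL.eq (A := fun z => formCyc K d (formRight d (formLeft (bas u) (bas (x, y)) -
    sgn K (k * n) • formRight d (bas (x, y)) (bas u)) z)) (B := fun z => -(sgn K (k * n) •
    formCyc K d (formRight d (bas (x, y)) (cmul (bas u) z - cmul (tw d k z) (bas u)))))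
    (by fun_prop) (by fun_prop) fun w _ => ?_
  have hfr : ∀ (a b : List I × List I → K) (c : List I → K),
      formRight d (a - b) c = formRight d a c - formRight d b c := fun a b c =>
    IsCL.map_sub (A := fun a => formRight d a c) (by fun_prop) a b
  have hfr' : ∀ (a : List I × List I → K) (b c : List I → K),
      formRight d a (b - c) = formRight d a b - formRight d a c := fun a b c =>
    IsCL.map_sub (A := fun b => formRight d a b) (by fun_prop) b c
  have hfs : ∀ (k : K) (a : List I × List I → K) (b : List I → K),
      formRight d a (k • b) = k • formRight d a b := fun k a b =>
    IsCL.map_smul (A := fun b => formRight d a b) (by fun_prop) k b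
  have e2 : sgn K (k * wdeg d w) = sgn K (wdeg d u * wdeg d w) := sgn_congr (by
    rw [← sub_mul]; exact (hg u hu).mul_right _)
  simp only [e1, bas_prod, formLeft_tens, formRight_tens d _ _ (bas u), hfr, hfr', hfs,
    formRight_smul, tw_bas, cmul_smul_left, cmul_smul_right, tens_smul_left, cmul_bas, map_sub,
    map_smul, formCyc_formRight_bas, e2, smul_sub, smul_smul, List.append_assoc,
    cycWord_append, ← sgn_add, smul_add, wdeg_append, formDeg, one_mul]
  have h1 : sgn K (wdeg d u * (wdeg d x + wdeg d y + 1) + (wdeg d x * (wdeg d y + wdeg d u +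
      wdeg d w + 1) + wdeg d y * (wdeg d u + (wdeg d w + wdeg d x)))) =
    sgn K (wdeg d u * (wdeg d x + wdeg d y + 1) + wdeg d y + (wdeg d x + wdeg d y) *
      (wdeg d u + wdeg d w + 1)) :=
    sgn_congr ⟨wdeg d x * wdeg d y - wdeg d y, by ring⟩
  have h2 : sgn K (wdeg d u * (wdeg d x + wdeg d y + 1) + (wdeg d u * wdeg d w + wdeg d x *
      (wdeg d y + (wdeg d w + wdeg d u) + 1))) =
    sgn K ((wdeg d u + wdeg d x) * (wdeg d y + wdeg d w + 1)) :=
    sgn_congr ⟨wdeg d u * wdeg d x, by ring⟩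
  rw [h1, h2, add_assoc (wdeg d y) (wdeg d u) (wdeg d w)]
  abel

end Cyclic

/-! ### Associative one-forms modulo graded commutators -/

section AssModel
variable {K I : Type*} [CommRing K] [TopologicalSpace K] [DiscreteTopology K]

@[fun_prop]
lemma isCL_thetaForm (d : I → ℤ) : IsCL K (thetaForm (K := K) d) := by
  refine IsCL.mk' (map_add _) (map_smul _) (continuous_pi fun p => ?_)
  match p with
  | ([], []) => exact continuous_const
  | ([], i :: w) => exact continuous_apply _
  | ([i], w) => exact (continuous_const.mul (continuous_apply _)).neg
  | (_ :: _ :: _, w) => exact continuous_const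

lemma thetaForm_bas (d : I → ℤ) (i : I) (w : List I) : thetaForm d (bas (i, w)) =
    (bas ([], i :: w) - sgn K (d i) • bas ([i], w) : List I × List I → K) := by
  classical
  funext p
  match p with
  | ([], []) => simp [thetaForm, bas_apply]
  | ([], j :: v) => simp [thetaForm, bas_apply]
  | ([j], v) =>
    simp only [thetaForm, bas_apply, LinearMap.coe_mk, AddHom.coe_mk, Pi.sub_apply, Pi.smul_apply,
      smul_eq_mul, Prod.mk.injEq, List.cons.injEq, and_true]
    by_cases h : j = i <;> simp [h]
  | (_ :: _ :: _, v) => simp [thetaForm, bas_apply]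

lemma thetaForm_tens (d : I → ℤ) (i : I) (z : List I → K) :
    thetaForm d (tens (bas i) z) = formRight d (tens one (bas [i])) z := by
  refine IsCL.eq (A := fun z => thetaForm d (tens (bas i) z)) (B := fun z =>
    formRight d (tens one (bas [i])) z) (by fun_prop) (by fun_prop) fun w _ => ?_
  rw [tens_bas, thetaForm_bas, formRight_tens, one_cmul, tw_bas, cmul_bas, one_eq_bas,
    tens_smul_left, tens_bas, tens_bas, wdeg_letter, one_mul]
  rfl

lemma thetaForm_homog {𝒦 : ℤ → AddSubgroup K} {d : I → ℤ} {n : ℤ}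
    {F : I × List I → K} (hF : F ∈ homog 𝒦 (headDeg d) n) :
    thetaForm d F ∈ homog 𝒦 (formDeg d) (n + 1) := by
  intro p
  match p with
  | ([], []) => exact AddSubgroup.zero_mem _
  | ([], i :: w) =>
    have := hF (i, w)
    convert this using 2
    · simp only [formDeg, headDeg, wdeg_nil, wdeg_cons]; ring
    · rfl
  | ([i], w) =>
    have := smul_sgn_mem (K := K) _ (d i) (hF (i, w))
    refine AddSubgroup.neg_mem _ ?_
    convert this using 2
    · simp only [formDeg, headDeg, wdeg_nil, wdeg_cons]; ring
    · rfl
  | (_ :: _ :: _, w) => exact AddSubgroup.zero_mem _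

lemma formCyc_thetaForm (d : I → ℤ) (F : I × List I → K) : formCyc K d (thetaForm d F) = F := by
  refine IsCL.eq (A := fun F => formCyc K d (thetaForm d F)) (B := fun F => F)
    (by fun_prop) (by fun_prop) fun p _ => ?_
  obtain ⟨i, w⟩ := p
  rw [bas_prod, thetaForm_tens, formCyc_formRight_one, cyc_letter]

lemma formRight_formRight (d : I → ℤ) (x y a b : List I → K) :
    formRight d (formRight d (tens x y) a) b = formRight d (tens x y) (cmul a b) := by
  rw [formRight_tens, IsCL.map_sub (A := fun a => formRight d a b) (by fun_prop)]
  simp only [formRight_tens, tw_cmul, cmul_assoc]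
  abel

variable (𝒦 : ℤ → AddSubgroup K)

lemma formCyc_eq_zero [EvenlyGraded 𝒦] {d : I → ℤ} {F : List I × List I → K}
    (hF : F ∈ assRel 𝒦 d) : formCyc K d F = 0 := by
  refine (Submodule.mem_bot K).1 (map_closedSpan isClosed_bot' (formCyc K d) ?_ hF)
  rintro _ (⟨x, rfl⟩ | ⟨k, n, a, ω, ha, hω, rfl⟩)
  · exact formCyc_one d x
  · exact formCyc_formComm (.of_homog ha) (.of_homog hω)

variable [GradedRing 𝒦]

/-- Every one-form is congruent to a combination of forms `dt_i · t_w`. -/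
lemma sub_thetaForm_formCyc_mem [EvenlyGraded 𝒦] (d : I → ℤ) (F : List I × List I → K) :
    F - thetaForm d (formCyc K d F) ∈ assRel 𝒦 d := by
  have hcl : IsCL K fun F => F - thetaForm d (formCyc K d F) := by fun_prop
  refine hcl.mem (isClosed_closedSpan _) fun p hp => ?_
  obtain ⟨x, a⟩ := p
  clear hp
  rw [bas_prod]
  induction a generalizing x with
  | nil =>
    rw [← one_eq_bas, formCyc_one, map_zero, sub_zero]
    exact tens_mem_closedSpan (Or.inl ⟨_, rfl⟩)
  | cons i a ih =>
    -- `x · d(t_i a) = x dt_i a ± (x t_i) · da`, and `x dt_i a` is `± dt_i a x` up to a commutator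
    have h1 : (tens (bas x) (bas (i :: a)) : List I × List I → K) =
        formLeft (bas x) (thetaForm d (tens (bas i) (bas a))) +
          sgn K (d i) • tens (bas (x ++ [i])) (bas a) := by
      have : ∀ F G : List I × List I → K,
        formLeft (bas x) (F - G) = formLeft (bas x) F - formLeft (bas x) G := fun F G =>
          IsCL.map_sub (A := fun F => formLeft (bas x) F) (by fun_prop) F G
      have h' : ∀ (k : K) (F : List I × List I → K),
        formLeft (bas x) (k • F) = k • formLeft (bas x) F := fun k F =>
          IsCL.map_smul (A := fun F => formLeft (bas x) F) (by fun_prop) k F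
      rw [thetaForm_tens, formRight_tens, this]
      simp only [formLeft_tens, one_cmul, h', cmul_one, tw_bas, cmul_smul_right, tens_smul_left,
        cmul_bas, wdeg_letter, one_mul]
      simp
    have h2 : formRight d (thetaForm d (tens (bas i) (bas a))) (bas x) =
        thetaForm (K := K) d (tens (bas i) (bas (a ++ x))) := by
      rw [thetaForm_tens, thetaForm_tens, formRight_formRight, cmul_bas]
    have h3 : formLeft (bas x) (thetaForm d (tens (bas i) (bas a))) =
        formComm d (wdeg d x) (headDeg d (i, a) + 1) (bas x)
          (thetaForm (K := K) d (tens (bas i) (bas a))) +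
        sgn K (wdeg d x * (headDeg d (i, a) + 1)) • thetaForm d (tens (bas i) (bas (a ++ x))) := by
      rw [formComm, h2]; abel
    have h4 : formComm d (wdeg d x) (headDeg d (i, a) + 1) (bas x)
        (thetaForm (K := K) d (tens (bas i) (bas a))) ∈ assRel 𝒦 d :=
      tens_mem_closedSpan (Or.inr ⟨_, _, _, _, bas_homog 𝒦 _ x,
        thetaForm_homog (by rw [tens_bas]; exact bas_homog 𝒦 (headDeg d) (i, a)), rfl⟩)
    have h5 : formCyc K d (formComm d (wdeg d x) (headDeg d (i, a) + 1) (bas x)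
        (thetaForm (K := K) d (tens (bas i) (bas a)))) = 0 := formCyc_eq_zero 𝒦 h4
    rw [h1, h3]
    have h6 := hcl.map_add (formComm d (wdeg d x) (headDeg d (i, a) + 1) (bas x)
          (thetaForm (K := K) d (tens (bas i) (bas a))) +
        sgn K (wdeg d x * (headDeg d (i, a) + 1)) • thetaForm d (tens (bas i) (bas (a ++ x))))
        (sgn K (d i) • tens (bas (x ++ [i])) (bas a))
    rw [h6, hcl.map_smul]
    refine Submodule.add_mem _ ?_ (Submodule.smul_mem _ _ (ih _))
    rw [hcl.map_add, hcl.map_smul, formCyc_thetaForm, sub_self, smul_zero, add_zero, h5, map_zero,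
      sub_zero]
    exact h4

/-- The inverse of `Θ`. -/
noncomputable def thetaInv [EvenlyGraded 𝒦] (d : I → ℤ) : DR1Ass 𝒦 d →L[K] (I × List I → K) :=
  Submodule.liftQL _ (formCyc K d) fun _ hF => formCyc_eq_zero 𝒦 hF

lemma thetaInv_mk [EvenlyGraded 𝒦] (d : I → ℤ) (F : List I × List I → K) :
    thetaInv 𝒦 d (Submodule.Quotient.mk F) = formCyc K d F := rfl

lemma theta_apply (d : I → ℤ) (F : I × List I → K) :
    theta 𝒦 d F = Submodule.Quotient.mk (thetaForm d F) := rfl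

lemma thetaInv_theta [EvenlyGraded 𝒦] (d : I → ℤ) (F : I × List I → K) :
    thetaInv 𝒦 d (theta 𝒦 d F) = F := by
  rw [theta_apply, thetaInv_mk, formCyc_thetaForm]

lemma theta_thetaInv [EvenlyGraded 𝒦] (d : I → ℤ) (x : DR1Ass 𝒦 d) :
    theta 𝒦 d (thetaInv 𝒦 d x) = x := by
  obtain ⟨F, rfl⟩ := Submodule.Quotient.mk_surjective _ x
  rw [thetaInv_mk, theta_apply]
  refine ((Submodule.Quotient.eq _).2 ?_).symm
  exact sub_thetaForm_formCyc_mem 𝒦 d F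

lemma theta_bijective [EvenlyGraded 𝒦] (d : I → ℤ) : Function.Bijective (theta (K := K) 𝒦 d) :=
  Function.bijective_iff_has_inverse.2
    ⟨thetaInv 𝒦 d, thetaInv_theta 𝒦 d, theta_thetaInv 𝒦 d⟩

lemma continuous_theta (d : I → ℤ) : Continuous (theta (K := K) 𝒦 d) := by
  obtain ⟨L, hL⟩ := isCL_thetaForm (K := K) d
  have : (theta 𝒦 d : (I × List I → K) → DR1Ass 𝒦 d) =
    fun F => (Submodule.mkQL (assRel 𝒦 d)) (L F) := by
    funext F; rw [← hL]; rfl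
  rw [this]
  exact ((Submodule.mkQL (assRel 𝒦 d)).comp L).continuous

/-- `Θ` as a continuous linear map. -/
noncomputable def thetaL (d : I → ℤ) : (I × List I → K) →L[K] DR1Ass 𝒦 d :=
  ⟨theta 𝒦 d, continuous_theta 𝒦 d⟩

lemma thetaInv_homog [EvenlyGraded 𝒦] {d : I → ℤ} {n : ℤ} {x : DR1Ass 𝒦 d}
    (hx : x ∈ hochCochains 𝒦 d n) : thetaInv 𝒦 d x ∈ homog 𝒦 (headDeg d) (n + 1) := by
  obtain ⟨F, hF, rfl⟩ := hx
  refine formCyc_homog ?_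
  rwa [add_assoc]

lemma theta_homog {d : I → ℤ} {n : ℤ} {F : I × List I → K}
    (hF : F ∈ homog 𝒦 (headDeg d) (n + 1)) : theta 𝒦 d F ∈ hochCochains 𝒦 d n := by
  refine ⟨thetaForm d F, ?_, rfl⟩
  have := thetaForm_homog hF
  rwa [add_assoc] at this

end AssModel

/-! ### From Lie one-forms to associative one-forms -/

section LieToAss
variable {K I : Type*} [CommRing K] [TopologicalSpace K] [DiscreteTopology K]

lemma ofBasis_ne_zero {X Y : Type*} {Φ : X → Y → K} {h : ∀ y, {x | Φ x y ≠ 0}.Finite} {F : X → K}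
    {y : Y} (hF : ofBasis Φ h F y ≠ 0) : ∃ x, F x ≠ 0 ∧ Φ x y ≠ 0 := by
  rw [ofBasis_apply] at hF
  obtain ⟨x, -, hx⟩ := Finset.exists_ne_zero_of_sum_ne_zero hF
  exact ⟨x, left_ne_zero_of_mul hx, right_ne_zero_of_mul hx⟩

lemma bracket_letter_ne_zero {d : I → ℤ} {i : I} {z : List I → K} {w : List I}
    (h : bracket d (bas [i]) z w ≠ 0) : ∃ v, z v ≠ 0 ∧ (i :: v).Perm w := by
  obtain ⟨u, v, rfl, hne⟩ := exists_ne_zero_of_splitSum (F := fun u v =>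
    bas [i] u * z v - sgn K (wdeg d u * wdeg d v) * (z u * bas [i] v)) h
  by_cases h1 : (bas [i] u : K) * z v = 0
  · have h2 : z u * (bas [i] v : K) ≠ 0 := fun h' => hne (by rw [h1, h', mul_zero, sub_zero])
    refine ⟨u, left_ne_zero_of_mul h2, ?_⟩
    rw [eq_of_bas_ne_zero (right_ne_zero_of_mul h2)]
    exact (List.perm_append_singleton i u).symm
  · refine ⟨v, right_ne_zero_of_mul h1, ?_⟩
    rw [eq_of_bas_ne_zero (left_ne_zero_of_mul h1)]
    rfl

/-- The value of `Θ⁻¹ ∘ l` at `(t_x · d(t_a)) ⊗ z`: the letters of `x` are moved to the last slot by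
`(t_i · ω) ⊗ z = -(-1)^(|ω||t_i|) [ω, t_i] ⊗ z = -(-1)^(|ω||t_i|) ω ⊗ [t_i, z]`. -/
noncomputable def lamWord (K : Type*) {I : Type*} [CommRing K] [TopologicalSpace K]
    [DiscreteTopology K] (d : I → ℤ) : List I → List I → (List I → K) → (I × List I → K)
  | [], a, z => cyc K d (tens (bas a) z)
  | i :: x, a, z => -(sgn K ((wdeg d x + wdeg d a + 1) * d i) •
      lamWord K d x a (bracket d (bas [i]) z))

@[fun_prop]
lemma isCL_lamWord (d : I → ℤ) (x a : List I) : IsCL K (lamWord K d x a) := by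
  induction x with
  | nil =>
    change IsCL K fun z => cyc K d (tens (bas a) z)
    fun_prop
  | cons i x ih =>
    change IsCL K fun z => -(sgn K ((wdeg d x + wdeg d a + 1) * d i) •
      lamWord K d x a (bracket d (bas [i]) z))
    fun_prop

/-- Only permutations of the letters occur, so that `lamWord` extends to infinite combinations. -/
lemma lamWord_perm {d : I → ℤ} {x a : List I} {z : List I → K} {p : I × List I}
    (h : lamWord K d x a z p ≠ 0) : ∃ v, z v ≠ 0 ∧ (x ++ (a ++ v)).Perm (p.1 :: p.2) := by
  induction x generalizing z with
  | nil =>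
    obtain ⟨q, hq, hq'⟩ := ofBasis_ne_zero h
    refine ⟨q.2, right_ne_zero_of_mul hq, ?_⟩
    rw [← eq_of_bas_ne_zero (left_ne_zero_of_mul hq), List.nil_append]
    exact cycWord_perm d _ _ hq'
  | cons i x ih =>
    have h' : lamWord K d x a (bracket d (bas [i]) z) p ≠ 0 := fun h' => h (by simp [lamWord, h'])
    obtain ⟨w, hw, hp⟩ := ih h'
    obtain ⟨v, hv, hvw⟩ := bracket_letter_ne_zero hw
    refine ⟨v, hv, .trans ?_ hp⟩
    rw [List.cons_append]
    refine (List.perm_middle (l₁ := x)).symm.trans (.append_left _ ?_)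
    exact (List.perm_middle (l₁ := a)).symm.trans (.append_left _ hvw)

lemma cyc_homog {𝒦 : ℤ → AddSubgroup K} [GradedRing 𝒦] {d : I → ℤ} {n : ℤ}
    {F : List I × List I → K} (hF : F ∈ homog 𝒦 (fun p => wdeg d p.1 + wdeg d p.2) n) :
    cyc K d F ∈ homog 𝒦 (headDeg d) n := by
  rw [cyc]
  exact ofBasis_homog (dX := fun p : List I × List I => wdeg d p.1 + wdeg d p.2) _ _
    (fun p => cycWord_homog 𝒦 d p.1 p.2) hF

lemma tens_homog {X Y : Type*} {𝒦 : ℤ → AddSubgroup K} [GradedRing 𝒦] {dX : X → ℤ} {dY : Y → ℤ}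
    {m n : ℤ} {f : X → K} {g : Y → K} (hf : f ∈ homog 𝒦 dX m) (hg : g ∈ homog 𝒦 dY n) :
    tens f g ∈ homog 𝒦 (fun p : X × Y => dX p.1 + dY p.2) (m + n) := by
  intro p
  have := SetLike.GradedMul.mul_mem (hf p.1) (hg p.2)
  convert this using 2
  · ring
  · rfl

lemma lamWord_homog {𝒦 : ℤ → AddSubgroup K} [GradedRing 𝒦] [EvenlyGraded 𝒦] {d : I → ℤ} {n : ℤ}
    (x a : List I) {z : List I → K} (hz : z ∈ homog 𝒦 (wdeg d) n) :
    lamWord K d x a z ∈ homog 𝒦 (headDeg d) (wdeg d x + wdeg d a + n) := by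
  induction x generalizing z n with
  | nil =>
    rw [wdeg_nil, zero_add]
    exact cyc_homog (tens_homog (bas_homog 𝒦 _ a) hz)
  | cons i x ih =>
    refine AddSubgroup.neg_mem _ (smul_sgn_mem _ _ ?_)
    have := ih (bracket_homog (bas_homog 𝒦 (wdeg d) [i]) hz)
    rw [wdeg_letter] at this
    rwa [wdeg_cons, show d i + wdeg d x + wdeg d a + n = wdeg d x + wdeg d a + (d i + n) by ring]

/-- The map `Θ⁻¹ ∘ l`, from representatives `x ⊗ a ⊗ z` of Lie one-forms to `W ⊗ T̂W`.  It is
defined for all `a` and `z` in `T̂W`. -/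
noncomputable def lam (K : Type*) {I : Type*} [CommRing K] [TopologicalSpace K]
    [DiscreteTopology K] (d : I → ℤ) : (List I × List I × List I → K) →L[K] (I × List I → K) :=
  ofBasis (fun p => lamWord K d p.1 p.2.1 (bas p.2.2)) fun y =>
    (finite_perm_triple (y.1 :: y.2)).subset fun p hp => by
      obtain ⟨v, hv, h⟩ := lamWord_perm hp
      rwa [eq_of_bas_ne_zero hv] at h

lemma lam_homog {𝒦 : ℤ → AddSubgroup K} [GradedRing 𝒦] [EvenlyGraded 𝒦] {d : I → ℤ} {n : ℤ}
    {F : List I × List I × List I → K}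
    (hF : F ∈ homog 𝒦 (fun p => wdeg d p.1 + wdeg d p.2.1 + wdeg d p.2.2) n) :
    lam K d F ∈ homog 𝒦 (headDeg d) n := by
  rw [lam]
  exact ofBasis_homog (dX := fun p : List I × List I × List I =>
    wdeg d p.1 + wdeg d p.2.1 + wdeg d p.2.2) _ _
    (fun p => lamWord_homog p.1 p.2.1 (bas_homog 𝒦 (wdeg d) p.2.2)) hF

lemma lam_bas_bas (d : I → ℤ) (x a : List I) (z : List I → K) :
    lam K d (tens (bas x) (tens (bas a) z)) = lamWord K d x a z := by
  refine IsCL.eq (A := fun z => lam K d (tens (bas x) (tens (bas a) z))) (B := fun z =>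
    lamWord K d x a z) (by fun_prop) (by fun_prop) fun w _ => ?_
  rw [tens_bas, tens_bas, lam, ofBasis_bas]

lemma lam_one (d : I → ℤ) (a z : List I → K) :
    lam K d (tens one (tens a z)) = cyc K d (tens a z) := by
  refine IsCL.eq (A := fun a => lam K d (tens one (tens a z))) (B := fun a => cyc K d (tens a z))
    (by fun_prop) (by fun_prop) fun w _ => ?_
  rw [one_eq_bas, lam_bas_bas, lamWord]

lemma lam_letter {d : I → ℤ} {m n : ℤ} {x a : List I → K} (hx : HasPar (wdeg d) m x)
    (ha : HasPar (wdeg d) n a) (i : I) (z : List I → K) :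
    lam K d (tens (cmul (bas [i]) x) (tens a z)) = -(sgn K ((m + n + 1) * d i) •
      lam K d (tens x (tens a (bracket d (bas [i]) z)))) := by
  refine IsCL.eq (A := fun x => lam K d (tens (cmul (bas [i]) x) (tens a z))) (B := fun x =>
    -(sgn K ((m + n + 1) * d i) • lam K d (tens x (tens a (bracket d (bas [i]) z)))))
    (by fun_prop) (by fun_prop) fun u hu => ?_
  refine IsCL.eq (A := fun a => lam K d (tens (cmul (bas [i]) (bas u)) (tens a z))) (B := fun a =>
    -(sgn K ((m + n + 1) * d i) • lam K d (tens (bas u) (tens a (bracket d (bas [i]) z)))))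
    (by fun_prop) (by fun_prop) fun v hv => ?_
  simp only [cmul_bas, lam_bas_bas, List.cons_append, List.nil_append, lamWord]
  congr 2
  refine sgn_congr ?_
  rw [← sub_mul, show wdeg d u + wdeg d v + 1 - (m + n + 1) =
    -((m - wdeg d u) + (n - wdeg d v)) by ring]
  exact (((hx u hu).add (ha v hv)).neg).mul_right _

lemma LieMon.lam_bracket {d : I → ℤ} {q : ℤ} {y : List I → K} (hy : LieMon d q y) {m n : ℤ}
    {x a : List I → K} (hx : HasPar (wdeg d) m x) (ha : HasPar (wdeg d) n a) (z : List I → K) :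
    lam K d (tens x (tens a (FormalGeom.bracket d y z))) =
      -(sgn K ((m + n + 1) * q) • lam K d (tens (cmul y x) (tens a z))) := by
  induction hy generalizing m x z with
  | letter i => rw [lam_letter hx ha, smul_neg, smul_smul, sgn_sq, one_smul, neg_neg]
  | @bracket p q b c hb hc ihb ihc =>
    rw [hb.hasPar.jacobi hc.hasPar, tens_sub_right, tens_sub_right, tens_smul_right,
      tens_smul_right, map_sub, map_smul, ihb hx, ihc hx, ihc (hb.hasPar.cmul hx),
      ihb (hc.hasPar.cmul hx), hb.hasPar.bracket_eq' hc.hasPar, cmul_sub_left, cmul_smul_left,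
      tens_sub_left, tens_smul_left, map_sub, map_smul, cmul_assoc, cmul_assoc]
    simp only [smul_neg, smul_sub, smul_smul, ← sgn_add]
    have h1 : sgn K ((m + n + 1) * p + (p + m + n + 1) * q) =
      sgn K ((m + n + 1) * (p + q) + p * q) := by congr 1; ring
    have h2 : sgn K (p * q + ((m + n + 1) * q + (q + m + n + 1) * p)) =
      sgn K ((m + n + 1) * (p + q)) := sgn_congr ⟨p * q, by ring⟩
    rw [h1, h2]
    abel

/-- `ω ⊗ [y, z] = [ω, y] ⊗ z` for `ω = x · da`, with `[ω, y] = - (-1)^(|ω||y|) y · ω`. -/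
lemma lam_bracket {d : I → ℤ} {m n : ℤ} {x a y : List I → K} (hx : HasPar (wdeg d) m x)
    (ha : HasPar (wdeg d) n a) (hy : y ∈ freeLie K d) (z : List I → K) :
    lam K d (tens x (tens a (bracket d y z))) =
      -lam K d (tens (cmul (tw d (m + n + 1) y) x) (tens a z)) := by
  refine IsCL.eq_of_lieMon (A := fun y => lam K d (tens x (tens a (bracket d y z))))
    (B := fun y => -lam K d (tens (cmul (tw d (m + n + 1) y) x) (tens a z)))
    (by fun_prop) (by fun_prop) (fun q y hy => ?_) hy
  rw [hy.lam_bracket hx ha, hy.hasPar.tw_eq, cmul_smul_left, tens_smul_left, map_smul]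

lemma lam_cmul {d : I → ℤ} {m n q : ℤ} {x a y : List I → K} (hx : HasPar (wdeg d) m x)
    (ha : HasPar (wdeg d) n a) (hy : y ∈ freeLie K d) (hy' : HasPar (wdeg d) q y)
    (z : List I → K) : lam K d (tens (cmul y x) (tens a z)) =
      -(sgn K ((m + n + 1) * q) • lam K d (tens x (tens a (bracket d y z)))) := by
  rw [lam_bracket hx ha hy, hy'.tw_eq, cmul_smul_left, tens_smul_left, map_smul, smul_neg,
    smul_smul, sgn_sq, one_smul, neg_neg]

lemma lam_invarRel {d : I → ℤ} {kx ka ky : ℤ} {x a y : List I → K} (hx : HasPar (wdeg d) kx x)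
    (ha : HasPar (wdeg d) ka a) (hy : y ∈ freeLie K d) (hy' : HasPar (wdeg d) ky y)
    (z : List I → K) : lam K d (invarRel d kx ka ky x a y z) = 0 := by
  rw [invarRel, map_add, map_smul, lam_cmul hx ha hy hy', smul_neg, smul_smul, sgn_sq, one_smul,
    add_neg_cancel]

lemma lam_leibnizRel {d : I → ℤ} {ka kb : ℤ} {a b : List I → K} (ha : a ∈ freeLie K d)
    (hb : b ∈ freeLie K d) (ha' : HasPar (wdeg d) ka a) (hb' : HasPar (wdeg d) kb b)
    (x z : List I → K) : lam K d (leibnizRel d ka kb x a b z) = 0 := by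
  refine IsCL.eq_zero (A := fun x => lam K d (leibnizRel d ka kb x a b z))
    (by unfold leibnizRel; fun_prop) fun x hx => ?_
  clear hx
  rw [leibnizRel, map_add, map_sub, map_smul, map_smul]
  induction x generalizing z with
  | nil =>
    rw [← one_eq_bas, lam_one, one_cmul, one_cmul, cyc_bracket ha' hb']
    have h1 := lam_cmul (hasPar_one d) hb' ha ha' z
    have h2 := lam_cmul (hasPar_one d) ha' hb hb' z
    rw [cmul_one, lam_one] at h1 h2
    rw [h1, h2]
    simp only [smul_neg, smul_smul, ← sgn_add]
    have e1 : sgn K (ka + (0 + kb + 1) * ka) = sgn K (ka * kb) := sgn_congr ⟨ka, by ring⟩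
    have e2 : sgn K ((ka + 1) * kb + (0 + ka + 1) * kb) = 1 := sgn_even ⟨(ka + 1) * kb, by ring⟩
    rw [e1, e2, one_smul]
    abel
  | cons i x ih =>
    have hx' := hasPar_bas (K := K) (wdeg d) x
    rw [bas_cons_eq, cmul_assoc, cmul_assoc, lam_letter hx' (ha'.bracket hb'),
      lam_letter (hx'.cmul ha') hb', lam_letter (hx'.cmul hb') ha', add_assoc (wdeg d x) ka kb,
      add_assoc (wdeg d x) kb ka, add_comm kb ka]
    have := congrArg (fun F => -(sgn K ((wdeg d x + (ka + kb) + 1) * d i) • F))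
      (ih (bracket d (bas [i]) z))
    simp only [smul_zero, neg_zero] at this
    rw [← this]
    module

/-- The map `lam` descends to `DR¹_Lie`. -/
lemma lam_eq_zero (𝒦 : ℤ → AddSubgroup K) [EvenlyGraded 𝒦] {d : I → ℤ}
    {F : List I × List I × List I → K} (hF : F ∈ lieRel 𝒦 d) : lam K d F = 0 := by
  refine (Submodule.mem_bot K).1 (map_closedSpan isClosed_bot' (lam K d) ?_ hF)
  rintro _ (⟨ka, kb, x, a, b, z, ha, hb, -, ha', hb', rfl⟩ |
    ⟨kx, ka, ky, x, a, y, z, -, hy, -, hx', ha', hy', rfl⟩)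
  · exact lam_leibnizRel ha hb (.of_homog ha') (.of_homog hb') _ _
  · exact lam_invarRel (.of_homog hx') (.of_homog ha') hy (.of_homog hy') _

/-! #### Iterated commutators -/

lemma HasPar.formLeft {d : I → ℤ} {k n : ℤ} {a : List I → K} {ω : List I × List I → K}
    (ha : HasPar (wdeg d) k a) (hω : HasPar (formDeg d) n ω) :
    HasPar (formDeg d) (k + n) (formLeft a ω) := by
  intro p hp
  obtain ⟨u, v, huv, hu, hv⟩ := exists_ne_zero_of_cmul hp
  have := (ha u hu).add (hω _ hv)
  simp only [formDeg, ← huv, wdeg_append] at this ⊢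
  rwa [show k + n - (wdeg d u + wdeg d v + wdeg d p.2 + 1) =
    k - wdeg d u + (n - (wdeg d v + wdeg d p.2 + 1)) by ring]

lemma HasPar.formRight {d : I → ℤ} {k n : ℤ} {a : List I → K} {ω : List I × List I → K}
    (ha : HasPar (wdeg d) k a) (hω : HasPar (formDeg d) n ω) :
    HasPar (formDeg d) (k + n) (formRight d ω a) := by
  refine HasPar.sub (f := fun p : List I × List I => FormalGeom.cmul (fun v => ω (p.1, v)) a p.2)
    (g := fun p => splitSum (fun u v => sgn K (wdeg d v) * ω (u, v)) p.1 * a p.2) (fun p hp => ?_)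
    (fun p hp => ?_)
  · obtain ⟨u, v, huv, hu, hv⟩ := exists_ne_zero_of_cmul hp
    have := (ha v hv).add (hω _ hu)
    simp only [formDeg, ← huv, wdeg_append] at this ⊢
    rwa [show k + n - (wdeg d p.1 + (wdeg d u + wdeg d v) + 1) =
      k - wdeg d v + (n - (wdeg d p.1 + wdeg d u + 1)) by ring]
  · dsimp only at hp
    obtain ⟨u, v, huv, hu⟩ := exists_ne_zero_of_splitSum (left_ne_zero_of_mul hp)
    have := (ha _ (right_ne_zero_of_mul hp)).add (hω _ (right_ne_zero_of_mul hu))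
    simp only [formDeg, ← huv, wdeg_append] at this ⊢
    rwa [show k + n - (wdeg d u + wdeg d v + wdeg d p.2 + 1) =
      k - wdeg d p.2 + (n - (wdeg d u + wdeg d v + 1)) by ring]

lemma HasPar.formComm {d : I → ℤ} {k n : ℤ} {a : List I → K} {ω : List I × List I → K}
    (ha : HasPar (wdeg d) k a) (hω : HasPar (formDeg d) n ω) :
    HasPar (formDeg d) (k + n) (formComm d k n a ω) :=
  (ha.formLeft hω).sub ((ha.formRight hω).smul _)

/-- `l((g₁ ⋯ g_k · da) ⊗ z) = [g₁, [g₂, ⋯ [g_k, da]]] · z`. -/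
lemma lam_listProd {d : I → ℤ} {k : ℤ} {a : List I → K} (ha : HasPar (wdeg d) k a)
    (gs : List (ℤ × (List I → K)))
    (hgs : ∀ g ∈ gs, g.2 ∈ freeLie K d ∧ HasPar (wdeg d) g.1 g.2) (z : List I → K) :
    lam K d (tens (listProd gs) (tens a z)) =
      formCyc K d (formRight d (iterComm d gs (k + 1) (tens one a)).2 z) := by
  -- the parities of `g₁ ⋯ g_k` and of the iterated commutator, which differ by `|da| = k + 1`
  have key : ∀ gs : List (ℤ × (List I → K)),
      (∀ g ∈ gs, g.2 ∈ freeLie K d ∧ HasPar (wdeg d) g.1 g.2) →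
      HasPar (wdeg d) ((iterComm d gs (k + 1) (tens one a)).1 - (k + 1)) (listProd gs) ∧
      HasPar (formDeg d) (iterComm d gs (k + 1) (tens one a)).1
        (iterComm d gs (k + 1) (tens one a)).2 := by
    intro gs hgs
    induction gs with
    | nil =>
      refine ⟨by simpa [iterComm, listProd] using hasPar_one d, fun p hp => ?_⟩
      have := ((hasPar_one d).tens ha) p hp
      simp only [iterComm, List.foldr_nil, formDeg]
      convert this using 1
      ring
    | cons g gs ih =>
      obtain ⟨h1, h2⟩ := ih fun g hg => hgs g (List.mem_cons_of_mem _ hg)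
      have hg := (hgs g List.mem_cons_self).2
      refine ⟨?_, hg.formComm h2⟩
      have := hg.cmul h1
      rw [← add_sub_assoc] at this
      exact this
  induction gs generalizing z with
  | nil => simp only [listProd, iterComm, List.foldr_nil, lam_one, formCyc_formRight_one]
  | cons g gs ih =>
    have hgs' : ∀ g ∈ gs, g.2 ∈ freeLie K d ∧ HasPar (wdeg d) g.1 g.2 :=
      fun g hg => hgs g (List.mem_cons_of_mem _ hg)
    obtain ⟨h1, h2⟩ := key gs hgs'
    obtain ⟨hg, hg'⟩ := hgs g List.mem_cons_self
    change lam K d (tens (cmul g.2 (listProd gs)) (tens a z)) = formCyc K d (formRight d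
      (formComm d g.1 (iterComm d gs (k + 1) (tens one a)).1 g.2
        (iterComm d gs (k + 1) (tens one a)).2) z)
    rw [lam_cmul h1 ha hg hg', ih hgs', formCyc_formRight_formComm hg' h2]
    congr 3
    ring

end LieToAss

/-! ### Lie one-forms -/

section LieModel
variable {K I : Type*} [CommRing K] [TopologicalSpace K] [DiscreteTopology K]

/-- `IsCL.mem` for `T̂W ⊗ L̂W ⊗ L̂W`: the first two factors can be taken to be words and Lie
monomials. -/
lemma IsCL.mem_of_lieTens {Y : Type*} {d : I → ℤ} {A : (List I × List I × List I → K) → (Y → K)}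
    (hA : IsCL K A) {N : Submodule K (Y → K)} (hN : IsClosed (N : Set (Y → K)))
    (h : ∀ (x : List I) (n : ℤ) (a z : List I → K), LieMon d n a → z ∈ freeLie K d →
      A (tens (bas x) (tens a z)) ∈ N)
    {F : List I × List I × List I → K} (hF : F ∈ lieTens K d) : A F ∈ N := by
  refine hA.preimage hN ?_ hF
  rintro _ ⟨x, a, ha, z, hz, rfl⟩
  refine IsCL.mem (A := fun x => A (tens x (tens a z))) (by fun_prop) hN fun x _ => ?_
  exact IsCL.mem_of_lieMon (A := fun a => A (tens (bas x) (tens a z))) (by fun_prop) hN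
    (fun n a ha => h x n a z ha hz) ha

/-- The completed tensor product `W ⊗ L̂W` inside `W ⊗ T̂W`. -/
def headLie (K : Type*) {I : Type*} [CommRing K] [TopologicalSpace K] [DiscreteTopology K]
    (d : I → ℤ) : Submodule K (I × List I → K) where
  carrier := {F | ∀ i, (fun w => F (i, w)) ∈ freeLie K d}
  add_mem' hF hG i := Submodule.add_mem _ (hF i) (hG i)
  zero_mem' _ := Submodule.zero_mem _
  smul_mem' k _ hF i := Submodule.smul_mem _ k (hF i)

lemma mem_headLie {d : I → ℤ} {F : I × List I → K} :
    F ∈ headLie K d ↔ ∀ i, (fun w => F (i, w)) ∈ freeLie K d := Iff.rfl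

lemma isClosed_headLie (d : I → ℤ) : IsClosed (headLie K d : Set (I × List I → K)) := by
  have : (headLie K d : Set (I × List I → K)) =
      ⋂ i, (fun (F : I × List I → K) w => F (i, w)) ⁻¹' (freeLie K d : Set (List I → K)) := by
    ext F; simp [mem_headLie]
  rw [this]
  exact isClosed_iInter fun i => isClosed_freeLie.preimage (by fun_prop)

lemma tens_mem_headLie {d : I → ℤ} (f : I → K) {z : List I → K} (hz : z ∈ freeLie K d) :
    tens f z ∈ headLie K d := fun i => by
  have : (fun w => tens f z (i, w)) = f i • z := rfl
  rw [this]; exact Submodule.smul_mem _ _ hz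

lemma hasSum_head (F : I × List I → K) : HasSum (fun i => tens (bas i) fun w => F (i, w)) F := by
  rw [Pi.hasSum]
  rintro ⟨i, w⟩
  convert hasSum_single (f := fun j => tens (bas j) (fun w => F (j, w)) (i, w)) i ?_ using 1
  · simp [tens, bas_self]
  · intro j hj
    simp [tens, bas_ne hj.symm]

lemma IsCL.mem_of_headLie {Y : Type*} {d : I → ℤ} {A : (I × List I → K) → (Y → K)}
    (hA : IsCL K A) {N : Submodule K (Y → K)} (hN : IsClosed (N : Set (Y → K)))
    (h : ∀ (i : I) (z : List I → K), z ∈ freeLie K d → A (tens (bas i) z) ∈ N)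
    {F : I × List I → K} (hF : F ∈ headLie K d) : A F ∈ N := by
  obtain ⟨L, hL⟩ := hA
  rw [hL]
  refine hN.mem_of_tendsto ((hasSum_head F).mapL L)
    (Filter.Eventually.of_forall fun s => N.sum_mem fun i _ => ?_)
  rw [← hL]
  exact h _ _ (hF i)

/-- For Lie elements `a` and `z`, the form `da · z` is a combination of forms `dt_i · w` with `w` a
Lie element. -/
lemma LieMon.cyc_mem {d : I → ℤ} {n : ℤ} {a : List I → K} (ha : LieMon d n a) {z : List I → K}
    (hz : z ∈ freeLie K d) : cyc K d (tens a z) ∈ headLie K d := by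
  induction ha generalizing z with
  | letter i => rw [cyc_letter]; exact tens_mem_headLie _ hz
  | bracket hb hc ihb ihc =>
    rw [cyc_bracket hb.hasPar hc.hasPar]
    exact Submodule.sub_mem _ (ihb (bracket_mem_freeLie hc.mem_freeLie hz))
      (Submodule.smul_mem _ _ (ihc (bracket_mem_freeLie hb.mem_freeLie hz)))

lemma bas_letter_mem (d : I → ℤ) (i : I) : (bas [i] : List I → K) ∈ freeLie K d :=
  (LieMon.letter i).mem_freeLie

lemma lam_mem_headLie {d : I → ℤ} {F : List I × List I × List I → K} (hF : F ∈ lieTens K d) :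
    lam K d F ∈ headLie K d := by
  refine IsCL.mem_of_lieTens (A := lam K d) (by fun_prop) (isClosed_headLie d)
    (fun x n a z ha hz => ?_) hF
  induction x generalizing z with
  | nil => rw [← one_eq_bas, lam_one]; exact ha.cyc_mem hz
  | cons i x ih =>
    rw [bas_cons_eq, lam_letter (hasPar_bas _ x) ha.hasPar]
    exact Submodule.neg_mem _ (Submodule.smul_mem _ _
      (ih _ (bracket_mem_freeLie (bas_letter_mem d i) hz)))

/-- The map `W ⊗ T̂W → T̂W ⊗ T̂W ⊗ T̂W` that sends `x ⊗ z` to `1 ⊗ x ⊗ z`, which stands for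
`dx ⊗ z`. -/
def emb (K : Type*) {I : Type*} [CommRing K] [TopologicalSpace K] :
    (I × List I → K) →L[K] (List I × List I × List I → K) where
  toFun F
    | ([], [i], w) => F (i, w)
    | _ => 0
  map_add' F G := by
    funext p
    match p with
    | ([], [i], w) => rfl
    | ([], [], w) => simp
    | ([], _ :: _ :: _, w) => simp
    | (_ :: _, _, w) => simp
  map_smul' k F := by
    funext p
    match p with
    | ([], [i], w) => rfl
    | ([], [], w) => simp
    | ([], _ :: _ :: _, w) => simp
    | (_ :: _, _, w) => simp
  cont := by
    refine continuous_pi fun p => ?_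
    match p with
    | ([], [i], w) => exact continuous_apply _
    | ([], [], w) => exact continuous_const
    | ([], _ :: _ :: _, w) => exact continuous_const
    | (_ :: _, _, w) => exact continuous_const

lemma emb_tens (i : I) (z : List I → K) :
    emb K (tens (bas i) z) = tens one (tens (bas [i]) z) := by
  classical
  funext p
  match p with
  | ([], [j], w) => simp [emb, tens, one, bas_apply]
  | ([], [], w) => simp [emb, tens, bas_apply]
  | ([], _ :: _ :: _, w) => simp [emb, tens, bas_apply]
  | (_ :: _, _, w) => simp [emb, tens, one]

lemma emb_homog {𝒦 : ℤ → AddSubgroup K} {d : I → ℤ} {n : ℤ} {F : I × List I → K}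
    (hF : F ∈ homog 𝒦 (headDeg d) n) :
    emb K F ∈ homog 𝒦 (fun p => wdeg d p.1 + wdeg d p.2.1 + wdeg d p.2.2) n := by
  intro p
  match p with
  | ([], [i], w) =>
    have := hF (i, w)
    change F (i, w) ∈ 𝒦 _
    simpa [headDeg, wdeg_nil, wdeg_letter] using this
  | ([], [], w) => exact AddSubgroup.zero_mem _
  | ([], _ :: _ :: _, w) => exact AddSubgroup.zero_mem _
  | (_ :: _, _, w) => exact AddSubgroup.zero_mem _

lemma lam_emb (d : I → ℤ) (F : I × List I → K) : lam K d (emb K F) = F := by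
  refine IsCL.eq (A := fun F => lam K d (emb K F)) (B := fun F => F) (by fun_prop) (by fun_prop)
    fun p _ => ?_
  obtain ⟨i, w⟩ := p
  rw [bas_prod, emb_tens, lam_one, cyc_letter]

lemma tens_mem_lieTens {d : I → ℤ} (x : List I → K) {a z : List I → K} (ha : a ∈ freeLie K d)
    (hz : z ∈ freeLie K d) : tens x (tens a z) ∈ lieTens K d :=
  tens_mem_closedSpan ⟨x, a, ha, z, hz, rfl⟩

lemma emb_mem_lieTens {d : I → ℤ} {F : I × List I → K} (hF : F ∈ headLie K d) :
    emb K F ∈ lieTens K d := by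
  refine IsCL.mem_of_headLie (A := emb K) (by fun_prop) (isClosed_closedSpan _)
    (fun i z hz => ?_) hF
  rw [emb_tens]
  exact tens_mem_lieTens _ (bas_letter_mem d i) hz

variable (𝒦 : ℤ → AddSubgroup K) [GradedRing 𝒦] [EvenlyGraded 𝒦]

/-- Every Lie one-form is a combination of forms `dt_i ⊗ z`. -/
lemma sub_emb_lam_mem {d : I → ℤ} {F : List I × List I × List I → K} (hF : F ∈ lieTens K d) :
    F - emb K (lam K d F) ∈ lieRel 𝒦 d := by
  have hcl : IsCL K fun F => F - emb K (lam K d F) := by fun_prop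
  have hrel : ∀ F ∈ lieRel 𝒦 d, F - emb K (lam K d F) ∈ lieRel 𝒦 d := fun F hF => by
    rwa [lam_eq_zero 𝒦 hF, map_zero, sub_zero]
  -- the left factor `x` can be moved to the last slot
  have step : ∀ {n : ℤ} {a : List I → K}, LieMon d n a →
      (∀ z ∈ freeLie K d, tens one (tens a z) - emb K (lam K d (tens one (tens a z))) ∈
        lieRel 𝒦 d) →
      ∀ x, ∀ z ∈ freeLie K d, tens x (tens a z) - emb K (lam K d (tens x (tens a z))) ∈
        lieRel 𝒦 d := by
    intro n a ha h x z hz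
    refine IsCL.mem (A := fun x => tens x (tens a z) - emb K (lam K d (tens x (tens a z))))
      (by fun_prop) (isClosed_closedSpan _) fun x hx => ?_
    clear hx
    induction x generalizing z with
    | nil => rw [← one_eq_bas]; exact h z hz
    | cons i x ih =>
      have h1 : invarRel d (wdeg d x) n (d i) (bas x) a (bas [i]) z ∈ lieRel 𝒦 d := by
        refine tens_mem_closedSpan (Or.inr ⟨_, _, _, _, _, _, _, ha.mem_freeLie, bas_letter_mem d i,
          hz, bas_homog 𝒦 _ x, ha.homog, ?_, rfl⟩)
        exact (LieMon.letter i).homog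
      have h2 := hrel _ h1
      rw [invarRel, ← bas_cons_eq, hcl.map_add, hcl.map_smul] at h2
      have h3 := (Submodule.add_mem_iff_right _
        (ih _ (bracket_mem_freeLie (bas_letter_mem d i) hz))).1 h2
      have h4 := Submodule.smul_mem _ (sgn K ((wdeg d x + n + 1) * d i)) h3
      rwa [smul_smul, sgn_sq, one_smul] at h4
  have main : ∀ {n : ℤ} {a : List I → K}, LieMon d n a →
      ∀ x, ∀ z ∈ freeLie K d, tens x (tens a z) - emb K (lam K d (tens x (tens a z))) ∈
        lieRel 𝒦 d := by
    intro n a ha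
    induction ha with
    | letter i =>
      refine step (.letter i) fun z hz => ?_
      rw [lam_one, cyc_letter, emb_tens, sub_self]
      exact Submodule.zero_mem _
    | @bracket p q b c hb hc ihb ihc =>
      refine step (hb.bracket hc) fun z hz => ?_
      have h1 : leibnizRel d p q one b c z ∈ lieRel 𝒦 d :=
        tens_mem_closedSpan (Or.inl ⟨_, _, _, _, _, _, hb.mem_freeLie, hc.mem_freeLie, hz,
          hb.homog, hc.homog, rfl⟩)
      have h2 := hrel _ h1
      rw [leibnizRel, one_cmul, one_cmul, hcl.map_add, hcl.map_sub, hcl.map_smul,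
        hcl.map_smul] at h2
      have h3 := (Submodule.add_mem_iff_left _ (Submodule.smul_mem _ _ (ihb c z hz))).1 h2
      exact (Submodule.sub_mem_iff_left _ (Submodule.smul_mem _ _ (ihc b z hz))).1 h3
  exact hcl.mem_of_lieTens (isClosed_closedSpan _) (fun x n a z ha hz => main ha _ z hz) hF

end LieModel

/-! ### The shuffle coproduct -/

section Coproduct
variable {K I : Type*} [CommRing K] [TopologicalSpace K] [DiscreteTopology K]

lemma shufCoprod_zero (d : I → ℤ) (u v : List I) :
    shufCoprod d (fun _ => (0 : K)) u v = 0 := by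
  have := shufCoprod_smul d (0 : K) (fun _ => 0) u v
  simpa using this

lemma continuous_shufCoprod (d : I → ℤ) (u v : List I) :
    Continuous fun f : List I → K => shufCoprod d f u v := by
  match u, v with
  | [], v => simp only [shufCoprod]; fun_prop
  | i :: u, [] => simp only [shufCoprod]; fun_prop
  | i :: u, j :: v =>
    simp only [shufCoprod]
    have h1 := continuous_shufCoprod d u (j :: v)
    have h2 := continuous_shufCoprod d (i :: u) v
    have h3 : Continuous fun (f : List I → K) w => f (i :: w) := by fun_prop
    have h4 : Continuous fun (f : List I → K) w => f (j :: w) := by fun_prop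
    exact (h1.comp h3).add (continuous_const.mul (h2.comp h4))
  termination_by u.length + v.length

/-- The shuffle coproduct with values in the completed tensor square. -/
def coprod (d : I → ℤ) (f : List I → K) : List I × List I → K := fun p => shufCoprod d f p.1 p.2

@[fun_prop]
lemma isCL_coprod (d : I → ℤ) : IsCL K (coprod (K := K) d) :=
  IsCL.mk' (fun f g => funext fun p => shufCoprod_add d f g p.1 p.2)
    (fun k f => funext fun p => shufCoprod_smul d k f p.1 p.2)
    (continuous_pi fun p => continuous_shufCoprod d p.1 p.2)

lemma shuffleOp_apply (d : I → ℤ) (f : List I → K) : shuffleOp K d f = mulMap (coprod d f) := rfl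

@[fun_prop]
lemma isCL_shuffleOp (d : I → ℤ) : IsCL K (shuffleOp K d) := by
  change IsCL K fun f => mulMap (coprod d f)
  fun_prop

/-- Left multiplication by `1 ⊗ x` on the tensor square. -/
def slotMul (d : I → ℤ) (x : List I → K) (T : List I × List I → K) : List I × List I → K :=
  fun p => cmul (tw d (wdeg d p.1) x) (fun v => T (p.1, v)) p.2

/-- Left multiplication by `x ⊗ 1 + 1 ⊗ x` on the tensor square. -/
def primMul (d : I → ℤ) (x : List I → K) (T : List I × List I → K) : List I × List I → K :=
  formLeft x T + slotMul d x T

section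
variable {E : Type*} [AddCommGroup E] [Module K E] [TopologicalSpace E]

@[fun_prop]
lemma isCL_slotMul_left (d : I → ℤ) (T : List I × List I → K) {A : E → (List I → K)}
    (hA : IsCL K A) : IsCL K fun x => slotMul d (A x) T := by
  refine IsCL.comp (B := fun x => slotMul d x T) (IsCL.mk' (fun g h => ?_) (fun k g => ?_) ?_) hA
  · funext p; simp [slotMul, tw_add, cmul_add_left]
  · funext p; simp [slotMul, tw_smul, cmul_smul_left]
  · unfold slotMul cmul mulMap splitSum tens tw; fun_prop

@[fun_prop]
lemma isCL_slotMul_right (d : I → ℤ) (x : List I → K) {A : E → (List I × List I → K)}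
    (hA : IsCL K A) : IsCL K fun T => slotMul d x (A T) := by
  refine IsCL.comp (B := fun T => slotMul d x T) (IsCL.mk' (fun g h => ?_) (fun k g => ?_) ?_) hA
  · funext p
    exact congrFun (cmul_add_right (tw d (wdeg d p.1) x) (fun v => g (p.1, v))
      fun v => h (p.1, v)) p.2
  · funext p
    exact congrFun (cmul_smul_right k (tw d (wdeg d p.1) x) (fun v => g (p.1, v))) p.2
  · unfold slotMul cmul mulMap splitSum tens tw; fun_prop

@[fun_prop]
lemma isCL_primMul_left (d : I → ℤ) (T : List I × List I → K) {A : E → (List I → K)}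
    (hA : IsCL K A) : IsCL K fun x => primMul d (A x) T := by
  unfold primMul; fun_prop

@[fun_prop]
lemma isCL_primMul_right (d : I → ℤ) (x : List I → K) {A : E → (List I × List I → K)}
    (hA : IsCL K A) : IsCL K fun T => primMul d x (A T) := by
  unfold primMul; fun_prop
end

lemma HasPar.slotMul_tens {d : I → ℤ} {k : ℤ} {f : List I → K} (hf : HasPar (wdeg d) k f)
    (x g : List I → K) :
    slotMul d x (FormalGeom.tens f g) =
      FormalGeom.tens f (FormalGeom.cmul (FormalGeom.tw d k x) g) := by
  funext p
  simp only [slotMul, FormalGeom.cmul, mulMap, FormalGeom.tens, FormalGeom.tw, mul_splitSum]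
  refine splitSum_congr fun u v _ => ?_
  have := hf.sgn_mul (wdeg d u) p.1
  rw [mul_comm (wdeg d u), mul_comm (wdeg d u)] at this
  linear_combination (x u * g v) * this

lemma HasPar.primMul_tens {d : I → ℤ} {k m : ℤ} {f x : List I → K} (hf : HasPar (wdeg d) k f)
    (hx : HasPar (wdeg d) m x) (g : List I → K) :
    primMul d x (FormalGeom.tens f g) = FormalGeom.tens (FormalGeom.cmul x f) g +
      sgn K (k * m) • FormalGeom.tens f (FormalGeom.cmul x g) := by
  rw [primMul, hf.slotMul_tens, formLeft_tens, hx.tw_eq, cmul_smul_left, tens_smul_right]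

/-- The operators `x ⊗ 1 + 1 ⊗ x` satisfy the relations of the free Lie algebra. -/
lemma primMul_bracket {d : I → ℤ} {m n : ℤ} {b c : List I → K} (hb : HasPar (wdeg d) m b)
    (hc : HasPar (wdeg d) n c) (T : List I × List I → K) :
    primMul d (bracket d b c) T =
      primMul d b (primMul d c T) - sgn K (m * n) • primMul d c (primMul d b T) := by
  refine IsCL.eq (A := fun T => primMul d (bracket d b c) T) (B := fun T =>
      primMul d b (primMul d c T) - sgn K (m * n) • primMul d c (primMul d b T))
    (by fun_prop) (by fun_prop) fun p _ => ?_
  obtain ⟨u, v⟩ := p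
  have hu := hasPar_bas (K := K) (wdeg d) u
  have hadd : ∀ (x : List I → K) (F G : List I × List I → K),
      primMul d x (F + G) = primMul d x F + primMul d x G :=
    fun x F G => IsCL.map_add (A := fun T => primMul d x T) (by fun_prop) F G
  have hsmul : ∀ (x : List I → K) (k : K) (F : List I × List I → K),
      primMul d x (k • F) = k • primMul d x F :=
    fun x k F => IsCL.map_smul (A := fun T => primMul d x T) (by fun_prop) k F
  rw [bas_prod, hu.primMul_tens (hb.bracket hc), hu.primMul_tens hb, hu.primMul_tens hc, hadd,
    hadd, hsmul, hsmul, hu.primMul_tens hb, hu.primMul_tens hc, (hc.cmul hu).primMul_tens hb,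
    (hb.cmul hu).primMul_tens hc, hb.bracket_eq' hc]
  simp only [cmul_sub_left, cmul_smul_left, tens_sub_left, tens_sub_right, tens_smul_left,
    tens_smul_right, cmul_assoc, smul_add, smul_sub, smul_smul, ← sgn_add]
  have h1 : sgn K ((n + wdeg d u) * m) = sgn K (m * n + wdeg d u * m) := by congr 1; ring
  have h2 : sgn K (m * n + (m + wdeg d u) * n) = sgn K (wdeg d u * n) :=
    sgn_congr ⟨m * n, by ring⟩
  have h3 : sgn K (wdeg d u * (m + n) + m * n) =
    sgn K (m * n + (wdeg d u * m + wdeg d u * n)) := by congr 1; ring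
  have h4 : sgn K (wdeg d u * (m + n)) = sgn K (wdeg d u * n + wdeg d u * m) := by congr 1; ring
  rw [h1, h2, h3, h4]
  abel

lemma shufCoprod_nil_right (d : I → ℤ) (f : List I → K) (u : List I) :
    shufCoprod d f u [] = f u := by
  cases u <;> simp [shufCoprod]

lemma coprod_letter_cmul (d : I → ℤ) (i : I) (f : List I → K) :
    coprod d (cmul (bas [i]) f) = primMul d (bas [i]) (coprod d f) := by
  classical
  have h : ∀ j u v, shufCoprod d (fun w => cmul (bas [i]) f (j :: w)) u v =
      if j = i then shufCoprod d f u v else 0 := by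
    intro j u v
    split_ifs with hj
    · simp only [letter_cmul_cons, if_pos hj]
    · simp only [letter_cmul_cons, if_neg hj, shufCoprod_zero]
  have h2 : ∀ u v, slotMul d (bas [i]) (coprod d f) (u, v) = sgn K (wdeg d u * d i) *
      cmul (bas [i]) (fun v => coprod d f (u, v)) v := by
    intro u v
    simp only [slotMul, tw_bas, cmul_smul_left, wdeg_letter, Pi.smul_apply, smul_eq_mul]
  funext p
  match p with
  | ([], []) =>
    rw [primMul, Pi.add_apply, h2]
    simp only [coprod, shufCoprod, formLeft, letter_cmul_nil, mul_zero, add_zero]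
  | ([], j :: v) =>
    rw [primMul, Pi.add_apply, h2]
    simp only [coprod, shufCoprod, formLeft, letter_cmul_nil, letter_cmul_cons, zero_add,
      wdeg_nil, zero_mul, sgn_zero, one_mul]
  | (j :: u, []) =>
    rw [primMul, Pi.add_apply, h2]
    simp only [coprod, formLeft, letter_cmul_nil, letter_cmul_cons, mul_zero, add_zero,
      shufCoprod_nil_right]
  | (j :: u, k :: v) =>
    rw [primMul, Pi.add_apply, h2]
    simp only [coprod, shufCoprod]
    rw [h, h]
    simp only [formLeft, letter_cmul_cons]
    by_cases hk : k = i
    · simp [hk, mul_comm, coprod]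
    · simp [hk, coprod]

/-- `Δ(x f) = (x ⊗ 1 + 1 ⊗ x) Δ(f)`: the elements of the free Lie algebra are primitive. -/
lemma coprod_lie_cmul {d : I → ℤ} {x : List I → K} (hx : x ∈ freeLie K d) (f : List I → K) :
    coprod d (cmul x f) = primMul d x (coprod d f) := by
  refine IsCL.eq_of_lieMon (A := fun x => coprod d (cmul x f)) (B := fun x =>
    primMul d x (coprod d f)) (by fun_prop) (by fun_prop) (fun n x hx => ?_) hx
  induction hx generalizing f with
  | letter i => exact coprod_letter_cmul d i f
  | bracket hb hc ihb ihc =>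
    rw [primMul_bracket hb.hasPar hc.hasPar, ← ihc f, ← ihb f, ← ihb, ← ihc,
      hb.hasPar.bracket_eq' hc.hasPar, cmul_sub_left, cmul_smul_left,
      (isCL_coprod d).map_sub, (isCL_coprod d).map_smul, cmul_assoc, cmul_assoc]

lemma coprod_one (d : I → ℤ) : coprod d (one : List I → K) = tens one one := by
  funext p
  match p with
  | ([], v) => simp [coprod, shufCoprod, tens, one]
  | (i :: u, []) => simp [coprod, shufCoprod, tens, one]
  | (i :: u, j :: v) => simp [coprod, shufCoprod, tens, one, shufCoprod_zero]

lemma mulMap_tens (f g : List I → K) : mulMap (tens f g) = cmul f g := rfl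

lemma shuffleOp_one (d : I → ℤ) : shuffleOp K d one = one := by
  rw [shuffleOp_apply, coprod_one, mulMap_tens, one_cmul]

/-- The elements of the free Lie algebra are primitive, so `s = 2` on them. -/
lemma shuffleOp_lie {d : I → ℤ} {x : List I → K} (hx : x ∈ freeLie K d) :
    shuffleOp K d x = (2 : K) • x := by
  have h : coprod d x = tens x one + tens one x := by
    have h1 := coprod_lie_cmul hx one
    have h2 : tw d 0 x = x := by funext w; simp [tw, sgn_zero]
    rwa [cmul_one, coprod_one, primMul, formLeft_tens, (hasPar_one d).slotMul_tens, h2,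
      cmul_one] at h1
  rw [shuffleOp_apply, h, IsCL.map_add (A := mulMap) (by fun_prop), mulMap_tens, mulMap_tens,
    one_cmul, cmul_one, two_smul]

/-! ### Derivations commute with the shuffle operator -/

/-- A graded derivation of parity `n` of the completed tensor algebra that sends the generators
to the free Lie algebra. -/
structure IsLieDer (d : I → ℤ) (n : ℤ) (D : (List I → K) → (List I → K)) : Prop where
  isCL : IsCL K D
  map_one : D one = 0
  letter_cmul : ∀ i f, D (cmul (bas [i]) f) =
    cmul (D (bas [i])) f + sgn K (n * d i) • cmul (bas [i]) (D f)
  lie : ∀ i, D (bas [i]) ∈ freeLie K d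
  par : ∀ i, HasPar (wdeg d) (n + d i) (D (bas [i]))

/-- The operator `D ⊗ 1 + 1 ⊗ D` on the tensor square. -/
def tensDer (d : I → ℤ) (n : ℤ) (D : (List I → K) → (List I → K)) (T : List I × List I → K) :
    List I × List I → K :=
  fun p => D (fun u => T (u, p.2)) p.1 + sgn K (n * wdeg d p.1) * D (fun v => T (p.1, v)) p.2

namespace IsLieDer
variable {d : I → ℤ} {n : ℤ} {D : (List I → K) → (List I → K)} (hD : IsLieDer d n D)
include hD

lemma par_word (w : List I) : HasPar (wdeg d) (n + wdeg d w) (D (bas w)) := by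
  induction w with
  | nil => rw [← one_eq_bas, hD.map_one]; exact hasPar_zero _ _
  | cons i w ih =>
    rw [bas_cons_eq, hD.letter_cmul, wdeg_cons, ← add_assoc]
    refine ((hD.par i).cmul (hasPar_bas _ w)).add (HasPar.smul ?_ _)
    have := (hasPar_bas (K := K) (wdeg d) [i]).cmul ih
    rwa [wdeg_letter, ← add_assoc, add_comm (d i) n] at this

lemma word_cmul (u : List I) (f : List I → K) : D (cmul (bas u) f) =
    cmul (D (bas u)) f + sgn K (n * wdeg d u) • cmul (bas u) (D f) := by
  induction u generalizing f with
  | nil =>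
    rw [← one_eq_bas, hD.map_one, one_cmul, one_cmul, cmul_zero_left, wdeg_nil, mul_zero, sgn_zero,
      one_smul, zero_add]
  | cons i u ih =>
    rw [bas_cons_eq, cmul_assoc, hD.letter_cmul, hD.letter_cmul, ih, wdeg_cons, mul_add, sgn_add]
    simp only [cmul_add_left, cmul_add_right, cmul_smul_left, cmul_smul_right, cmul_assoc,
      smul_add, smul_smul]
    abel

@[fun_prop]
lemma isCL_tensDer : IsCL K (tensDer d n D) := by
  obtain ⟨L, hL⟩ := hD.isCL
  have : tensDer d n D = fun T p => L (fun u => T (u, p.2)) p.1 +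
      sgn K (n * wdeg d p.1) * L (fun v => T (p.1, v)) p.2 := by
    funext T p; simp only [tensDer, hL]
  rw [this]
  refine IsCL.mk' (fun F G => ?_) (fun k F => ?_) ?_
  · funext p
    have h1 := map_add L (fun u => F (u, p.2)) fun u => G (u, p.2)
    have h2 := map_add L (fun u => F (p.1, u)) fun u => G (p.1, u)
    change L ((fun u => F (u, p.2)) + fun u => G (u, p.2)) p.1 + sgn K (n * wdeg d p.1) *
      L ((fun u => F (p.1, u)) + fun u => G (p.1, u)) p.2 = _
    rw [h1, h2]
    simp only [Pi.add_apply]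
    ring
  · funext p
    have h1 := map_smul L k (fun u => F (u, p.2))
    have h2 := map_smul L k (fun u => F (p.1, u))
    change L (k • (fun u => F (u, p.2))) p.1 + sgn K (n * wdeg d p.1) *
      L (k • (fun u => F (p.1, u))) p.2 = _
    rw [h1, h2]
    simp only [Pi.smul_apply, smul_eq_mul]
    ring
  · refine continuous_pi fun p => ?_
    fun_prop

lemma tensDer_tens {k : ℤ} {f : List I → K} (hf : HasPar (wdeg d) k f) (g : List I → K) :
    tensDer d n D (tens f g) = tens (D f) g + sgn K (n * k) • tens f (D g) := by
  funext ⟨p, q⟩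
  have h1 : (fun u => tens f g (u, q)) = g q • f := by
    funext u; simp [tens, mul_comm]
  have h2 : (fun v => tens f g (p, v)) = f p • g := by
    funext v; simp [tens]
  simp only [tensDer, h1, h2, hD.isCL.map_smul]
  have := hf.sgn_mul n p
  simp only [tens, Pi.add_apply, Pi.smul_apply, smul_eq_mul]
  linear_combination (D g q) * this

lemma mulMap_tensDer (T : List I × List I → K) : D (mulMap T) = mulMap (tensDer d n D T) := by
  have h1 := hD.isCL
  have h2 := hD.isCL_tensDer
  refine IsCL.eq (A := fun T => D (mulMap T)) (B := fun T => mulMap (tensDer d n D T))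
    (by fun_prop) (by fun_prop) fun p _ => ?_
  obtain ⟨u, v⟩ := p
  have hm : IsCL K (mulMap : (List I × List I → K) → (List I → K)) := by fun_prop
  rw [bas_prod, hD.tensDer_tens (hasPar_bas _ u), mulMap_tens, hD.word_cmul, hm.map_add,
    hm.map_smul, mulMap_tens, mulMap_tens]

lemma tensDer_primMul (i : I) (T : List I × List I → K) :
    tensDer d n D (primMul d (bas [i]) T) = primMul d (D (bas [i])) T +
      sgn K (n * d i) • primMul d (bas [i]) (tensDer d n D T) := by
  have h2 := hD.isCL_tensDer
  refine IsCL.eq (A := fun T => tensDer d n D (primMul d (bas [i]) T)) (B := fun T =>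
    primMul d (D (bas [i])) T + sgn K (n * d i) • primMul d (bas [i]) (tensDer d n D T))
    (by fun_prop) (by fun_prop) fun p _ => ?_
  obtain ⟨u, v⟩ := p
  have hu := hasPar_bas (K := K) (wdeg d) u
  have hi : HasPar (wdeg d) (d i) (bas [i] : List I → K) := (LieMon.letter i).hasPar
  have hp : IsCL K fun T => primMul (K := K) d (bas [i]) T := by fun_prop
  rw [bas_prod, hu.primMul_tens hi, hu.primMul_tens (hD.par i), hD.tensDer_tens hu, hp.map_add,
    hp.map_smul, (hD.par_word u).primMul_tens hi, hu.primMul_tens hi, h2.map_add, h2.map_smul,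
    hD.tensDer_tens (hi.cmul hu), hD.tensDer_tens hu, hD.letter_cmul, hD.letter_cmul]
  simp only [tens_add_left, tens_add_right, tens_smul_left, tens_smul_right, smul_add, smul_smul,
    ← sgn_add]
  have h1 : sgn K (n * (d i + wdeg d u)) = sgn K (n * d i + n * wdeg d u) := by congr 1; ring
  have h3 : sgn K (wdeg d u * d i + n * wdeg d u) = sgn K (wdeg d u * (n + d i)) := by
    congr 1; ring
  have h4 : sgn K (n * d i + (n + wdeg d u) * d i) = sgn K (wdeg d u * d i) :=
    sgn_congr ⟨n * d i, by ring⟩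
  have h5 : sgn K (wdeg d u * d i + (n * wdeg d u + n * d i)) =
    sgn K (n * d i + (n * wdeg d u + wdeg d u * d i)) := by congr 1; ring
  rw [h1, h3, h4, h5]
  abel

/-- A derivation that preserves the primitive elements is a coderivation: both sides satisfy the
same recursion over words. -/
lemma coprod_map (f : List I → K) : coprod d (D f) = tensDer d n D (coprod d f) := by
  have h1 := hD.isCL
  have h2 := hD.isCL_tensDer
  refine IsCL.eq (A := fun f => coprod d (D f)) (B := fun f => tensDer d n D (coprod d f))
    (by fun_prop) (by fun_prop) fun w hw => ?_
  clear hw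
  have hc := isCL_coprod (K := K) d
  induction w with
  | nil =>
    rw [← one_eq_bas, coprod_one, hD.tensDer_tens (hasPar_one d), hD.map_one]
    funext p
    have := congrFun (hc.map_smul 0 0) p
    simp only [zero_smul] at this
    rw [this]
    simp [tens]
  | cons i w ih =>
    rw [bas_cons_eq, coprod_letter_cmul, hD.tensDer_primMul, hD.letter_cmul, hc.map_add,
      hc.map_smul, coprod_lie_cmul (hD.lie i), coprod_letter_cmul, ih]

/-- Derivations that preserve the primitive elements commute with the shuffle operator. -/
lemma shuffleOp_comm (f : List I → K) : shuffleOp K d (D f) = D (shuffleOp K d f) := by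
  rw [shuffleOp_apply, shuffleOp_apply, hD.mulMap_tensDer, hD.coprod_map]

end IsLieDer

lemma LieMon.isLieDer {d : I → ℤ} {n : ℤ} {y : List I → K} (hy : LieMon d n y) :
    IsLieDer d n (FormalGeom.bracket d y) where
  isCL := by fun_prop
  map_one := by
    rw [hy.hasPar.bracket_eq' (hasPar_one d), one_cmul, cmul_one, mul_zero, sgn_zero, one_smul,
      sub_self]
  letter_cmul i f := by
    rw [hy.hasPar.bracket_cmul, tw_bas, cmul_smul_left, wdeg_letter]
  lie i := bracket_mem_freeLie hy.mem_freeLie (LieMon.letter i).mem_freeLie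
  par i := hy.hasPar.bracket (LieMon.letter i).hasPar

end Coproduct

/-! ### The filtration by products of Lie elements -/

section Filtration
variable {K I : Type*} [CommRing K] [TopologicalSpace K] [DiscreteTopology K]

/-- The products of `k` Lie monomials, with their degrees. -/
inductive LieProd (d : I → ℤ) : ℕ → ℤ → (List I → K) → Prop
  | one : LieProd d 0 0 one
  | mul {k : ℕ} {m n : ℤ} {x p : List I → K} : LieMon d m x → LieProd d k n p →
      LieProd d (k + 1) (m + n) (cmul x p)

lemma LieProd.hasPar {d : I → ℤ} {k : ℕ} {n : ℤ} {p : List I → K} (hp : LieProd d k n p) :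
    HasPar (wdeg d) n p := by
  induction hp with
  | one => exact hasPar_one d
  | mul hx _ ih => exact hx.hasPar.cmul ih

lemma LieProd.cmul {d : I → ℤ} {i j : ℕ} {m n : ℤ} {p q : List I → K} (hp : LieProd d i m p)
    (hq : LieProd d j n q) : LieProd d (i + j) (m + n) (cmul p q) := by
  induction hp with
  | one => rwa [one_cmul, zero_add, zero_add]
  | mul hx _ ih =>
    rw [cmul_assoc, Nat.add_right_comm, Int.add_assoc]
    exact .mul hx ih

lemma lieProd_word (d : I → ℤ) (w : List I) :
    LieProd d w.length (wdeg d w) (bas w : List I → K) := by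
  induction w with
  | nil => rw [← one_eq_bas]; exact .one
  | cons i w ih => rw [bas_cons_eq, wdeg_cons]; exact .mul (.letter i) ih

/-- The span of the products of `k` Lie monomials. -/
def lieGr (K : Type*) {I : Type*} [CommRing K] (d : I → ℤ) (k : ℕ) : Submodule K (List I → K) :=
  Submodule.span K {p | ∃ n, LieProd d k n p}

/-- The span of the products of fewer than `k` Lie monomials. -/
def lieFil (K : Type*) {I : Type*} [CommRing K] (d : I → ℤ) (k : ℕ) : Submodule K (List I → K) :=
  Submodule.span K {p | ∃ j < k, ∃ n, LieProd d j n p}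

/-- The span of the tensors of total order `k` of products of Lie monomials. -/
def lieGr₂ (K : Type*) {I : Type*} [CommRing K] (d : I → ℤ) (k : ℕ) :
    Submodule K (List I × List I → K) :=
  Submodule.span K {T | ∃ i j m n p q, i + j = k ∧ LieProd d i m p ∧ LieProd d j n q ∧
    T = tens p q}

lemma LieProd.mem_lieGr {d : I → ℤ} {k : ℕ} {n : ℤ} {p : List I → K} (hp : LieProd d k n p) :
    p ∈ lieGr K d k := Submodule.subset_span ⟨n, hp⟩

lemma LieProd.mem_lieFil {d : I → ℤ} {j k : ℕ} (h : j < k) {n : ℤ} {p : List I → K}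
    (hp : LieProd d j n p) : p ∈ lieFil K d k := Submodule.subset_span ⟨j, h, n, hp⟩

lemma lieGr_le_lieFil (d : I → ℤ) {j k : ℕ} (h : j < k) : lieGr K d j ≤ lieFil K d k :=
  Submodule.span_le.2 fun _ ⟨_, hp⟩ => hp.mem_lieFil h

lemma lieFil_mono (d : I → ℤ) {j k : ℕ} (h : j ≤ k) : lieFil K d j ≤ lieFil K d k :=
  Submodule.span_mono fun _ ⟨i, hi, hp⟩ => ⟨i, hi.trans_le h, hp⟩

/-- A continuous linear map sends a span into a submodule as soon as it does so with the
generators. -/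
lemma mem_of_mem_span {E F : Type*} [AddCommGroup E] [Module K E] [TopologicalSpace E]
    [AddCommGroup F] [Module K F] [TopologicalSpace F] {A : E → F} (hA : IsCL K A) {S : Set E}
    {N : Submodule K F} (h : ∀ x ∈ S, A x ∈ N) {x : E} (hx : x ∈ Submodule.span K S) :
    A x ∈ N := by
  obtain ⟨L, hL⟩ := hA
  have : Submodule.span K S ≤ N.comap (L : E →ₗ[K] F) :=
    Submodule.span_le.2 fun x hx => by
      have := h x hx
      rw [hL] at this
      exact this
  rw [hL]
  exact this hx

lemma LieMon.cmul_mem_lieGr {d : I → ℤ} {m : ℤ} {x : List I → K} (hx : LieMon d m x) {k : ℕ}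
    {p : List I → K} (hp : p ∈ lieGr K d k) : cmul x p ∈ lieGr K d (k + 1) :=
  mem_of_mem_span (A := fun p => cmul x p) (by fun_prop)
    (by rintro _ ⟨_, hp⟩; exact (LieProd.mul hx hp).mem_lieGr) hp

lemma LieMon.cmul_mem_lieFil {d : I → ℤ} {m : ℤ} {x : List I → K} (hx : LieMon d m x) {k : ℕ}
    {p : List I → K} (hp : p ∈ lieFil K d k) : cmul x p ∈ lieFil K d (k + 1) :=
  mem_of_mem_span (A := fun p => cmul x p) (by fun_prop)
    (by rintro _ ⟨_, h, _, hp⟩; exact (LieProd.mul hx hp).mem_lieFil (Nat.succ_lt_succ h)) hp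

lemma LieMon.bracket_mem_lieGr {d : I → ℤ} {m : ℤ} {x : List I → K} (hx : LieMon d m x) {k : ℕ}
    {n : ℤ} {p : List I → K} (hp : LieProd d k n p) :
    FormalGeom.bracket d x p ∈ lieGr K d k := by
  induction hp with
  | one => rw [hx.isLieDer.map_one]; exact Submodule.zero_mem _
  | mul hy hp ih =>
    rw [hx.hasPar.bracket_cmul, hy.hasPar.tw_eq, cmul_smul_left]
    exact Submodule.add_mem _ (LieProd.mul (hx.bracket hy) hp).mem_lieGr
      (Submodule.smul_mem _ _ (hy.cmul_mem_lieGr ih))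

lemma LieProd.coprod_mem {d : I → ℤ} {k : ℕ} {n : ℤ} {p : List I → K} (hp : LieProd d k n p) :
    coprod d p ∈ lieGr₂ K d k := by
  induction hp with
  | one =>
    rw [coprod_one]
    exact Submodule.subset_span ⟨0, 0, 0, 0, FormalGeom.one, FormalGeom.one, rfl, .one, .one, rfl⟩
  | @mul k _ _ x _ hx _ ih =>
    rw [coprod_lie_cmul hx.mem_freeLie]
    refine mem_of_mem_span (A := fun T => primMul d x T) (by fun_prop) ?_ ih
    rintro _ ⟨i, j, m, n, p, q, hij, hp, hq, rfl⟩
    rw [hp.hasPar.primMul_tens hx.hasPar]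
    refine Submodule.add_mem _
      (Submodule.subset_span ⟨i + 1, j, _, _, _, _, ?_, .mul hx hp, hq, rfl⟩)
      (Submodule.smul_mem _ _ (Submodule.subset_span
        ⟨i, j + 1, _, _, _, _, ?_, hp, .mul hx hq, rfl⟩))
    all_goals omega

/-- `μ((x ⊗ 1 + 1 ⊗ x) T) = 2 x μ(T)` up to commutators of `x`. -/
lemma LieMon.mulMap_primMul {d : I → ℤ} {m : ℤ} {x : List I → K} (hx : LieMon d m x) {k : ℕ}
    {T : List I × List I → K} (hT : T ∈ lieGr₂ K d k) :
    mulMap (primMul d x T) - (2 : K) • cmul x (mulMap T) ∈ lieGr K d k := by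
  refine mem_of_mem_span (A := fun T => mulMap (primMul d x T) - (2 : K) • cmul x (mulMap T))
    (by fun_prop) ?_ hT
  rintro _ ⟨i, j, a, b, p, q, rfl, hp, hq, rfl⟩
  have hm : IsCL K (mulMap : (List I × List I → K) → (List I → K)) := by fun_prop
  have h : mulMap (primMul d x (tens p q)) - (2 : K) • FormalGeom.cmul x (mulMap (tens p q)) =
      -FormalGeom.cmul (FormalGeom.bracket d x p) q := by
    rw [hp.hasPar.primMul_tens hx.hasPar, hm.map_add, hm.map_smul, hx.hasPar.bracket_eq' hp.hasPar]
    simp only [mulMap_tens, cmul_sub_left, cmul_smul_left, cmul_assoc, two_smul, mul_comm a m]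
    abel
  rw [h]
  refine Submodule.neg_mem _ ?_
  refine mem_of_mem_span (A := fun p => FormalGeom.cmul p q) (by fun_prop) ?_
    (hx.bracket_mem_lieGr hp)
  rintro p ⟨_, hp⟩
  exact (hp.cmul hq).mem_lieGr

/-- `s = 2^k` on products of `k` Lie elements, modulo products of fewer Lie elements. -/
lemma LieProd.shuffleOp_sub_mem {d : I → ℤ} {k : ℕ} {n : ℤ} {p : List I → K}
    (hp : LieProd d k n p) : shuffleOp K d p - (2 ^ k : K) • p ∈ lieFil K d k := by
  induction hp with
  | one => rw [shuffleOp_one, pow_zero, one_smul, sub_self]; exact Submodule.zero_mem _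
  | @mul k _ _ x p hx hp ih =>
    have h1 := lieGr_le_lieFil d (Nat.lt_succ_self k) (hx.mulMap_primMul hp.coprod_mem)
    have h2 := Submodule.smul_mem _ (2 : K) (hx.cmul_mem_lieFil ih)
    have := Submodule.add_mem _ h1 h2
    rw [← coprod_lie_cmul hx.mem_freeLie, ← shuffleOp_apply, ← shuffleOp_apply] at this
    convert this using 1
    rw [cmul_sub_right, cmul_smul_right, pow_succ']
    module

/-- The factor `s - 2^k` lowers the filtration. -/
lemma shuffleOp_sub_mem_lieFil {d : I → ℤ} {k : ℕ} {p : List I → K}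
    (hpk : p ∈ lieFil K d (k + 1)) : shuffleOp K d p - (2 ^ k : K) • p ∈ lieFil K d k := by
  refine mem_of_mem_span (A := fun p => shuffleOp K d p - (2 ^ k : K) • p) (by fun_prop) ?_ hpk
  rintro p ⟨j, hj, n, hp⟩
  rcases (Nat.lt_succ_iff_lt_or_eq.1 hj) with h | rfl
  · have h1 := lieFil_mono d h.le hp.shuffleOp_sub_mem
    have h2 := Submodule.smul_mem _ ((2 : K) ^ j - 2 ^ k) (hp.mem_lieFil h)
    convert Submodule.add_mem _ h1 h2 using 1
    module
  · exact hp.shuffleOp_sub_mem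

/-- On combinations of `1` and Lie elements, `s - 1` is the projection to the Lie elements. -/
lemma shuffleOp_sub_one_mem {d : I → ℤ} {p : List I → K} (hp : p ∈ lieFil K d 2) :
    shuffleOp K d p - p ∈ freeLie K d := by
  refine mem_of_mem_span (A := fun p => shuffleOp K d p - p) (by fun_prop) ?_ hp
  rintro p ⟨j, hj, n, hp⟩
  cases hp with
  | one => rw [shuffleOp_one, sub_self]; exact Submodule.zero_mem _
  | @mul k _ _ x q hx hq =>
    obtain rfl : k = 0 := by omega
    cases hq with
    | one =>
      rw [cmul_one, shuffleOp_lie hx.mem_freeLie, two_smul, add_sub_cancel_right]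
      exact hx.mem_freeLie

end Filtration

/-! ### The first Hodge projection -/

section Hodge
variable {K I : Type*} [CommRing K] [TopologicalSpace K] [DiscreteTopology K] [Algebra ℚ K]

open Polynomial

lemma aeval_C_apply (d : I → ℤ) (c : ℚ) (f : List I → K) :
    aeval (shuffleOp K d) (C c) f = (algebraMap ℚ K c) • f := by
  rw [aeval_C, Module.algebraMap_end_apply, algebraMap_smul]

lemma aeval_mul_X_apply (d : I → ℤ) (p : ℚ[X]) (f : List I → K) :
    aeval (shuffleOp K d) (p * X) f = aeval (shuffleOp K d) p (shuffleOp K d f) := by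
  rw [map_mul, aeval_X, Module.End.mul_apply]

lemma aeval_shuffleOp_comm (d : I → ℤ) (p : ℚ[X]) (f : List I → K) :
    aeval (shuffleOp K d) p (shuffleOp K d f) = shuffleOp K d (aeval (shuffleOp K d) p f) := by
  rw [← aeval_mul_X_apply, mul_comm, map_mul, aeval_X, Module.End.mul_apply]

/-- Properties that are stable under linear combinations and under `s` are stable under the
polynomials in `s`. -/
lemma aeval_induction (d : I → ℤ) {P : (List I → K) → Prop} {f : List I → K} (hf : P f)
    (hadd : ∀ f g, P f → P g → P (f + g)) (hsmul : ∀ (c : ℚ) f, P f → P (algebraMap ℚ K c • f))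
    (hs : ∀ f, P f → P (shuffleOp K d f)) (p : ℚ[X]) : P (aeval (shuffleOp K d) p f) := by
  induction p using Polynomial.induction_on generalizing f with
  | C a => rw [aeval_C_apply]; exact hsmul a f hf
  | add p q ihp ihq => rw [map_add]; exact hadd _ _ (ihp hf) (ihq hf)
  | monomial n a ih =>
    rw [pow_succ, ← mul_assoc, aeval_mul_X_apply]
    exact ih (hs f hf)

lemma isCL_aeval (d : I → ℤ) (p : ℚ[X]) : IsCL K (aeval (shuffleOp K d) p) := by
  induction p using Polynomial.induction_on with
  | C a =>
    have : (aeval (shuffleOp K d) (C a) : (List I → K) → (List I → K)) =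
      fun f => (algebraMap ℚ K a) • f := funext fun f => aeval_C_apply d a f
    rw [this]; fun_prop
  | add p q ihp ihq =>
    rw [map_add]
    change IsCL K fun f => aeval (shuffleOp K d) p f + aeval (shuffleOp K d) q f
    fun_prop
  | monomial n a ih =>
    have : (aeval (shuffleOp K d) (C a * X ^ (n + 1)) : (List I → K) → (List I → K)) =
      fun f => aeval (shuffleOp K d) (C a * X ^ n) (shuffleOp K d f) := funext fun f => by
        rw [pow_succ, ← mul_assoc, aeval_mul_X_apply]
    rw [this]; fun_prop

@[fun_prop]
lemma isCL_hodgePoly (d : I → ℤ) (n j : ℕ) : IsCL K (hodgePoly K d n j) := by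
  unfold hodgePoly
  split_ifs
  · exact isCL_aeval d _
  · exact ⟨0, fun _ => rfl⟩

@[fun_prop]
lemma isCL_hodgeProj (d : I → ℤ) (j : ℕ) : IsCL K (hodgeProj K d j) := by
  refine IsCL.mk' (map_add _) (map_smul _) (continuous_pi fun w => ?_)
  obtain ⟨L, hL⟩ := isCL_hodgePoly (K := K) d w.length j
  change Continuous fun f => hodgePoly K d w.length j f w
  simp only [hL]
  fun_prop

lemma hodgeProj_apply (d : I → ℤ) (j : ℕ) (f : List I → K) (w : List I) :
    hodgeProj K d j f w = hodgePoly K d w.length j f w := rfl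

/-! #### The operator `s` preserves the order -/

lemma shufCoprod_eq_zero (d : I → ℤ) {f : List I → K} {u v : List I}
    (h : ∀ w, w.length = u.length + v.length → f w = 0) : shufCoprod d f u v = 0 := by
  match u, v with
  | [], v => simpa [shufCoprod] using h v (by simp)
  | i :: u, [] => simpa [shufCoprod] using h (i :: u) (by simp)
  | i :: u, j :: v =>
    rw [shufCoprod, shufCoprod_eq_zero d (f := fun w => f (i :: w)), shufCoprod_eq_zero d
      (f := fun w => f (j :: w)), mul_zero, add_zero]
    · intro w hw
      exact h _ (by simp only [List.length_cons] at hw ⊢; omega)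
    · intro w hw
      exact h _ (by simp only [List.length_cons] at hw ⊢; omega)
  termination_by u.length + v.length

lemma shuffleOp_eq_zero (d : I → ℤ) {n : ℕ} {f : List I → K} (h : ∀ w, w.length = n → f w = 0)
    {w : List I} (hw : w.length = n) : shuffleOp K d f w = 0 := by
  change splitSum (fun u v => shufCoprod d f u v) w = 0
  rw [splitSum_congr (G := fun _ _ => 0), splitSum_zero]
  intro u v huv
  refine shufCoprod_eq_zero d fun w' hw' => h w' ?_
  rw [hw', ← List.length_append, huv, hw]

lemma aeval_eq_zero (d : I → ℤ) {n : ℕ} {f : List I → K} (h : ∀ w, w.length = n → f w = 0)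
    (p : ℚ[X]) {w : List I} (hw : w.length = n) : aeval (shuffleOp K d) p f w = 0 := by
  refine aeval_induction d (P := fun f => ∀ w, w.length = n → f w = 0) h ?_ ?_ ?_ p w hw
  · intro f g hf hg w hw; simp [hf w hw, hg w hw]
  · intro c f hf w hw; simp [hf w hw]
  · intro f hf w hw; exact shuffleOp_eq_zero d hf hw

lemma hodgePoly_eq_zero (d : I → ℤ) {n : ℕ} {f : List I → K} (h : ∀ w, w.length = n → f w = 0)
    (m j : ℕ) {w : List I} (hw : w.length = n) : hodgePoly K d m j f w = 0 := by
  unfold hodgePoly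
  split_ifs
  · exact aeval_eq_zero d h _ hw
  · rfl

lemma hodgePoly_shuffleOp (d : I → ℤ) (n j : ℕ) (f : List I → K) :
    hodgePoly K d n j (shuffleOp K d f) = shuffleOp K d (hodgePoly K d n j f) := by
  unfold hodgePoly
  split_ifs
  · exact aeval_shuffleOp_comm d _ f
  · exact (map_zero _).symm

lemma hodgeProj_shuffleOp (d : I → ℤ) (j : ℕ) (f : List I → K) :
    hodgeProj K d j (shuffleOp K d f) = shuffleOp K d (hodgeProj K d j f) := by
  funext w
  rw [hodgeProj_apply, hodgePoly_shuffleOp, ← sub_eq_zero, ← Pi.sub_apply, ← map_sub]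
  refine shuffleOp_eq_zero d (n := w.length) (fun v hv => ?_) rfl
  rw [Pi.sub_apply, hodgeProj_apply, hv, sub_self]

lemma hodgeProj_bas (d : I → ℤ) (j : ℕ) (w : List I) :
    hodgeProj K d j (bas w) = hodgePoly K d w.length j (bas w) := by
  funext v
  rw [hodgeProj_apply]
  by_cases h : v.length = w.length
  · rw [h]
  · have : ∀ x : List I, x.length = v.length → (bas w x : K) = 0 := fun x hx =>
      bas_ne fun h' => h (by rw [← hx, h'])
    rw [hodgePoly_eq_zero d this _ _ rfl, hodgePoly_eq_zero d this _ _ rfl]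

/-! #### The image of the projection -/

lemma aeval_basisDivisor_apply (d : I → ℤ) (x : ℚ) (r : ℕ) (f : List I → K) :
    aeval (shuffleOp K d) (Lagrange.basisDivisor x (2 ^ r)) f =
      algebraMap ℚ K (x - 2 ^ r)⁻¹ • (shuffleOp K d f - (2 ^ r : K) • f) := by
  rw [Lagrange.basisDivisor, map_mul, Module.End.mul_apply, aeval_C_apply, map_sub, aeval_X,
    LinearMap.sub_apply, aeval_C_apply, map_pow, map_ofNat]

/-- The factors of index `r ≥ 2` of `e_n(1)` bring the number of Lie elements down to at most
one. -/
lemma aeval_prod_mem (d : I → ℤ) (x : ℚ) (n : ℕ) {f : List I → K} (hf : f ∈ lieFil K d (n + 2)) :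
    aeval (shuffleOp K d) (∏ r ∈ Finset.Ico 2 (n + 2), Lagrange.basisDivisor x (2 ^ r)) f ∈
      lieFil K d 2 := by
  induction n generalizing f with
  | zero => simpa using hf
  | succ n ih =>
    rw [show n + 1 + 2 = (n + 2) + 1 by ring, Finset.prod_Ico_succ_top (by omega), map_mul,
      Module.End.mul_apply]
    refine ih ?_
    rw [aeval_basisDivisor_apply]
    exact Submodule.smul_mem _ _ (shuffleOp_sub_mem_lieFil hf)

/-- The polynomial `e_n(1)`, with the factor of index `0` applied last. -/
lemma hodgePoly_one_eq (d : I → ℤ) (n : ℕ) (f : List I → K) :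
    hodgePoly K d (n + 1) 1 f = aeval (shuffleOp K d) (Lagrange.basisDivisor ((2 : ℚ) ^ 1) (2 ^ 0))
      (aeval (shuffleOp K d) (∏ r ∈ Finset.Ico 2 (n + 2),
        Lagrange.basisDivisor ((2 : ℚ) ^ 1) (2 ^ r)) f) := by
  have h : (Finset.range (n + 1 + 1)).erase 1 = insert 0 (Finset.Ico 2 (n + 2)) := by
    ext r; simp only [Finset.mem_erase, Finset.mem_range, Finset.mem_insert, Finset.mem_Ico]; omega
  rw [hodgePoly, if_pos (by omega), Lagrange.basis, h, Finset.prod_insert (by simp), map_mul,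
    Module.End.mul_apply]

/-- The image of `e(1)` is contained in the free Lie algebra: on a product of Lie elements, `s` is
triangular for the filtration by the number of factors. -/
lemma hodgeProj_one_mem (d : I → ℤ) (f : List I → K) : hodgeProj K d 1 f ∈ freeLie K d := by
  refine IsCL.mem (A := hodgeProj K d 1) (by fun_prop) isClosed_freeLie fun w _ => ?_
  rw [hodgeProj_bas]
  have hw : (bas w : List I → K) ∈ lieFil K d (w.length + 1) :=
    (lieProd_word d w).mem_lieFil (Nat.lt_succ_self _)
  rcases h : w.length with _ | n
  · rw [hodgePoly, if_neg (by omega)]; exact Submodule.zero_mem _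
  · rw [h] at hw
    rw [hodgePoly_one_eq, aeval_basisDivisor_apply, pow_zero, pow_zero, one_smul]
    exact Submodule.smul_mem _ _ (shuffleOp_sub_one_mem (aeval_prod_mem d _ n hw))

/-- Lie elements have no constant term, since `s` is `1` on constants but `2` on Lie elements. -/
lemma freeLie_nil {d : I → ℤ} {f : List I → K} (hf : f ∈ freeLie K d) : f [] = 0 := by
  have := congrFun (shuffleOp_lie hf) []
  rw [shuffleOp_apply] at this
  simpa [mulMap, splitSum_nil, coprod, shufCoprod, two_mul] using this

lemma aeval_lie {d : I → ℤ} {f : List I → K} (hf : f ∈ freeLie K d) (p : ℚ[X]) :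
    aeval (shuffleOp K d) p f = algebraMap ℚ K (p.eval 2) • f := by
  induction p using Polynomial.induction_on with
  | C a => rw [aeval_C_apply, eval_C]
  | add p q ihp ihq => rw [map_add, LinearMap.add_apply, ihp, ihq, eval_add, map_add, add_smul]
  | monomial n a ih =>
    rw [pow_succ, ← mul_assoc, aeval_mul_X_apply, shuffleOp_lie hf, map_smul, ih, smul_smul,
      eval_mul_X (p := C a * X ^ n), map_mul, map_ofNat, mul_comm]

lemma eval_basis_two {n : ℕ} (hn : 1 ≤ n) :
    (Lagrange.basis (Finset.range (n + 1)) (fun r => (2 : ℚ) ^ r) 1).eval 2 = 1 := by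
  have := Lagrange.eval_basis_self (F := ℚ) (s := Finset.range (n + 1)) (v := fun r => (2 : ℚ) ^ r)
    (i := 1) (pow_right_injective₀ (by norm_num) (by norm_num)).injOn
    (Finset.mem_range.2 (by omega))
  simpa using this

lemma hodgeProj_one_lie {d : I → ℤ} {f : List I → K} (hf : f ∈ freeLie K d) :
    hodgeProj K d 1 f = f := by
  funext w
  rw [hodgeProj_apply, hodgePoly]
  split_ifs with h
  · rw [aeval_lie hf, eval_basis_two h, map_one, one_smul]
  · obtain rfl : w = [] := List.length_eq_zero_iff.1 (by omega)
    rw [freeLie_nil hf]; rfl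

lemma image_hodgeProj_one (d : I → ℤ) :
    hodgeProj K d 1 '' {f | f [] = 0} = freeLie K d := by
  ext f
  constructor
  · rintro ⟨f, -, rfl⟩
    exact hodgeProj_one_mem d f
  · exact fun hf => ⟨f, freeLie_nil hf, hodgeProj_one_lie hf⟩

/-- A word is the sum of its projection and of an element of the image of `s - 2`, because the
polynomial `1 - e_n(1)` in `s` vanishes at `2`. -/
lemma exists_shuffleOp_sub (d : I → ℤ) (w : List I) : ∃ u : List I → K,
    bas w = hodgeProj K d 1 (bas w) + (shuffleOp K d u - (2 : K) • u) := by
  rw [hodgeProj_bas, hodgePoly]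
  split_ifs with h
  · obtain ⟨q, hq⟩ := (dvd_iff_isRoot (p := Lagrange.basis (Finset.range (w.length + 1))
      (fun r => (2 : ℚ) ^ r) 1 - 1) (a := 2)).2 (by simp [IsRoot, eval_basis_two h])
    refine ⟨-aeval (shuffleOp K d) q (bas w), ?_⟩
    rw [sub_eq_iff_eq_add] at hq
    rw [hq, map_add, map_mul, map_sub, aeval_X, map_one, LinearMap.add_apply, Module.End.mul_apply,
      LinearMap.sub_apply, aeval_C_apply, map_neg, Module.End.one_apply, map_ofNat]
    module
  · obtain rfl : w = [] := List.length_eq_zero_iff.1 (by omega)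
    refine ⟨-one, ?_⟩
    rw [map_neg, shuffleOp_one, ← one_eq_bas, LinearMap.zero_apply]
    module

lemma hodgeProj_one_shuffleOp_sub (d : I → ℤ) (u : List I → K) :
    hodgeProj K d 1 (shuffleOp K d u - (2 : K) • u) = 0 := by
  rw [map_sub, map_smul, hodgeProj_shuffleOp, shuffleOp_lie (hodgeProj_one_mem d u), sub_self]

/-- Operators that commute with `s` and preserve the free Lie algebra commute with `e(1)`. -/
lemma hodgeProj_one_comm {d : I → ℤ} {D : (List I → K) → (List I → K)} (hD : IsCL K D)
    (hs : ∀ f, shuffleOp K d (D f) = D (shuffleOp K d f))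
    (hL : ∀ f ∈ freeLie K d, D f ∈ freeLie K d) (f : List I → K) :
    hodgeProj K d 1 (D f) = D (hodgeProj K d 1 f) := by
  refine IsCL.eq (A := fun f => hodgeProj K d 1 (D f)) (B := fun f => D (hodgeProj K d 1 f))
    (by fun_prop) (by fun_prop) fun w _ => ?_
  obtain ⟨u, hu⟩ := exists_shuffleOp_sub (K := K) d w
  have h1 : D (bas w) = D (hodgeProj K d 1 (bas w)) +
      (shuffleOp K d (D u) - (2 : K) • D u) := by
    rw [hs, ← hD.map_smul, ← hD.map_sub, ← hD.map_add, ← hu]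
  rw [h1, map_add, hodgeProj_one_shuffleOp_sub, add_zero,
    hodgeProj_one_lie (hL _ (hodgeProj_one_mem d _))]

/-! #### Degrees -/

/-- Homogeneous components are stable under rational scalars: the projections onto them are
additive, hence `ℚ`-linear. -/
lemma rat_smul_mem {𝒦 : ℤ → AddSubgroup K} [GradedRing 𝒦] {n : ℤ} {x : K} (hx : x ∈ 𝒦 n) (c : ℚ) :
    algebraMap ℚ K c * x ∈ 𝒦 n := by
  have h := map_rat_smul (GradedRing.proj 𝒦 n) c x
  rw [GradedRing.proj_apply, GradedRing.proj_apply, DirectSum.decompose_of_mem_same 𝒦 hx] at h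
  rw [← Algebra.smul_def, ← h]
  exact SetLike.coe_mem _

lemma shufCoprod_homog {𝒦 : ℤ → AddSubgroup K} {d : I → ℤ} {n : ℤ} {f : List I → K}
    (hf : f ∈ homog 𝒦 (wdeg d) n) (u v : List I) :
    shufCoprod d f u v ∈ 𝒦 (n - (wdeg d u + wdeg d v)) := by
  match u, v with
  | [], v => simpa [shufCoprod, wdeg_nil] using hf v
  | i :: u, [] => simpa [shufCoprod, wdeg_nil] using hf (i :: u)
  | i :: u, j :: v =>
    have h : ∀ i, (fun w => f (i :: w)) ∈ homog 𝒦 (wdeg d) (n - d i) := fun i w => by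
      have := hf (i :: w)
      rwa [wdeg_cons, ← sub_sub] at this
    have h1 := shufCoprod_homog (h i) u (j :: v)
    have h2 := smul_sgn_mem (K := K) _ (d j * wdeg d (i :: u)) (shufCoprod_homog (h j) (i :: u) v)
    rw [shufCoprod]
    refine AddSubgroup.add_mem _ ?_ ?_
    · convert h1 using 2
      simp only [wdeg_cons]; ring
    · rw [smul_eq_mul] at h2
      convert h2 using 2
      simp only [wdeg_cons]; ring
  termination_by u.length + v.length

lemma shuffleOp_homog {𝒦 : ℤ → AddSubgroup K} {d : I → ℤ} {n : ℤ} {f : List I → K}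
    (hf : f ∈ homog 𝒦 (wdeg d) n) : shuffleOp K d f ∈ homog 𝒦 (wdeg d) n := by
  intro w
  change splitSum (fun u v => shufCoprod d f u v) w ∈ 𝒦 _
  rw [splitSum]
  refine AddSubgroup.sum_mem (𝒦 _) fun k _ => ?_
  have := shufCoprod_homog hf (w.take k) (w.drop k)
  rwa [← wdeg_append, List.take_append_drop] at this

lemma hodgeProj_homog {𝒦 : ℤ → AddSubgroup K} [GradedRing 𝒦] {d : I → ℤ} {n : ℤ} (j : ℕ)
    {f : List I → K} (hf : f ∈ homog 𝒦 (wdeg d) n) :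
    hodgeProj K d j f ∈ homog 𝒦 (wdeg d) n := by
  intro w
  rw [hodgeProj_apply, hodgePoly]
  split_ifs
  · exact aeval_induction d (P := fun f => f ∈ homog 𝒦 (wdeg d) n) hf
      (fun _ _ => AddSubgroup.add_mem _) (fun c f hf w => rat_smul_mem (hf w) c)
      (fun f hf => shuffleOp_homog hf) _ w
  · exact AddSubgroup.zero_mem _

end Hodge

/-! ### Odd vector fields and their Lie derivatives -/

section OddField
variable {K I : Type*} [CommRing K] [TopologicalSpace K] [DiscreteTopology K]
  {d : I → ℤ} {M : (List I → K) →L[K] (List I → K)}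

lemma HasPar.parityOp_eq {n : ℤ} {f : List I → K} (hf : HasPar (wdeg d) n f) :
    parityOp d f = sgn K n • f := by
  funext w
  have := hf.sgn_mul 1 w
  rwa [one_mul, one_mul] at this

lemma assLieDer_tens (x y : List I → K) :
    assLieDer d M (tens x y) = tens (M x) y - tens (parityOp d x) (M y) := by
  funext ⟨p, q⟩
  have h1 : (fun u => tens x y (u, q)) = y q • x := by
    funext u; simp [tens, mul_comm]
  have h2 : (fun v => tens x y (p, v)) = x p • y := by
    funext v; simp [tens]
  rw [assLieDer_apply]
  dsimp only
  rw [h1, h2, map_smul, map_smul]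
  simp only [tens, parityOp, Pi.sub_apply, Pi.smul_apply, smul_eq_mul]
  ring

variable {𝒦 : ℤ → AddSubgroup K} [GradedRing 𝒦] [EvenlyGraded 𝒦]

lemma IsOddField.letter_homog (hM : IsOddField 𝒦 d M) (i : I) :
    M (bas [i]) ∈ FormalGeom.homog 𝒦 (wdeg d) (d i + 1) :=
  hM.homog _ _ (LieMon.letter i).homog

lemma IsOddField.letter_cmul (hM : IsOddField 𝒦 d M) (i : I) (f : List I → K) :
    M (cmul (bas [i]) f) = cmul (M (bas [i])) f + sgn K (d i) • cmul (bas [i]) (M f) := by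
  rw [hM.cmul_eq, (LieMon.letter i).hasPar.parityOp_eq, cmul_smul_left]

lemma IsOddField.isLieDer (hM : IsOddField 𝒦 d M) : IsLieDer d 1 M where
  isCL := by fun_prop
  map_one := hM.map_one
  letter_cmul i f := by rw [hM.letter_cmul, one_mul]
  lie i := hM.lie _ (LieMon.letter i).mem_freeLie
  par i := by
    rw [add_comm]
    exact .of_homog (hM.letter_homog i)

/-- The square of an odd vector field is a vector field, hence it vanishes as soon as it vanishes
on the letters. -/
lemma IsOddField.sq_eq_zero (hM : IsOddField 𝒦 d M) (h : ∀ i, M (M (bas [i])) = 0)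
    (f : List I → K) : M (M f) = 0 := by
  refine IsCL.eq_zero (A := fun f => M (M f)) (by fun_prop) fun w hw => ?_
  clear hw
  induction w with
  | nil => rw [← one_eq_bas, hM.map_one, map_zero]
  | cons i w ih =>
    have h0 : cmul (bas [i]) (0 : List I → K) = 0 := by
      simpa using cmul_smul_right (0 : K) (bas [i]) 0
    rw [bas_cons_eq, hM.letter_cmul, map_add, map_smul, hM.letter_cmul, hM.cmul_eq, h i, ih,
      cmul_zero_left, (HasPar.of_homog (hM.letter_homog i)).parityOp_eq, sgn_add, sgn_one,
      cmul_smul_left, h0]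
    module

lemma CInfinityStructure.ext_ext {vdeg : I → ℤ} (m : CInfinityStructure 𝒦 vdeg) (f : List I → K) :
    m.ext (m.ext f) = 0 := by
  refine m.isOddField.sq_eq_zero (fun i => ?_) f
  have h := m.ext_eq ⟨bas [i], bas_letter_mem _ i⟩
  dsimp only at h
  rw [h, m.ext_eq, m.sq_zero]
  rfl

lemma IsOddField.assLieDer_sq (hM : IsOddField 𝒦 d M) (h : ∀ f, M (M f) = 0)
    (F : List I × List I → K) : assLieDer d M (assLieDer d M F) = 0 := by
  refine IsCL.eq_zero (A := fun F => assLieDer d M (assLieDer d M F)) (by fun_prop) fun p _ => ?_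
  rw [bas_prod, assLieDer_tens, map_sub, assLieDer_tens, assLieDer_tens, h, h, hM.parity]
  funext p
  simp [tens]

lemma IsOddField.lieLieDer_sq (hM : IsOddField 𝒦 d M) (h : ∀ f, M (M f) = 0)
    (F : List I × List I × List I → K) : lieLieDer d M (lieLieDer d M F) = 0 := by
  refine IsCL.eq_zero (A := fun F => lieLieDer d M (lieLieDer d M F)) (by fun_prop) fun p _ => ?_
  rw [bas_prod, show p.2 = (p.2.1, p.2.2) from rfl, bas_prod]
  simp only [map_sub, lieLieDer_tens, h, hM.parity, parityOp_parityOp]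
  funext p
  simp [tens]
  ring

lemma lieLieDer_homog (hM : IsOddField 𝒦 d M) {n : ℤ} {F : List I × List I × List I → K}
    (hF : F ∈ homog 𝒦 (fun p => wdeg d p.1 + wdeg d p.2.1 + wdeg d p.2.2) n) :
    lieLieDer d M F ∈ homog 𝒦 (fun p => wdeg d p.1 + wdeg d p.2.1 + wdeg d p.2.2) (n + 1) := by
  intro ⟨p, q, r⟩
  change M (fun u => F (u, q, r)) p - sgn K (wdeg d p) • M (fun v => F (p, v, r)) q -
    sgn K (wdeg d p + wdeg d q) • M (fun w => F (p, q, w)) r ∈ 𝒦 (n + 1 -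
      (wdeg d p + wdeg d q + wdeg d r))
  have h1 : (fun u => F (u, q, r)) ∈ homog 𝒦 (wdeg d) (n - wdeg d q - wdeg d r) := fun u => by
    convert hF (u, q, r) using 2
    ring
  have h2 : (fun v => F (p, v, r)) ∈ homog 𝒦 (wdeg d) (n - wdeg d p - wdeg d r) := fun v => by
    convert hF (p, v, r) using 2
    ring
  have h3 : (fun w => F (p, q, w)) ∈ homog 𝒦 (wdeg d) (n - wdeg d p - wdeg d q) := fun w => by
    convert hF (p, q, w) using 2
    ring
  refine AddSubgroup.sub_mem _ (AddSubgroup.sub_mem _ ?_ (smul_sgn_mem _ _ ?_))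
    (smul_sgn_mem _ _ ?_)
  · convert hM.homog _ _ h1 p using 2
    ring
  · convert hM.homog _ _ h2 q using 2
    ring
  · convert hM.homog _ _ h3 r using 2
    ring

/-- The Lie derivative on `W ⊗ T̂W`, under its identification `Θ` with the associative one-forms
modulo graded commutators. -/
noncomputable def headDer (d : I → ℤ) (M : (List I → K) →L[K] (List I → K)) (F : I × List I → K) :
    I × List I → K := formCyc K d (assLieDer d M (thetaForm d F))

@[fun_prop]
lemma isCL_headDer : IsCL K (headDer d M) := by
  change IsCL K fun F => formCyc K d (assLieDer d M (thetaForm d F))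
  fun_prop

lemma headDer_tens (hM : IsOddField 𝒦 d M) (i : I) (z : List I → K) :
    headDer d M (tens (bas i) z) =
      -cyc K d (tens (M (bas [i])) z) - sgn K (d i) • tens (bas i) (M z) := by
  have h1 : (fun p => sgn K (formDeg d p) * (tens one (bas [i]) : List I × List I → K) p) =
      -sgn K (d i) • tens one (bas [i]) := by
    funext p
    by_cases hp : (tens one (bas [i]) : List I × List I → K) p = 0
    · simp [hp]
    · obtain rfl : p = ([], [i]) := by
        rw [one_eq_bas, tens_bas] at hp
        exact eq_of_bas_ne_zero hp
      simp [formDeg, wdeg_nil, wdeg_letter, sgn_add, sgn_one]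
  have h2 : assLieDer d M (tens one (bas [i])) = -tens one (M (bas [i])) := by
    rw [assLieDer_tens, hM.map_one, (hasPar_one d).parityOp_eq, sgn_zero, one_smul]
    funext p
    simp [tens]
  have h3 : IsCL K fun ω => formRight d ω z := by fun_prop
  rw [headDer, thetaForm_tens, assLieDer_formRight hM, h1, h2, formRight_smul, map_add, map_smul,
    ← neg_one_smul K, formRight_smul, map_smul, formCyc_formRight_one, formCyc_formRight_one,
    cyc_letter]
  module

lemma lam_lieLieDer_emb (hM : IsOddField 𝒦 d M) (F : I × List I → K) :
    lam K d (lieLieDer d M (emb K F)) = headDer d M F := by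
  refine IsCL.eq (A := fun F => lam K d (lieLieDer d M (emb K F))) (B := headDer d M)
    (by fun_prop) (by fun_prop) fun p _ => ?_
  obtain ⟨i, w⟩ := p
  have h0 : ∀ y : List I × List I → K, tens (0 : List I → K) y = 0 := fun y => by
    funext p; simp [tens]
  rw [bas_prod, emb_tens, lieLieDer_tens, hM.map_one, (hasPar_one d).parityOp_eq, sgn_zero,
    one_smul, (LieMon.letter i).hasPar.parityOp_eq, h0, zero_sub, map_sub, map_neg, lam_one,
    lam_one, tens_smul_left, map_smul, cyc_letter, headDer_tens hM]

/-- The Lie derivative of Lie one-forms is the one of the corresponding elements of `W ⊗ T̂W`. -/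
lemma lam_lieLieDer (hM : IsOddField 𝒦 d M) {F : List I × List I × List I → K}
    (hF : F ∈ lieTens K d) : lam K d (lieLieDer d M F) = headDer d M (lam K d F) := by
  have h := lam_eq_zero 𝒦 (lieLieDer_lieRel hM (sub_emb_lam_mem 𝒦 hF))
  rw [map_sub, map_sub, sub_eq_zero] at h
  rw [h, lam_lieLieDer_emb hM]

end OddField

/-! ### The Hodge projection on one-forms -/

section HodgeTilde
variable {K I : Type*} [CommRing K] [TopologicalSpace K] [DiscreteTopology K] [Algebra ℚ K]

lemma hodgeProjTilde_apply (d : I → ℤ) (j : ℕ) (F : I × List I → K) (i : I) :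
    (fun w => hodgeProjTilde K d j F (i, w)) = hodgeProj K d j fun w => F (i, w) := rfl

@[fun_prop]
lemma isCL_hodgeProjTilde (d : I → ℤ) (j : ℕ) : IsCL K (hodgeProjTilde K d j) := by
  refine IsCL.mk' (map_add _) (map_smul _) (continuous_pi fun p => ?_)
  obtain ⟨L, hL⟩ := isCL_hodgeProj (K := K) d j
  change Continuous fun F : I × List I → K => hodgeProj K d j (fun w => F (p.1, w)) p.2
  simp only [hL]
  fun_prop

lemma hodgeProjTilde_tens (d : I → ℤ) (j : ℕ) (f : I → K) (z : List I → K) :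
    hodgeProjTilde K d j (tens f z) = tens f (hodgeProj K d j z) := by
  funext ⟨i, w⟩
  have : (fun w => tens f z (i, w)) = f i • z := rfl
  change hodgeProj K d j (fun w => tens f z (i, w)) w = _
  rw [this, map_smul]
  rfl

lemma hodgeProjTilde_one_mem (d : I → ℤ) (F : I × List I → K) :
    hodgeProjTilde K d 1 F ∈ headLie K d := fun i => by
  rw [hodgeProjTilde_apply]; exact hodgeProj_one_mem d _

lemma hodgeProjTilde_one_eq {d : I → ℤ} {F : I × List I → K} (hF : F ∈ headLie K d) :
    hodgeProjTilde K d 1 F = F := by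
  funext ⟨i, w⟩
  exact congrFun (hodgeProj_one_lie (hF i)) w

lemma hodgeProjTilde_homog {𝒦 : ℤ → AddSubgroup K} [GradedRing 𝒦] {d : I → ℤ} {n : ℤ} (j : ℕ)
    {F : I × List I → K} (hF : F ∈ homog 𝒦 (headDeg d) n) :
    hodgeProjTilde K d j F ∈ homog 𝒦 (headDeg d) n := by
  rintro ⟨i, w⟩
  have h : (fun w => F (i, w)) ∈ homog 𝒦 (wdeg d) (n - d i) := fun w => by
    convert hF (i, w) using 2
    simp only [headDeg]; ring
  change hodgeProj K d j (fun w => F (i, w)) w ∈ 𝒦 _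
  convert hodgeProj_homog j h w using 2
  simp only [headDeg]; ring

/-- `e(1)` commutes with the adjoint action of the free Lie algebra. -/
lemma LieMon.hodgeProj_one_bracket {d : I → ℤ} {n : ℤ} {y : List I → K} (hy : LieMon d n y)
    (z : List I → K) :
    hodgeProj K d 1 (FormalGeom.bracket d y z) = FormalGeom.bracket d y (hodgeProj K d 1 z) :=
  hodgeProj_one_comm (D := FormalGeom.bracket d y) hy.isLieDer.isCL hy.isLieDer.shuffleOp_comm
    (fun _ hf => bracket_mem_freeLie hy.mem_freeLie hf) z

/-- The projection of `da · z` is `da · e(1) z`, for every Lie element `a`. -/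
lemma hodgeProjTilde_one_cyc {d : I → ℤ} {a : List I → K} (ha : a ∈ freeLie K d)
    (z : List I → K) : hodgeProjTilde K d 1 (cyc K d (tens a z)) =
      cyc K d (tens a (hodgeProj K d 1 z)) := by
  refine IsCL.eq_of_lieMon (A := fun a => hodgeProjTilde K d 1 (cyc K d (tens a z)))
    (B := fun a => cyc K d (tens a (hodgeProj K d 1 z))) (by fun_prop) (by fun_prop)
    (fun n a ha => ?_) ha
  induction ha generalizing z with
  | letter i => rw [cyc_letter, cyc_letter, hodgeProjTilde_tens]
  | bracket hb hc ihb ihc =>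
    rw [cyc_bracket hb.hasPar hc.hasPar, cyc_bracket hb.hasPar hc.hasPar, map_sub, map_smul,
      ihb, ihc, hb.hodgeProj_one_bracket, hc.hodgeProj_one_bracket]

/-- The Lie derivative along a vector field that preserves the free Lie algebra commutes with the
Hodge projection. -/
lemma hodgeProjTilde_one_headDer {𝒦 : ℤ → AddSubgroup K} [GradedRing 𝒦] [EvenlyGraded 𝒦]
    {d : I → ℤ} {M : (List I → K) →L[K] (List I → K)} (hM : IsOddField 𝒦 d M)
    (F : I × List I → K) :
    hodgeProjTilde K d 1 (headDer d M F) = headDer d M (hodgeProjTilde K d 1 F) := by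
  refine IsCL.eq (A := fun F => hodgeProjTilde K d 1 (headDer d M F))
    (B := fun F => headDer d M (hodgeProjTilde K d 1 F)) (by fun_prop) (by fun_prop) fun p _ => ?_
  obtain ⟨i, w⟩ := p
  rw [bas_prod, hodgeProjTilde_tens, headDer_tens hM, headDer_tens hM, map_sub, map_neg, map_smul,
    hodgeProjTilde_one_cyc (hM.lie _ (bas_letter_mem d i)), hodgeProjTilde_tens,
    hodgeProj_one_comm (D := M) (by fun_prop) hM.isLieDer.shuffleOp_comm hM.lie]

end HodgeTilde

/-! ### The map from Lie to associative one-forms and its splitting -/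

section LieToAss
variable {K I : Type*} [CommRing K] [TopologicalSpace K] [DiscreteTopology K]
  (𝒦 : ℤ → AddSubgroup K) [GradedRing 𝒦] [EvenlyGraded 𝒦] (d : I → ℤ)

/-- The map `l` from Lie to associative one-forms, as `Θ ∘ lam`. -/
noncomputable def lieToAss : DR1Lie 𝒦 d →L[K] DR1Ass 𝒦 d :=
  Submodule.liftQL _ ((thetaL 𝒦 d).comp ((lam K d).comp (lieTens K d).subtypeL)) fun F hF => by
    change theta 𝒦 d (lam K d F) = 0
    rw [show lam K d F = 0 from lam_eq_zero 𝒦 hF, map_zero]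

lemma lieToAss_mk (F : lieTens K d) :
    lieToAss 𝒦 d (Submodule.Quotient.mk F) = theta 𝒦 d (lam K d F) := rfl

lemma isLieToAss_lieToAss : IsLieToAss 𝒦 d (lieToAss 𝒦 d) := by
  intro gs k a z hgs _ ha' _ F hF
  rw [lieToAss_mk, hF, lam_listProd (.of_homog ha') gs
    fun g hg => ⟨(hgs g hg).1, .of_homog (hgs g hg).2⟩]
  exact theta_thetaInv 𝒦 d (Submodule.Quotient.mk _)

lemma lieToAss_homog {n : ℤ} {x : DR1Lie 𝒦 d} (hx : x ∈ harrCochains 𝒦 d n) :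
    lieToAss 𝒦 d x ∈ hochCochains 𝒦 d n := by
  obtain ⟨F, hF, rfl⟩ := hx
  exact theta_homog 𝒦 (lam_homog hF)

variable [Algebra ℚ K]

/-- The map `W ⊗ T̂W → DR¹_Lie` that sends `x ⊗ z` to `dx ⊗ e(1) z`.  The projection `e(1)` brings
`z` into `L̂W`. -/
noncomputable def headForm : (I × List I → K) →L[K] DR1Lie 𝒦 d :=
  (Submodule.mkQL _).comp (((emb K).comp ⟨hodgeProjTilde K d 1, by
    obtain ⟨L, hL⟩ := isCL_hodgeProjTilde (K := K) d 1
    change Continuous fun F => hodgeProjTilde K d 1 F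
    simp only [hL]
    exact L.continuous⟩).codRestrict (lieTens K d)
      fun F => emb_mem_lieTens (hodgeProjTilde_one_mem d F))

lemma headForm_eq (F : I × List I → K) : headForm 𝒦 d F = Submodule.Quotient.mk
    ⟨emb K (hodgeProjTilde K d 1 F), emb_mem_lieTens (hodgeProjTilde_one_mem d F)⟩ := rfl

lemma headForm_lam (F : lieTens K d) :
    headForm 𝒦 d (lam K d F) = Submodule.Quotient.mk F := by
  rw [headForm_eq, eq_comm, Submodule.Quotient.eq]
  change (F : List I × List I × List I → K) - emb K (hodgeProjTilde K d 1 (lam K d F)) ∈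
    lieRel 𝒦 d
  rw [hodgeProjTilde_one_eq (lam_mem_headLie F.2)]
  exact sub_emb_lam_mem 𝒦 F.2

lemma headForm_surjective : Function.Surjective (headForm (K := K) 𝒦 d) := fun x => by
  obtain ⟨F, rfl⟩ := Submodule.Quotient.mk_surjective _ x
  exact ⟨_, headForm_lam 𝒦 d F⟩

lemma lieToAss_headForm (F : I × List I → K) :
    lieToAss 𝒦 d (headForm 𝒦 d F) = theta 𝒦 d (hodgeProjTilde K d 1 F) := by
  rw [headForm_eq, lieToAss_mk, lam_emb]

/-- `DR¹_Lie` is topologically generated by the forms `dt_i ⊗ z`, on which `l` is prescribed. -/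
lemma isLieToAss_unique {l l' : DR1Lie 𝒦 d →L[K] DR1Ass 𝒦 d} (hl : IsLieToAss 𝒦 d l)
    (hl' : IsLieToAss 𝒦 d l') : l' = l := by
  ext x
  obtain ⟨F, rfl⟩ := headForm_surjective 𝒦 d x
  have h : ∀ l : DR1Lie 𝒦 d →L[K] DR1Ass 𝒦 d, IsCL K fun F =>
      thetaInv 𝒦 d (l (headForm 𝒦 d F)) := fun l =>
    ⟨(thetaInv 𝒦 d).comp (l.comp (headForm 𝒦 d)), fun _ => rfl⟩
  have key : thetaInv 𝒦 d (l' (headForm 𝒦 d F)) = thetaInv 𝒦 d (l (headForm 𝒦 d F)) := by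
    refine IsCL.eq (h l') (h l) fun p _ => ?_
    obtain ⟨i, w⟩ := p
    have hF : emb K (hodgeProjTilde K d 1 (bas (i, w))) =
        tens (listProd []) (tens (bas [i]) (hodgeProj K d 1 (bas w))) := by
      rw [bas_prod, hodgeProjTilde_tens, emb_tens]; rfl
    have hz := hodgeProj_one_mem (K := K) d (bas w)
    have hi : (bas [i] : List I → K) ∈ homog 𝒦 (wdeg d) (d i) := (LieMon.letter i).homog
    rw [headForm_eq, hl' [] (d i) _ _ (by simp) (bas_letter_mem d i) hi hz _ hF,
      hl [] (d i) _ _ (by simp) (bas_letter_mem d i) hi hz _ hF]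
  rw [← theta_thetaInv 𝒦 d (l' _), key, theta_thetaInv]

/-- The retraction `dx · z ↦ dx ⊗ e(1) z` of the Hochschild onto the Harrison complex. -/
noncomputable def assToLie : DR1Ass 𝒦 d →L[K] DR1Lie 𝒦 d := (headForm 𝒦 d).comp (thetaInv 𝒦 d)

lemma assToLie_theta (F : I × List I → K) : assToLie 𝒦 d (theta 𝒦 d F) = headForm 𝒦 d F := by
  rw [assToLie, ContinuousLinearMap.comp_apply, thetaInv_theta]

lemma assToLie_lieToAss (x : DR1Lie 𝒦 d) : assToLie 𝒦 d (lieToAss 𝒦 d x) = x := by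
  obtain ⟨F, rfl⟩ := Submodule.Quotient.mk_surjective _ x
  rw [lieToAss_mk, assToLie_theta, headForm_lam]

lemma assToLie_homog {n : ℤ} {x : DR1Ass 𝒦 d} (hx : x ∈ hochCochains 𝒦 d n) :
    assToLie 𝒦 d x ∈ harrCochains 𝒦 d n :=
  ⟨⟨emb K (hodgeProjTilde K d 1 (thetaInv 𝒦 d x)), emb_mem_lieTens (hodgeProjTilde_one_mem d _)⟩,
    emb_homog (hodgeProjTilde_homog 1 (thetaInv_homog 𝒦 hx)), rfl⟩

lemma lieToAss_mem (x : DR1Lie 𝒦 d) : lieToAss 𝒦 d x ∈ hodgeSummand 𝒦 d 1 := by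
  obtain ⟨F, rfl⟩ := headForm_surjective 𝒦 d x
  rw [lieToAss_headForm]
  exact ⟨_, ⟨F, rfl⟩, rfl⟩

lemma lieToAss_assToLie {y : DR1Ass 𝒦 d} (hy : y ∈ hodgeSummand 𝒦 d 1) :
    lieToAss 𝒦 d (assToLie 𝒦 d y) = y := by
  obtain ⟨_, ⟨F, rfl⟩, rfl⟩ := hy
  rw [assToLie_theta, lieToAss_headForm, hodgeProjTilde_one_eq (hodgeProjTilde_one_mem d F)]

/-- The isomorphism of the Lie one-forms with the first Hodge summand. -/
noncomputable def lieEquivHodge : DR1Lie 𝒦 d ≃L[K] hodgeSummand 𝒦 d 1 :=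
  ContinuousLinearEquiv.equivOfInverse ((lieToAss 𝒦 d).codRestrict _ (lieToAss_mem 𝒦 d))
    ((assToLie 𝒦 d).comp (hodgeSummand 𝒦 d 1).subtypeL) (assToLie_lieToAss 𝒦 d)
    fun y => Subtype.ext (lieToAss_assToLie 𝒦 d y.2)

lemma coe_lieEquivHodge (x : DR1Lie 𝒦 d) :
    (lieEquivHodge 𝒦 d x : DR1Ass 𝒦 d) = lieToAss 𝒦 d x := rfl

end LieToAss

/-! ### Compatibility with the differentials -/

section Differentials
variable {K I : Type*} [CommRing K] [TopologicalSpace K] [DiscreteTopology K]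
  {𝒦 : ℤ → AddSubgroup K} [GradedRing 𝒦] [EvenlyGraded 𝒦] {vdeg : I → ℤ}
  (m : CInfinityStructure 𝒦 vdeg)

lemma isDifferential_lieDiff :
    IsDifferential (harrCochains 𝒦 (suspDualDeg vdeg)) (lieDiff m) := by
  refine ⟨fun x => ?_, fun n x hx => ?_⟩
  · obtain ⟨F, rfl⟩ := Submodule.Quotient.mk_surjective _ x
    change Submodule.Quotient.mk (lieTensDer m (lieTensDer m F)) = _
    have : lieTensDer m (lieTensDer m F) = 0 :=
      Subtype.ext (m.isOddField.lieLieDer_sq m.ext_ext F)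
    rw [this, Submodule.Quotient.mk_zero]
  · obtain ⟨F, hF, rfl⟩ := hx
    refine ⟨lieTensDer m F, ?_, rfl⟩
    have := lieLieDer_homog m.isOddField hF
    exact this

lemma isDifferential_assDiff :
    IsDifferential (hochCochains 𝒦 (suspDualDeg vdeg)) (assDiff m) := by
  refine ⟨fun x => ?_, fun n x hx => ?_⟩
  · obtain ⟨F, rfl⟩ := Submodule.Quotient.mk_surjective _ x
    change Submodule.Quotient.mk (assLieDer _ m.ext (assLieDer _ m.ext F)) = _
    rw [m.isOddField.assLieDer_sq m.ext_ext, Submodule.Quotient.mk_zero]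
  · obtain ⟨F, hF, rfl⟩ := hx
    refine ⟨assLieDer (suspDualDeg vdeg) m.ext F, ?_, rfl⟩
    have := assLieDer_homog m.isOddField hF
    rwa [add_right_comm] at this

lemma assDiff_theta (F : I × List I → K) : assDiff m (theta 𝒦 (suspDualDeg vdeg) F) =
    theta 𝒦 (suspDualDeg vdeg) (headDer (suspDualDeg vdeg) m.ext F) :=
  (theta_thetaInv 𝒦 _ (Submodule.Quotient.mk (assLieDer _ m.ext (thetaForm _ F)))).symm

lemma lieToAss_lieDiff (x : DR1Lie 𝒦 (suspDualDeg vdeg)) :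
    lieToAss 𝒦 _ (lieDiff m x) = assDiff m (lieToAss 𝒦 _ x) := by
  obtain ⟨F, rfl⟩ := Submodule.Quotient.mk_surjective _ x
  rw [lieToAss_mk, assDiff_theta, ← lam_lieLieDer m.isOddField F.2]
  rfl

variable [Algebra ℚ K]

lemma assDiff_mem_hodgeSummand {x : DR1Ass 𝒦 (suspDualDeg vdeg)}
    (hx : x ∈ hodgeSummand 𝒦 (suspDualDeg vdeg) 1) :
    assDiff m x ∈ hodgeSummand 𝒦 (suspDualDeg vdeg) 1 := by
  obtain ⟨_, ⟨F, rfl⟩, rfl⟩ := hx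
  rw [assDiff_theta, ← hodgeProjTilde_one_headDer m.isOddField]
  exact ⟨_, ⟨_, rfl⟩, rfl⟩

lemma assToLie_assDiff (x : DR1Ass 𝒦 (suspDualDeg vdeg)) :
    assToLie 𝒦 _ (assDiff m x) = lieDiff m (assToLie 𝒦 _ x) := by
  obtain ⟨F, rfl⟩ := (theta_bijective 𝒦 _).2 x
  have hl : Function.Injective (lieToAss (K := K) 𝒦 (suspDualDeg vdeg)) :=
    Function.LeftInverse.injective (assToLie_lieToAss 𝒦 _)
  apply hl
  rw [lieToAss_lieDiff, assDiff_theta, assToLie_theta, assToLie_theta, lieToAss_headForm,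
    lieToAss_headForm, assDiff_theta, hodgeProjTilde_one_headDer m.isOddField]

end Differentials

end FormalGeom

theorem mainTheorem5 {K : Type*} [CommRing K] [Algebra ℚ K] [TopologicalSpace K]
    [DiscreteTopology K] (𝒦 : ℤ → AddSubgroup K) [GradedRing 𝒦] [EvenlyGraded 𝒦]
    {I : Type*} (vdeg : I → ℤ) (m : CInfinityStructure 𝒦 vdeg) :
    -- the key identity
    hodgeProj K (suspDualDeg vdeg) 1 '' {f | f [] = 0} = freeLie K (suspDualDeg vdeg) ∧
    -- the two complexes, and the Hodge summand as a subcomplex of the second one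
    IsDifferential (harrCochains 𝒦 (suspDualDeg vdeg)) (lieDiff m) ∧
    IsDifferential (hochCochains 𝒦 (suspDualDeg vdeg)) (assDiff m) ∧
    Function.Bijective (theta 𝒦 (suspDualDeg vdeg)) ∧
    (∀ x ∈ hodgeSummand 𝒦 (suspDualDeg vdeg) 1,
      assDiff m x ∈ hodgeSummand 𝒦 (suspDualDeg vdeg) 1) ∧
    -- the map `l`, which exists and is unique
    ∃ l : DR1Lie 𝒦 (suspDualDeg vdeg) →L[K] DR1Ass 𝒦 (suspDualDeg vdeg),
      IsLieToAss 𝒦 (suspDualDeg vdeg) l ∧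
      (∀ l', IsLieToAss 𝒦 (suspDualDeg vdeg) l' → l' = l) ∧
      (∀ x, l (lieDiff m x) = assDiff m (l x)) ∧
      (∀ n, ∀ x ∈ harrCochains 𝒦 (suspDualDeg vdeg) n,
        l x ∈ hochCochains 𝒦 (suspDualDeg vdeg) n) ∧
      -- it is an isomorphism of complexes onto the Hodge summand
      (∃ φ : DR1Lie 𝒦 (suspDualDeg vdeg) ≃L[K] hodgeSummand 𝒦 (suspDualDeg vdeg) 1,
        (∀ x, (φ x : DR1Ass 𝒦 (suspDualDeg vdeg)) = l x) ∧
        ∀ n x, (φ x : DR1Ass 𝒦 (suspDualDeg vdeg)) ∈ hochCochains 𝒦 (suspDualDeg vdeg) n ↔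
          x ∈ harrCochains 𝒦 (suspDualDeg vdeg) n) ∧
      -- it is split as a map of complexes
      ∃ r : DR1Ass 𝒦 (suspDualDeg vdeg) →L[K] DR1Lie 𝒦 (suspDualDeg vdeg),
        (∀ x, r (l x) = x) ∧
        (∀ x, r (assDiff m x) = lieDiff m (r x)) ∧
        ∀ n, ∀ x ∈ hochCochains 𝒦 (suspDualDeg vdeg) n,
          r x ∈ harrCochains 𝒦 (suspDualDeg vdeg) n := by
  refine ⟨image_hodgeProj_one _, isDifferential_lieDiff m, isDifferential_assDiff m,
    theta_bijective 𝒦 _, fun x hx => assDiff_mem_hodgeSummand m hx, lieToAss 𝒦 _,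
    isLieToAss_lieToAss 𝒦 _, fun l' hl' => isLieToAss_unique 𝒦 _ (isLieToAss_lieToAss 𝒦 _) hl',
    lieToAss_lieDiff m, fun n x hx => lieToAss_homog 𝒦 _ hx,
    ⟨lieEquivHodge 𝒦 _, coe_lieEquivHodge 𝒦 _, fun n x => ⟨fun hx => ?_, lieToAss_homog 𝒦 _⟩⟩,
    assToLie 𝒦 _, assToLie_lieToAss 𝒦 _, assToLie_assDiff m, fun n x hx => assToLie_homog 𝒦 _ hx⟩
  rw [← assToLie_lieToAss 𝒦 _ x]
  exact assToLie_homog 𝒦 _ hx
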